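/- **Setting.** There are $Q\ge1$ secondary users and $N\ge1$ carriers. Data (for all $q,r,k$): $f_q>0$, $0<\tau_q^{\min}<\tau_q^{\max}<T_q$, $\mu_{q,k|0}<\mu_{q,k|1}$, $\sigma_{q,k|0},\sigma_{q,k|1}>0$, $0<\alpha_{q,k},\beta_q\le\frac12$, $\sigma^2_{q,k}>0$, channels $H_{qr}(k)\in\mathbb C$ with $H_{qq}(k)\ne0$, $G_{Pq}(k)\in\mathbb C$, $p^{\max}_{q,k}>0$, $P_q>0$, $I_q^{\max}>0$, $I^{\rm tot}>0$, $c\ge0$. Put $\mathcal Q(x)=\frac1{\sqrt{2\pi}}\int_x^\infty e^{-s^2/2}ds$, $\delta_{q,k}=\mu_{q,k|1}-\mu_{q,k|0}$, $\hat\sigma^2_{q,k}=\sigma^2_{q,k}/|H_{qq}(k)|^2$, $\hat H_{qr}=H_{qr}/H_{qq}$, $\hat\alpha_{q,k}=\mathcal Q^{-1}(1-\alpha_{q,k})$. User $q$ chooses $x_q=(\hat\tau_q,p_q,\varphi_q)\in\mathbb R^{N+2}$ ($\varphi_q$ is the false alarm probability, $p_q$ the power allocation). Let $$u_{q,k}(x_q)=\frac{\sigma_{q,k|0}\mathcal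 Q^{-1}(\varphi_q)-\delta_{q,k}\hat\tau_q}{\sigma_{q,k|1}},\qquad r_{q,k}(p)=\log\Big(1+\frac{p_{q,k}}{\hat\sigma^2_{q,k}+\sum_{r\ne q}|\hat H_{qr}(k)|^2p_{r,k}}\Big),$$ $$\theta_q(x)=\log\Big(\big(1-\tfrac{\hat\tau_q^2}{f_qT_q}\big)(1-\varphi_q)\sum_kr_{q,k}(p)\Big)-\frac c2\Big(\frac{\hat\tau_q}{\sqrt{f_q}}-\frac1Q\sum_r\frac{\hat\tau_r}{\sqrt{f_r}}\Big)^2\quad(\log0=-\infty),$$ $$I_q(x_q)=\sum_k\big(1-\mathcal Q(u_{q,k})\big)|G_{Pq}(k)|^2p_{q,k}-I_q^{\max},\qquad I(x)=\sum_q\sum_k\big(1-\mathcal Q(u_{q,k})\big)|G_{Pq}(k)|^2p_{q,k}-I^{\rm tot},$$ $\mathcal P_q=\{p\in\mathbb R^N:\sum_kp_k\le P_q,\ 0\le p_k\le p_{q,k}^{\max}\}$, $\mathcal Y_q$ the set of $x_q$ with $0<\varphi_q\le\beta_q$, $u_{q,k}(x_q)\le\hat\alpha_{q,k}$ for all $k$,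 $p_q\in\mathcal P_q$ and $\sqrt{\tau_q^{\min}f_q}\le\hat\tau_q\le\sqrt{\tau_q^{\max}f_q}$, and $\mathcal X_q=\{x_q\in\mathcal Y_q:I_q(x_q)\le0\}$, assumed nonempty for every $q$. A *Nash equilibrium* (NE) of the game $\mathcal G$ is a pair $(x,\pi)$ such that, for all $q$, $x_q$ maximizes $\theta_q-\pi I$ over $\mathcal X_q$ given $x_{-q}$, and $\pi\ge0$, $I(x)\le0$, $\pi I(x)=0$. For the truncated game $\mathcal G_t$ the condition on $\pi$ is instead that $\pi$ maximizes $\pi'\mapsto\pi'I(x)$ over $[0,t]$. With $\mathcal L_q=-\theta_q+\lambda_qI_q+\pi I$, let $A(x,\lambda,\pi)$ be the Jacobian matrix, with respect to $x$, of $(\nabla_{x_q}\mathcal L_q)_{q=1}^Q$. **Constants.** Let $$r_q^{\min}=\min_k\frac1{p_{q,k}^{\max}}\log\Big(1+\frac{p_{q,k}^{\max}}{\hat\sigma_{q,k}^2+\sum_{r\ne q}|\hat H_{qr}(k)|^2p_{r,k}^{\max}}\Big),\qquad r_q^{\max}=\sum_k\log\Big(1+\frac{p_{q,k}^{\max}}{\hat\sigma^2_{q,k}}\Big),$$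 $$\lambda^{\max}=\sum_q\frac{1/\min\{I^{\rm tot},\min_rI_r^{\max},\min_{r,k}p_{r,k}^{\max}\}}{r_q^{\min}\min_k\hat\sigma^2_{q,k}}.$$ Fix $t>\lambda^{\max}$ and, for each $q$, a nonzero $p_q^{\rm ref}\in\mathcal P_q$ with $\sum_k|G_{Pq}(k)|^2p^{\rm ref}_{q,k}\le2I_q^{\max}$. Put $$d_{\hat\tau_q}=\frac{\frac2{f_qT_q}\big(1+\tau_q^{\min}/T_q\big)}{\big(1-\tau_q^{\min}/T_q\big)^2},\quad d_{q,k}=\frac{1/r_q^{\max}}{\big(\hat\sigma^2_{q,k}+\sum_{r=1}^Q|\hat H_{qr}(k)|^2p^{\max}_{r,k}\big)^2},\quad d_{\varphi_q}=\Big(1-\min_k\mathcal Q\big(\tfrac{\delta_{q,k}\sqrt{f_q\tau_q^{\max}}}{\sigma_{q,k|0}}\big)\Big)^{-2},$$ $$e_{q,k}=\exp\Big(\tfrac12\big(\tfrac{\delta_{q,k}}{\sigma_{q,k|0}}\sqrt{f_q\tau_q^{\max}}\big)^2\Big),\quad\omega_{q,k}=\frac{\delta_{q,k}}{\sqrt{2\pi}\,\sigma_{q,k|1}},\quad\omega'_{q,k}=\frac{\sigma_{q,k|0}}{\sigma_{q,k|1}}e_{q,k},$$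 $$\omega''_{q,k}=\frac{\sigma_{q,k|0}\delta_{q,k}}{\sigma_{q,k|1}^2}\max\Big\{\mathcal Q^{-1}(\alpha_{q,k}),\tfrac{\delta_{q,k}}{\sigma_{q,k|1}}\sqrt{f_q\tau_q^{\max}}\Big\}e_{q,k},$$ $$S_{\hat\tau_q}=2\sum_k(\omega_{q,k}+\omega''_{q,k}p^{\max}_{q,k}),\quad S_{q,k}=2(\omega_{q,k}+\omega'_{q,k}),\quad S_{\varphi_q}=2\sum_k(\omega''_{q,k}p^{\max}_{q,k}+\omega'_{q,k}),$$ $$\eta_q=\log\Big(1-\frac{\tau_q^{\min}}{T_q}\Big)+\log\Big(1-\max_k\mathcal Q\big(\tfrac{\sigma_{q,k|1}\hat\alpha_{q,k}+\delta_{q,k}\sqrt{f_q\tau_q^{\min}}}{\sigma_{q,k|0}}\big)\Big)+\log\sum_kr_{q,k}(p_q^{\rm ref},p_{-q}^{\max})-\frac t2\sum_k|G_{Pq}(k)|^2p_{q,k}^{\rm ref},$$ $\ell_q=(\min_k\hat\sigma^2_{q,k})e^{\eta_q}$, $r_q^{\rm low}=\ell_qr_q^{\min}$, $$\zeta=\max_q\Big\{\max_k\frac1{\hat\sigma^2_{q,k}}\Big(\frac1{r_q^{\rm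 low}}+\frac1{r_q^{\rm low}r_q^{\min}}\sum_k\frac1{\hat\sigma^2_{q,k}}\Big)\Big\},$$ $$\gamma_q^{(1)}=\frac{2I^{\rm tot}\max(t,\lambda^{\max})}{\min\{d_{\hat\tau_q}/S_{\hat\tau_q},\ \min_kd_{q,k}/S_{q,k},\ d_{\varphi_q}/S_{\varphi_q}\}},\qquad\gamma_q^{(2)}=\frac{\zeta}{2tI^{\rm tot}}\cdot\frac{\gamma_q^{(1)}}{\min\{S_{\hat\tau_q},\min_kS_{q,k},S_{\varphi_q}\}}.$$ These are positive. Let $\widehat{\mathcal Y}^t$ be the set of $x\in\prod_q\mathcal Y_q$ with $\sum_kp_{q,k}\ge\ell_q$ for all $q$. **Corollary.** Suppose that for every $q$ $$\gamma_q^{(1)}\max_k\frac{|G_{Pq}(k)|^2}{I^{\rm tot}}+\gamma_q^{(2)}\sum_{r\ne q}\Big(\max_k\frac{|H_{qr}(k)|^2}{\sigma^2_{q,k}}+\max_k\frac{|H_{rq}(k)|^2}{\sigma^2_{r,k}}\Big)<1.$$ Then $A(x,\lambda,\pi)$ is positive definite ($y^TAy>0$ for all $y\ne0$) for all $x\in\widehat{\mathcal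 Y}^t$, $\lambda\in[0,\lambda^{\max}]^Q$ and $\pi\in[0,t]$. Moreover every NE of $\mathcal G_t$ is a NE of $\mathcal G$; $\mathcal G$ has a NE; every NE $(x,\pi)$ of $\mathcal G$ has $x\in\widehat{\mathcal Y}^t$ and $\pi\le t$; and the $x$-component of the NE of $\mathcal G$ is unique. -/

import Mathlib

noncomputable section

open scoped BigOperators

/-- The Gaussian tail function `Q(x) = (1/√(2π)) ∫_x^∞ exp(-t²/2) dt`. -/
def gaussQ (x : ℝ) : ℝ :=
  (√(2 * Real.pi))⁻¹ * ∫ t in Set.Ioi x, Real.exp (-t ^ 2 / 2)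

/-- The inverse of the strictly decreasing bijection `gaussQ : ℝ → (0, 1)`;
it is only ever used at arguments in `(0, 1)`. -/
def gaussQinv : ℝ → ℝ := Function.invFun gaussQ

/-- Data of a cognitive radio network with `Q` secondary users and `N` subcarriers. -/
structure CRSystem (Q N : ℕ) where
  /-- sampling frequencies -/
  f : Fin Q → ℝ
  /-- frame durations -/
  T : Fin Q → ℝ
  /-- smallest admissible sensing times -/
  tauMin : Fin Q → ℝ
  /-- largest admissible sensing times -/
  tauMax : Fin Q → ℝ
  /-- mean of the decision variable when the primary signal is absent -/
  mu0 : Fin Q → Fin N → ℝ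
  /-- mean of the decision variable when the primary signal is present -/
  mu1 : Fin Q → Fin N → ℝ
  /-- standard deviation when the primary signal is absent -/
  sd0 : Fin Q → Fin N → ℝ
  /-- standard deviation when the primary signal is present -/
  sd1 : Fin Q → Fin N → ℝ
  /-- largest admissible missed detection probabilities -/
  alpha : Fin Q → Fin N → ℝ
  /-- largest admissible false alarm probabilities -/
  beta : Fin Q → ℝ
  /-- noise power spectral densities `σ²_{q,k}` -/
  noise : Fin Q → Fin N → ℝ
  /-- `H q r k`: channel from the secondary transmitter `r` to the secondary receiver `q` -/
  H : Fin Q → Fin Q → Fin N → ℂ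
  /-- `G q k`: channel from the secondary transmitter `q` to the primary receiver -/
  G : Fin Q → Fin N → ℂ
  /-- spectral masks -/
  pMax : Fin Q → Fin N → ℝ
  /-- power budgets -/
  budget : Fin Q → ℝ
  /-- individual interference thresholds `I_q^max` -/
  Imax : Fin Q → ℝ
  /-- threshold of the global interference constraint -/
  Itot : ℝ
  /-- weight of the equi-sensing penalty -/
  c : ℝ

/-- The coordinates of one user's strategy: `τ̂`, the powers `p_k`, and `P^fa`. -/
abbrev Coord (N : ℕ) : Type := Unit ⊕ Fin N ⊕ Unit

/-- A strategy `(τ̂, p, P^fa)` of one user. -/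
abbrev Strategy (N : ℕ) : Type := Coord N → ℝ

/-- A strategy profile of all the users. -/
abbrev Profile (Q N : ℕ) : Type := Fin Q → Strategy N

namespace Strategy

variable {N : ℕ}

/-- normalized sensing time `τ̂ = √(τ f)` -/
def tau (z : Strategy N) : ℝ := z (Sum.inl ())

/-- power on the carrier `k` -/
def pow (z : Strategy N) (k : Fin N) : ℝ := z (Sum.inr (Sum.inl k))

/-- false alarm probability -/
def fa (z : Strategy N) : ℝ := z (Sum.inr (Sum.inr ()))

end Strategy

namespace CRSystem

variable {Q N : ℕ} (S : CRSystem Q N)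

/-- Standing assumptions on the data. -/
structure Valid : Prop where
  f_pos : ∀ q, 0 < S.f q
  tauMin_pos : ∀ q, 0 < S.tauMin q
  tauMin_lt : ∀ q, S.tauMin q < S.tauMax q
  tauMax_lt : ∀ q, S.tauMax q < S.T q
  mu_lt : ∀ q k, S.mu0 q k < S.mu1 q k
  sd0_pos : ∀ q k, 0 < S.sd0 q k
  sd1_pos : ∀ q k, 0 < S.sd1 q k
  alpha_pos : ∀ q k, 0 < S.alpha q k
  alpha_le : ∀ q k, S.alpha q k ≤ 1 / 2
  beta_pos : ∀ q, 0 < S.beta q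
  beta_le : ∀ q, S.beta q ≤ 1 / 2
  noise_pos : ∀ q k, 0 < S.noise q k
  direct_ne : ∀ q k, S.H q q k ≠ 0
  pMax_pos : ∀ q k, 0 < S.pMax q k
  budget_pos : ∀ q, 0 < S.budget q
  Imax_pos : ∀ q, 0 < S.Imax q
  Itot_pos : 0 < S.Itot
  c_nonneg : 0 ≤ S.c

/-! ### Rates, interference and payoffs -/

/-- `σ̂²_{q,k} = σ²_{q,k} / |H_qq(k)|²` -/
def nNoise (q : Fin Q) (k : Fin N) : ℝ := S.noise q k / ‖S.H q q k‖ ^ 2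

/-- `|Ĥ_qr(k)|² = |H_qr(k) / H_qq(k)|²` -/
def nGain (q r : Fin Q) (k : Fin N) : ℝ := ‖S.H q r k / S.H q q k‖ ^ 2

/-- weight `w_{q,k} = |G_{P,q}(k)|²` of the interference constraints -/
def w (q : Fin Q) (k : Fin N) : ℝ := ‖S.G q k‖ ^ 2

/-- `μ_{q,k|1} - μ_{q,k|0}` -/
def dmu (q : Fin Q) (k : Fin N) : ℝ := S.mu1 q k - S.mu0 q k

/-- `τ̂_q^min = √(τ_q^min f_q)` -/
def htauMin (q : Fin Q) : ℝ := √(S.tauMin q * S.f q)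

/-- `τ̂_q^max = √(τ_q^max f_q)` -/
def htauMax (q : Fin Q) : ℝ := √(S.tauMax q * S.f q)

/-- `α̂_{q,k} = Q⁻¹(1 - α_{q,k})` -/
def hAlpha (q : Fin Q) (k : Fin N) : ℝ := gaussQinv (1 - S.alpha q k)

/-- maximal information rate `r_{q,k}(p)` of the link `q` on the carrier `k` -/
def rate (p : Fin Q → Fin N → ℝ) (q : Fin Q) (k : Fin N) : ℝ :=
  Real.log (1 + p q k /
    (S.nNoise q k + ∑ r ∈ Finset.univ.erase q, S.nGain q r k * p r k))

/-- `(σ_{q,k|0} Q⁻¹(P^fa) - (μ_{q,k|1} - μ_{q,k|0}) τ̂) / σ_{q,k|1}` -/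
def detArg (q : Fin Q) (k : Fin N) (z : Strategy N) : ℝ :=
  (S.sd0 q k * gaussQinv z.fa - S.dmu q k * z.tau) / S.sd1 q k

/-- missed detection probability -/
def pMiss (q : Fin Q) (k : Fin N) (z : Strategy N) : ℝ := 1 - gaussQ (S.detArg q k z)

/-- opportunistic throughput of the user `q` -/
def throughput (q : Fin Q) (x : Profile Q N) : ℝ :=
  (1 - (x q).tau ^ 2 / (S.f q * S.T q)) * (1 - (x q).fa) *
    ∑ k, S.rate (fun r => (x r).pow) q k

/-- payoff `θ_q`, at profiles where the throughput of the user `q` is positive -/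
def theta (q : Fin Q) (x : Profile Q N) : ℝ :=
  Real.log (S.throughput q x) -
    S.c / 2 * ((x q).tau / √(S.f q) - 1 / (Q : ℝ) * ∑ r, (x r).tau / √(S.f r)) ^ 2

/-- local interference violation `I_q` -/
def localI (q : Fin Q) (z : Strategy N) : ℝ :=
  ∑ k, S.pMiss q k z * S.w q k * z.pow k - S.Imax q

/-- global interference violation `I` -/
def globalI (x : Profile Q N) : ℝ :=
  ∑ k, ∑ q, S.pMiss q k (x q) * S.w q k * (x q).pow k - S.Itot

/-! ### Strategy sets -/

/-- the set `𝒫_q` of admissible power allocations -/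
def powerSet (q : Fin Q) : Set (Fin N → ℝ) :=
  {p | ∑ k, p k ≤ S.budget q ∧ ∀ k, 0 ≤ p k ∧ p k ≤ S.pMax q k}

/-- the convex part `𝒴_q` of the strategy set; `0 < P^fa` is the domain of `Q⁻¹` -/
def Y (q : Fin Q) : Set (Strategy N) :=
  {z | 0 < z.fa ∧ z.fa ≤ S.beta q ∧ (∀ k, S.detArg q k z ≤ S.hAlpha q k) ∧
    z.pow ∈ S.powerSet q ∧ S.htauMin q ≤ z.tau ∧ z.tau ≤ S.htauMax q}

/-- the strategy set `𝒳_q` -/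
def X (q : Fin Q) : Set (Strategy N) := {z | z ∈ S.Y q ∧ S.localI q z ≤ 0}

/-! ### Games and equilibria -/

/-- What the user `q` maximizes at the price `π`: `θ_q - π I`, which is `-∞` where the
throughput (whose logarithm enters `θ_q`) vanishes. -/
def payoff (q : Fin Q) (x : Profile Q N) (price : ℝ) : EReal :=
  if 0 < S.throughput q x then ((S.theta q x - price * S.globalI x : ℝ) : EReal) else ⊥

/-- every user plays a best response at the given price -/
def BestResponses (x : Profile Q N) (price : ℝ) : Prop :=
  ∀ q, x q ∈ S.X q ∧
    ∀ z ∈ S.X q, S.payoff q (Function.update x q z) price ≤ S.payoff q x price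

/-- Nash equilibrium of the game with the price complementarity condition -/
def IsNE (x : Profile Q N) (price : ℝ) : Prop :=
  S.BestResponses x price ∧ 0 ≤ price ∧ S.globalI x ≤ 0 ∧ price * S.globalI x = 0

/-- Nash equilibrium of the price-truncated game -/
def IsTruncNE (t : ℝ) (x : Profile Q N) (price : ℝ) : Prop :=
  S.BestResponses x price ∧ price ∈ Set.Icc 0 t ∧
    ∀ m ∈ Set.Icc 0 t, m * S.globalI x ≤ price * S.globalI x

/-! ### The matrix `A` -/

/-- Lagrangian of the user `q` -/
def lagrangian (q : Fin Q) (lam price : ℝ) (x : Profile Q N) : ℝ :=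
  -S.theta q x + lam * S.localI q (x q) + price * S.globalI x

/-- partial derivative of a function of the profile with respect to `x_{q,i}` -/
def partialD (F : Profile Q N → ℝ) (q : Fin Q) (i : Coord N) (x : Profile Q N) : ℝ :=
  fderiv ℝ F x (Pi.single q (Pi.single i 1))

/-- the Jacobian matrix `A(x, λ, π)` of `x ↦ (∇_{x_q} L_q)_q` -/
def A (x : Profile Q N) (lam : Fin Q → ℝ) (price : ℝ) :
    Matrix (Fin Q × Coord N) (Fin Q × Coord N) ℝ :=
  Matrix.of fun a b =>
    partialD (fun y => partialD (S.lagrangian a.1 (lam a.1) price) a.1 a.2 y) b.1 b.2 x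

/-! ### The constants -/

/-- `min_k log(1 + p^max_{q,k} / (σ̂²_{q,k} + ∑_{r≠q} |Ĥ_qr(k)|² p^max_{r,k})) / p^max_{q,k}` -/
def rMin (q : Fin Q) : ℝ := ⨅ k, S.rate S.pMax q k / S.pMax q k

/-- `∑_k log(1 + p^max_{q,k} / σ̂²_{q,k})` -/
def rMax (q : Fin Q) : ℝ := ∑ k, Real.log (1 + S.pMax q k / S.nNoise q k)

/-- bound `λ^max` on the multipliers and on the price -/
def lambdaMax : ℝ :=
  ∑ q, (1 / min S.Itot (⨅ r, min (S.Imax r) (⨅ k, S.pMax r k))) /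
    (S.rMin q * ⨅ k, S.nNoise q k)

/-- lower bound of the false alarm probability -/
def faMin (q : Fin Q) : ℝ := ⨅ k, gaussQ (S.dmu q k * √(S.f q * S.tauMax q) / S.sd0 q k)

/-- lower bound of the curvature of the payoff in `τ̂_q` -/
def dTau (q : Fin Q) : ℝ :=
  2 / (S.f q * S.T q) * (1 + S.tauMin q / S.T q) / (1 - S.tauMin q / S.T q) ^ 2

/-- lower bound of the curvature of the payoff in `p_{q,k}` -/
def dPow (q : Fin Q) (k : Fin N) : ℝ :=
  (1 / S.rMax q) / (S.nNoise q k + ∑ r, S.nGain q r k * S.pMax r k) ^ 2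

/-- lower bound of the curvature of the payoff in `P_q^fa` -/
def dFa (q : Fin Q) : ℝ := 1 / (1 - S.faMin q) ^ 2

/-- bound of `|∂ P^miss / ∂ τ̂|` -/
def omTau (q : Fin Q) (k : Fin N) : ℝ := 1 / √(2 * Real.pi) * (S.dmu q k / S.sd1 q k)

/-- bound of `|∂ P^miss / ∂ P^fa|` -/
def omFa (q : Fin Q) (k : Fin N) : ℝ :=
  S.sd0 q k / S.sd1 q k *
    Real.exp ((S.dmu q k / S.sd0 q k * √(S.f q * S.tauMax q)) ^ 2 / 2)

/-- bound of `|∂² P^miss / ∂ τ̂ ∂ P^fa|` -/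
def omTauFa (q : Fin Q) (k : Fin N) : ℝ :=
  S.sd0 q k * S.dmu q k / S.sd1 q k ^ 2 *
    max (gaussQinv (S.alpha q k)) (S.dmu q k / S.sd1 q k * √(S.f q * S.tauMax q)) *
    Real.exp ((S.dmu q k / S.sd0 q k * √(S.f q * S.tauMax q)) ^ 2 / 2)

/-- row sum of the off-diagonal bound matrix of `∇² I_q`, first row -/
def sumTau (q : Fin Q) : ℝ := 2 * (∑ k, S.omTau q k + ∑ k, S.omTauFa q k * S.pMax q k)

/-- row sum of the off-diagonal bound matrix of `∇² I_q`, row of the carrier `k` -/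
def sumPow (q : Fin Q) (k : Fin N) : ℝ := 2 * (S.omTau q k + S.omFa q k)

/-- row sum of the off-diagonal bound matrix of `∇² I_q`, last row -/
def sumFa (q : Fin Q) : ℝ := 2 * (∑ k, S.omTauFa q k * S.pMax q k + ∑ k, S.omFa q k)

/-- reference false alarm probability -/
def faRef (q : Fin Q) : ℝ :=
  ⨆ k, gaussQ ((S.sd1 q k * S.hAlpha q k + S.dmu q k * √(S.f q * S.tauMin q)) / S.sd0 q k)

/-- admissible reference power allocations of the user `q` -/
def IsRefPower (q : Fin Q) (p : Fin N → ℝ) : Prop :=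
  p ∈ S.powerSet q ∧ p ≠ 0 ∧ ∑ k, S.w q k * p k ≤ 2 * S.Imax q

/-- `η_q^ref(t)` -/
def etaRef (pRef : Fin Q → Fin N → ℝ) (t : ℝ) (q : Fin Q) : ℝ :=
  Real.log (1 - S.tauMin q / S.T q) + Real.log (1 - S.faRef q) +
    Real.log (∑ k, S.rate (Function.update S.pMax q (pRef q)) q k) -
    t / 2 * ∑ k, S.w q k * pRef q k

/-- lower bound of the sum power of the user `q` at an equilibrium -/
def powLow (pRef : Fin Q → Fin N → ℝ) (t : ℝ) (q : Fin Q) : ℝ :=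
  (⨅ k, S.nNoise q k) * Real.exp (S.etaRef pRef t q)

/-- lower bound of the total rate of the user `q` at an equilibrium -/
def rLow (pRef : Fin Q → Fin N → ℝ) (t : ℝ) (q : Fin Q) : ℝ :=
  S.powLow pRef t q * S.rMin q

/-- the profiles in `∏_q 𝒴_q` with sum powers at least `powLow` -/
def Yhat (pRef : Fin Q → Fin N → ℝ) (t : ℝ) : Set (Profile Q N) :=
  {x | ∀ q, x q ∈ S.Y q ∧ S.powLow pRef t q ≤ ∑ k, (x q).pow k}

/-- `ζ(t)` -/
def zeta (pRef : Fin Q → Fin N → ℝ) (t : ℝ) : ℝ :=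
  ⨆ q, (⨆ k, 1 / S.nNoise q k) *
    (1 / S.rLow pRef t q +
      1 / S.rLow pRef t q * (1 / S.rMin q) * ∑ k, 1 / S.nNoise q k)

/-- `γ_q^(1)` -/
def gamma1 (t : ℝ) (q : Fin Q) : ℝ :=
  S.Itot * (2 * max t S.lambdaMax) /
    min (S.dTau q / S.sumTau q)
      (min (⨅ k, S.dPow q k / S.sumPow q k) (S.dFa q / S.sumFa q))

/-- `ζ_q^max(t)` -/
def zetaMax (pRef : Fin Q → Fin N → ℝ) (t : ℝ) (q : Fin Q) : ℝ :=
  S.zeta pRef t / (2 * t * S.Itot) *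
    (1 / min (S.sumTau q) (min (⨅ k, S.sumPow q k) (S.sumFa q)))

/-- `γ_q^(2)` -/
def gamma2 (pRef : Fin Q → Fin N → ℝ) (t : ℝ) (q : Fin Q) : ℝ :=
  S.zetaMax pRef t q * S.gamma1 t q

end CRSystem

end

/-! The equilibria are the solutions of a variational inequality whose map is strictly monotone in
the strategies.

Positive definiteness. Since `y ⬝ᵥ A *ᵥ y` is the sum over users of the second derivative `d2Lag`,
once along the user's own direction and once along the whole of `y`, estimates of these suffice. The
payoff contributes the diagonal curvatures `dTau`, `dPow`, `dFa` (`neg_d2Theta_ge`). On `Y` the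
missed detection probability is convex, because its argument is nonpositive and the inverse tail
function is convex on `(0, 1/2]`; so only the mixed terms between powers and sensing variables of
the interference can be negative, and Young's inequality absorbs them (`d2Interf_ge`). The coupling
between users is of size `zeta` times link gain, provided the rates stay away from zero
(`crossTerm_ge`); the equi-sensing penalties sum to a nonnegative form. Weak coupling says that the
curvature beats all of this (`sum_d2Lag_pos`).

Games. Adjoin multipliers `λ_q` in `[0, lambdaMax]` and a price in `[0, t]`. In the derivative of
the extended map the multipliers couple to the strategies skew-symmetrically, so the map is
monotone, strictly in `x` (`extMap_lt`), and the inequality on a compact convex set has a solution.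
Such a solution is an equilibrium because none of the artificial bounds matters: comparison with
`pRef` shows that the lower bound on the power is inactive (`UserVI.powLow_lt`), and the test
direction towards zero power bounds the multipliers (`UserVI.localI_nonpos`,
`BestResponses.price_le`). Strict convexity of the Lagrangian in the user's own strategy turns
first-order conditions into best responses.

Uniqueness. A given equilibrium is shown to solve the same variational inequality. The multiplier of
a user comes from solving the inequality with the other users and the price frozen; the solution
found there must be the equilibrium strategy itself (`IsNE.exists_userVI`). Two equilibria then
contradict strict monotonicity unless their profiles agree. -/

/-! ### The Gaussian tail function and its inverse -/

noncomputable section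

/-- The density of the standard normal distribution. -/
def gaussPdf (x : ℝ) : ℝ := (√(2 * Real.pi))⁻¹ * Real.exp (-x ^ 2 / 2)

lemma sqrt_two_pi_pos : 0 < √(2 * Real.pi) := by positivity

lemma gaussPdf_pos (x : ℝ) : 0 < gaussPdf x :=
  mul_pos (inv_pos.2 sqrt_two_pi_pos) (Real.exp_pos _)

lemma gaussPdf_le (x : ℝ) : gaussPdf x ≤ (√(2 * Real.pi))⁻¹ := by
  unfold gaussPdf
  have : Real.exp (-x ^ 2 / 2) ≤ 1 := Real.exp_le_one_iff.2 (by nlinarith [sq_nonneg x])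
  have h := inv_pos.2 sqrt_two_pi_pos
  nlinarith

lemma integrable_exp_neg_sq_half : MeasureTheory.Integrable (fun t : ℝ => Real.exp (-t ^ 2 / 2)) := by
  have := integrable_exp_neg_mul_sq (b := 1 / 2) (by norm_num)
  refine this.congr (Filter.Eventually.of_forall fun x => ?_)
  simp only
  congr 1
  ring

lemma integral_exp_neg_sq_half_Ioi :
    ∫ t in Set.Ioi (0 : ℝ), Real.exp (-t ^ 2 / 2) = √(2 * Real.pi) / 2 := by
  have := integral_gaussian_Ioi (1 / 2)
  rw [show Real.pi / (1 / 2) = 2 * Real.pi by ring] at this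
  rw [← this]
  congr 1
  ext x
  congr 1
  ring

/-- With a proper integral and a variable endpoint, the derivative follows from the fundamental
theorem of calculus and the symmetry from a change of sign. -/
lemma gaussQ_eq (x : ℝ) :
    gaussQ x = 1 / 2 - (√(2 * Real.pi))⁻¹ * ∫ t in (0 : ℝ)..x, Real.exp (-t ^ 2 / 2) := by
  have h := intervalIntegral.integral_interval_add_Ioi (a := 0) (b := x)
    (integrable_exp_neg_sq_half.integrableOn) (integrable_exp_neg_sq_half.integrableOn)
  have h0 := sqrt_two_pi_pos
  rw [integral_exp_neg_sq_half_Ioi] at h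
  unfold gaussQ
  rw [show (∫ t in Set.Ioi x, Real.exp (-t ^ 2 / 2)) =
    √(2 * Real.pi) / 2 - ∫ t in (0 : ℝ)..x, Real.exp (-t ^ 2 / 2) by linarith]
  field_simp

lemma gaussQ_zero : gaussQ 0 = 1 / 2 := by simp [gaussQ_eq]

lemma hasDerivAt_gaussQ (x : ℝ) : HasDerivAt gaussQ (-gaussPdf x) x := by
  have hc : Continuous fun t : ℝ => Real.exp (-t ^ 2 / 2) := by fun_prop
  have h := (hc.integral_hasStrictDerivAt 0 x).hasDerivAt
  have := (h.const_mul (√(2 * Real.pi))⁻¹).const_sub (1 / 2)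
  exact this.congr_of_eventuallyEq (Filter.Eventually.of_forall gaussQ_eq)

lemma continuous_gaussQ : Continuous gaussQ :=
  continuous_iff_continuousAt.2 fun x => (hasDerivAt_gaussQ x).continuousAt

lemma gaussQ_strictAnti : StrictAnti gaussQ :=
  strictAnti_of_deriv_neg fun x => by
    rw [(hasDerivAt_gaussQ x).deriv]; linarith [gaussPdf_pos x]

lemma gaussQ_neg (x : ℝ) : gaussQ (-x) = 1 - gaussQ x := by
  have h : ∫ t in (0 : ℝ)..-x, Real.exp (-t ^ 2 / 2) =
      -∫ t in (0 : ℝ)..x, Real.exp (-t ^ 2 / 2) := by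
    have := intervalIntegral.integral_comp_neg (a := 0) (b := x)
      (fun t : ℝ => Real.exp (-t ^ 2 / 2))
    simp only [neg_sq, neg_zero] at this
    rw [this, intervalIntegral.integral_symm]
  rw [gaussQ_eq, gaussQ_eq, h]
  ring

lemma gaussQ_tendsto_atTop : Filter.Tendsto gaussQ Filter.atTop (nhds 0) := by
  have h := MeasureTheory.intervalIntegral_tendsto_integral_Ioi (0 : ℝ)
    integrable_exp_neg_sq_half.integrableOn Filter.tendsto_id
  rw [integral_exp_neg_sq_half_Ioi] at h
  have := (h.const_mul (√(2 * Real.pi))⁻¹).const_sub (1 / 2)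
  have h0 := sqrt_two_pi_pos
  rw [show (1 / 2 - (√(2 * Real.pi))⁻¹ * (√(2 * Real.pi) / 2)) = 0 by field_simp; norm_num] at this
  exact this.congr fun x => (gaussQ_eq x).symm

lemma gaussQ_pos (x : ℝ) : 0 < gaussQ x :=
  lt_of_le_of_lt (gaussQ_strictAnti.antitone.le_of_tendsto gaussQ_tendsto_atTop (x + 1))
    (gaussQ_strictAnti (by linarith))

lemma gaussQ_lt_one (x : ℝ) : gaussQ x < 1 := by
  have := gaussQ_pos (-x)
  rw [gaussQ_neg] at this
  linarith

lemma exists_gaussQ_eq {y : ℝ} (h0 : 0 < y) (h1 : y < 1) : ∃ x, gaussQ x = y := by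
  have small : ∀ z : ℝ, 0 < z → ∃ a, gaussQ a < z := fun z hz =>
    (gaussQ_tendsto_atTop.eventually (gt_mem_nhds hz)).exists
  obtain ⟨a, ha⟩ := small y h0
  obtain ⟨b, hb⟩ := small (1 - y) (by linarith)
  exact mem_range_of_exists_le_of_exists_ge continuous_gaussQ ⟨a, ha.le⟩
    ⟨-b, by rw [gaussQ_neg]; linarith⟩

lemma gaussQ_gaussQinv {y : ℝ} (h0 : 0 < y) (h1 : y < 1) : gaussQ (gaussQinv y) = y :=
  Function.invFun_eq (exists_gaussQ_eq h0 h1)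

lemma gaussQinv_le_iff {y x : ℝ} (h0 : 0 < y) (h1 : y < 1) : gaussQinv y ≤ x ↔ gaussQ x ≤ y := by
  conv_rhs => rw [← gaussQ_gaussQinv h0 h1]
  exact gaussQ_strictAnti.le_iff_ge.symm

lemma le_gaussQinv_iff {y x : ℝ} (h0 : 0 < y) (h1 : y < 1) : x ≤ gaussQinv y ↔ y ≤ gaussQ x := by
  conv_rhs => rw [← gaussQ_gaussQinv h0 h1]
  exact gaussQ_strictAnti.le_iff_ge.symm

lemma gaussQinv_nonneg {y : ℝ} (h0 : 0 < y) (h1 : y ≤ 1 / 2) : 0 ≤ gaussQinv y := by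
  rw [le_gaussQinv_iff h0 (by linarith), gaussQ_zero]; exact h1

lemma gaussQinv_nonpos {y : ℝ} (h0 : 1 / 2 ≤ y) (h1 : y < 1) : gaussQinv y ≤ 0 := by
  rw [gaussQinv_le_iff (by linarith) h1, gaussQ_zero]; exact h0

/-- The derivative of `gaussQinv`. -/
def gaussQinvDeriv (y : ℝ) : ℝ := -(√(2 * Real.pi) * Real.exp (gaussQinv y ^ 2 / 2))

lemma gaussQinvDeriv_neg (y : ℝ) : gaussQinvDeriv y < 0 :=
  neg_lt_zero.2 (mul_pos sqrt_two_pi_pos (Real.exp_pos _))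

lemma continuousAt_gaussQinv {y : ℝ} (h0 : 0 < y) (h1 : y < 1) : ContinuousAt gaussQinv y := by
  have hev : ∀ᶠ z in nhds y, 0 < z ∧ z < 1 := (lt_mem_nhds h0).and (gt_mem_nhds h1)
  rw [ContinuousAt, tendsto_order]
  constructor
  · intro a ha
    have hy : y < gaussQ a := by
      rw [← gaussQ_gaussQinv h0 h1]; exact gaussQ_strictAnti ha
    filter_upwards [hev, gt_mem_nhds hy] with z hz hza
    by_contra hcon
    rw [not_lt, gaussQinv_le_iff hz.1 hz.2] at hcon
    linarith
  · intro a ha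
    have hy : gaussQ a < y := by
      conv_rhs => rw [← gaussQ_gaussQinv h0 h1]
      exact gaussQ_strictAnti ha
    filter_upwards [hev, lt_mem_nhds hy] with z hz hza
    by_contra hcon
    rw [not_lt, le_gaussQinv_iff hz.1 hz.2] at hcon
    linarith

lemma hasDerivAt_gaussQinv {y : ℝ} (h0 : 0 < y) (h1 : y < 1) :
    HasDerivAt gaussQinv (gaussQinvDeriv y) y := by
  have hev : ∀ᶠ z in nhds y, 0 < z ∧ z < 1 := (lt_mem_nhds h0).and (gt_mem_nhds h1)
  have := HasDerivAt.of_local_left_inverse (continuousAt_gaussQinv h0 h1)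
    (hasDerivAt_gaussQ (gaussQinv y)) (by linarith [gaussPdf_pos (gaussQinv y)])
    (hev.mono fun z hz => gaussQ_gaussQinv hz.1 hz.2)
  refine this.congr_deriv ?_
  unfold gaussQinvDeriv gaussPdf
  rw [inv_neg, mul_inv, inv_inv, ← Real.exp_neg]
  congr 3
  ring

/-- The second derivative of `gaussQinv`. -/
def gaussQinvDeriv2 (y : ℝ) : ℝ := gaussQinvDeriv y * (gaussQinv y * gaussQinvDeriv y)

lemma hasDerivAt_gaussQinvDeriv {y : ℝ} (h0 : 0 < y) (h1 : y < 1) :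
    HasDerivAt gaussQinvDeriv (gaussQinvDeriv2 y) y := by
  have h := ((((hasDerivAt_gaussQinv h0 h1).pow 2).div_const 2).exp.const_mul
    (√(2 * Real.pi))).neg
  refine h.congr_deriv ?_
  have e : gaussQinvDeriv y = -(√(2 * Real.pi) * Real.exp (gaussQinv y ^ 2 / 2)) := rfl
  unfold gaussQinvDeriv2
  nth_rewrite 2 [e]
  simp only [Pi.pow_apply]
  push_cast
  ring

/-- The second derivative is the inverse times the square of its first derivative, hence has the
sign of the inverse. The bounds `beta ≤ 1 / 2` enter the convexity of the missed detection
probability here. -/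
lemma gaussQinvDeriv2_nonneg {y : ℝ} (h0 : 0 < y) (h1 : y ≤ 1 / 2) : 0 ≤ gaussQinvDeriv2 y := by
  have := gaussQinv_nonneg h0 h1
  have h2 := gaussQinvDeriv_neg y
  unfold gaussQinvDeriv2
  nlinarith [mul_nonneg this (mul_self_nonneg (gaussQinvDeriv y))]

lemma hasDerivAt_gaussPdf (x : ℝ) : HasDerivAt gaussPdf (-x * gaussPdf x) x := by
  have h : HasDerivAt (fun x : ℝ => -x ^ 2 / 2) (-(2 * x) / 2) x := by
    simpa using ((hasDerivAt_pow 2 x).neg.div_const 2)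
  refine (h.exp.const_mul (√(2 * Real.pi))⁻¹).congr_deriv ?_
  unfold gaussPdf
  ring

lemma contDiff_gaussPdf {n : WithTop ℕ∞} : ContDiff ℝ n gaussPdf := by
  unfold gaussPdf
  fun_prop

lemma contDiff_two_gaussQ : ContDiff ℝ 2 gaussQ := by
  rw [show (2 : WithTop ℕ∞) = 1 + 1 by norm_num, contDiff_succ_iff_deriv]
  refine ⟨fun x => (hasDerivAt_gaussQ x).differentiableAt, by simp, ?_⟩
  rw [show deriv gaussQ = fun x => -gaussPdf x from funext fun x => (hasDerivAt_gaussQ x).deriv]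
  exact contDiff_gaussPdf.neg

/-- Bootstrap: the derivative is a smooth function of `gaussQinv` itself, so each order of
regularity yields the next. -/
lemma contDiffOn_two_gaussQinv : ContDiffOn ℝ 2 gaussQinv (Set.Ioo 0 1) := by
  have hd : DifferentiableOn ℝ gaussQinv (Set.Ioo 0 1) := fun y hy =>
    (hasDerivAt_gaussQinv hy.1 hy.2).differentiableAt.differentiableWithinAt
  have hd' : ∀ n : WithTop ℕ∞, ContDiffOn ℝ n gaussQinv (Set.Ioo 0 1) →
      ContDiffOn ℝ n (deriv gaussQinv) (Set.Ioo 0 1) := by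
    intro n hn
    have : ContDiffOn ℝ n gaussQinvDeriv (Set.Ioo 0 1) := by
      unfold gaussQinvDeriv
      fun_prop
    exact this.congr fun y hy => (hasDerivAt_gaussQinv hy.1 hy.2).deriv
  have h0 : ContDiffOn ℝ 0 gaussQinv (Set.Ioo 0 1) := contDiffOn_zero.2 hd.continuousOn
  have step : ∀ n : ℕ, ContDiffOn ℝ n gaussQinv (Set.Ioo 0 1) →
      ContDiffOn ℝ (n + 1) gaussQinv (Set.Ioo 0 1) := fun n hn => by
    rw [contDiffOn_succ_iff_deriv_of_isOpen isOpen_Ioo]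
    exact ⟨hd, by simp, hd' _ hn⟩
  have h1 := step 0 (by exact_mod_cast h0)
  have h2 := step 1 (by simpa using h1)
  exact h2.of_le (by norm_num [one_add_one_eq_two])

/-- The density decreases on the positive half-line. This is what makes the strategy sets `Y`
convex. -/
lemma gaussQ_convexOn : ConvexOn ℝ (Set.Ici 0) gaussQ := by
  refine MonotoneOn.convexOn_of_deriv (convex_Ici 0) continuous_gaussQ.continuousOn
    (fun x _ => (hasDerivAt_gaussQ x).differentiableAt.differentiableWithinAt) ?_
  rw [interior_Ici]
  intro x hx y hy hxy
  rw [(hasDerivAt_gaussQ x).deriv, (hasDerivAt_gaussQ y).deriv]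
  unfold gaussPdf
  have h := inv_pos.2 sqrt_two_pi_pos
  have : Real.exp (-y ^ 2 / 2) ≤ Real.exp (-x ^ 2 / 2) := by
    apply Real.exp_le_exp.2
    have hx' : (0 : ℝ) < x := hx
    nlinarith
  nlinarith

end

/-! ### Monotone variational inequalities -/

/-- A square real matrix whose quadratic form is nonnegative on nonnegative vectors admits a
probability vector with nonnegative image. -/
lemma exists_mem_stdSimplex_sum_nonneg {m : Type*} [Fintype m] [Nonempty m]
    (a : m → m → ℝ) (ha : ∀ i j, 0 ≤ a i j + a j i) :
    ∃ μ ∈ stdSimplex ℝ m, ∀ i, 0 ≤ ∑ j, a i j * μ j := by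
  classical
  by_contra! hcon
  let Φ : (m → ℝ) →ₗ[ℝ] (m → ℝ) := Matrix.mulVecLin (Matrix.of a)
  have hΦ : ∀ μ i, Φ μ i = ∑ j, a i j * μ j := fun μ i => rfl
  have hC : Convex ℝ (Φ '' stdSimplex ℝ m) := (convex_stdSimplex ℝ m).linear_image Φ
  have hCc : IsCompact (Φ '' stdSimplex ℝ m) :=
    (isCompact_stdSimplex ℝ m).image Φ.continuous_of_finiteDimensional
  have hP : Convex ℝ (Set.Ici (0 : m → ℝ)) := convex_Ici 0
  have hdisj : Disjoint (Φ '' stdSimplex ℝ m) (Set.Ici (0 : m → ℝ)) := by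
    rw [Set.disjoint_left]
    rintro _ ⟨μ, hμ, rfl⟩ hpos
    obtain ⟨i, hi⟩ := hcon μ hμ
    have := hpos i
    rw [hΦ] at this
    simp at this
    linarith
  -- A functional `ν` separating the image of the simplex from the orthant turns out nonnegative and
  -- nonzero. Its normalization is then a probability vector on whose image `ν` must be negative,
  -- contrary to the sign of the quadratic form.
  obtain ⟨f, u, v, h1, huv, h2⟩ := geometric_hahn_banach_compact_closed hC hCc hP isClosed_Ici hdisj
  have hv : v < 0 := by simpa using h2 0 (Set.mem_Ici.2 le_rfl)
  set ν : m → ℝ := fun i => f (Pi.single i 1) with hν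
  have hf : ∀ y : m → ℝ, f y = ∑ i, ν i * y i := by
    intro y
    conv_lhs => rw [pi_eq_sum_univ' y]
    rw [map_sum]
    refine Finset.sum_congr rfl fun i _ => ?_
    rw [map_smul, smul_eq_mul, mul_comm, hν]
  have hν0 : ∀ i, 0 ≤ ν i := by
    intro i
    by_contra! hi
    -- This point of the orthant is placed where the functional equals `v`, a value excluded by
    -- `h2`.
    have hpos : (0 : m → ℝ) ≤ Pi.single i (v / ν i) := by
      rw [Pi.le_def]
      intro j
      by_cases hj : j = i
      · subst hj; simp; exact (div_pos_of_neg_of_neg hv hi).le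
      · simp [hj]
    have := h2 _ hpos
    rw [hf] at this
    simp [Pi.single_apply] at this
    rw [mul_div_cancel₀ _ hi.ne] at this
    exact lt_irrefl _ this
  have hsum : 0 < ∑ i, ν i := by
    refine lt_of_le_of_ne (Finset.sum_nonneg fun i _ => hν0 i) fun h => ?_
    have hz : ∀ i, ν i = 0 := fun i =>
      (Finset.sum_eq_zero_iff_of_nonneg fun i _ => hν0 i).1 h.symm i (Finset.mem_univ i)
    obtain ⟨i⟩ := ‹Nonempty m›
    have := h1 (Φ (Pi.single i 1)) ⟨_, single_mem_stdSimplex ℝ i, rfl⟩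
    rw [hf] at this
    simp [hz] at this
    linarith
  have hmem : (∑ i, ν i)⁻¹ • ν ∈ stdSimplex ℝ m := by
    refine ⟨fun i => mul_nonneg (inv_nonneg.2 hsum.le) (hν0 i), ?_⟩
    simp only [Pi.smul_apply, smul_eq_mul, ← Finset.mul_sum]
    exact inv_mul_cancel₀ hsum.ne'
  have hneg := h1 _ ⟨_, hmem, rfl⟩
  rw [map_smul, map_smul, smul_eq_mul, hf] at hneg
  have hq : 0 ≤ ∑ i, ν i * Φ ν i := by
    have e1 : ∑ i, ν i * Φ ν i = ∑ i, ∑ j, ν i * ν j * a i j := by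
      refine Finset.sum_congr rfl fun i _ => ?_
      rw [hΦ, Finset.mul_sum]
      exact Finset.sum_congr rfl fun j _ => by ring
    have e2 : ∑ i, ν i * Φ ν i = ∑ i, ∑ j, ν i * ν j * a j i := by
      rw [e1, Finset.sum_comm]
      exact Finset.sum_congr rfl fun i _ => Finset.sum_congr rfl fun j _ => by ring
    have : 0 ≤ ∑ i, ∑ j, ν i * ν j * (a i j + a j i) :=
      Finset.sum_nonneg fun i _ => Finset.sum_nonneg fun j _ =>
        mul_nonneg (mul_nonneg (hν0 i) (hν0 j)) (ha i j)
    simp only [mul_add, Finset.sum_add_distrib] at this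
    linarith
  have := mul_nonneg (inv_nonneg.2 hsum.le) hq
  linarith

/-- Existence of solutions of monotone variational inequalities on compact convex sets. -/
lemma exists_variationalInequality {E : Type*} [NormedAddCommGroup E] [NormedSpace ℝ E]
    [FiniteDimensional ℝ E] {K : Set E} (hK : IsCompact K) (hconv : Convex ℝ K)
    (hne : K.Nonempty) (B : E → E → ℝ) (hlin : ∀ z, IsLinearMap ℝ (B z))
    (hmono : ∀ z ∈ K, ∀ z' ∈ K, 0 ≤ B z' (z' - z) + B z (z - z'))
    (hcont : ∀ z ∈ K, ∀ z' ∈ K,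
      ContinuousWithinAt (fun s : ℝ => B (z + s • (z' - z)) (z' - z)) (Set.Ioi 0) 0) :
    ∃ z ∈ K, ∀ z' ∈ K, 0 ≤ B z (z' - z) := by
  classical
  have hBc : ∀ z, Continuous (B z) := fun z =>
    (IsLinearMap.mk' (B z) (hlin z)).continuous_of_finiteDimensional
  -- The Minty form is closed in `z` for each test point, so by compactness finitely many test
  -- points suffice. For these, a convex combination is supplied by the matrix lemma applied to `B
  -- yᵢ (yᵢ - yⱼ)`, whose symmetrization is nonnegative by monotonicity.
  have minty : ∃ z ∈ K, ∀ y ∈ K, 0 ≤ B y (y - z) := by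
    have hnon := hK.inter_iInter_nonempty (fun y : K => {z | 0 ≤ B y (y - z)})
      (fun y => isClosed_le continuous_const ((hBc y).comp (continuous_const.sub continuous_id)))
      (fun u => ?_)
    · obtain ⟨z, hz, hz'⟩ := hnon
      exact ⟨z, hz, fun y hy => Set.mem_iInter.1 hz' ⟨y, hy⟩⟩
    · rcases u.eq_empty_or_nonempty with rfl | hu
      · simpa using hne
      have : Nonempty u := hu.to_subtype
      obtain ⟨μ, hμ, hμ'⟩ := exists_mem_stdSimplex_sum_nonneg
        (fun i j : u => B i.1 ((i.1 : E) - (j.1 : E))) (fun i j => by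
          have := hmono i.1 i.1.2 j.1 j.1.2
          linarith)
      refine ⟨∑ j, μ j • (j.1 : E), hconv.sum_mem (fun i _ => hμ.1 i) hμ.2 fun i _ => i.1.2, ?_⟩
      refine Set.mem_iInter₂.2 fun i hi => ?_
      have h := hμ' ⟨i, hi⟩
      have e : (i : E) - ∑ j : u, μ j • (j.1 : E) = ∑ j : u, μ j • ((i : E) - (j.1 : E)) := by
        simp only [smul_sub, Finset.sum_sub_distrib, ← Finset.sum_smul, hμ.2, one_smul]
      have e2 : B i (i - ∑ j : u, μ j • (j.1 : E)) = ∑ j : u, B i (i - j.1) * μ j := by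
        rw [e]
        change IsLinearMap.mk' (B i) (hlin i) _ = _
        rw [map_sum]
        refine Finset.sum_congr rfl fun j _ => ?_
        rw [map_smul, smul_eq_mul, mul_comm]
        rfl
      change 0 ≤ B i (i - ∑ j : u, μ j • (j.1 : E))
      rw [e2]
      exact h
  obtain ⟨z, hz, hmin⟩ := minty
  refine ⟨z, hz, fun z' hz' => ?_⟩
  -- Minty's trick: test at `z + s (z' - z)`, divide by `s` and let `s` tend to zero from the right.
  have hlim := hcont z hz z' hz'
  rw [ContinuousWithinAt] at hlim
  simp only [zero_smul, add_zero] at hlim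
  refine ge_of_tendsto hlim ?_
  filter_upwards [Ioo_mem_nhdsGT (zero_lt_one' ℝ)] with s hs
  have hmem : z + s • (z' - z) ∈ K := hconv.add_smul_sub_mem hz hz' ⟨hs.1.le, hs.2.le⟩
  have h := hmin _ hmem
  rw [add_sub_cancel_left, (hlin _).map_smul, smul_eq_mul] at h
  exact nonneg_of_mul_nonneg_right h hs.1

/-! ### First and second directional derivatives of payoff and interference -/

noncomputable section

namespace Strategy

variable {N : ℕ}

@[simp] lemma tau_add (z v : Strategy N) : tau (z + v) = z.tau + v.tau := rfl
@[simp] lemma fa_add (z v : Strategy N) : fa (z + v) = z.fa + v.fa := rfl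
@[simp] lemma pow_add (z v : Strategy N) (k : Fin N) : pow (z + v) k = z.pow k + v.pow k := rfl
@[simp] lemma tau_sub (z v : Strategy N) : tau (z - v) = z.tau - v.tau := rfl
@[simp] lemma fa_sub (z v : Strategy N) : fa (z - v) = z.fa - v.fa := rfl
@[simp] lemma pow_sub (z v : Strategy N) (k : Fin N) : pow (z - v) k = z.pow k - v.pow k := rfl
@[simp] lemma tau_smul (s : ℝ) (v : Strategy N) : tau (s • v) = s * v.tau := rfl
@[simp] lemma fa_smul (s : ℝ) (v : Strategy N) : fa (s • v) = s * v.fa := rfl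
@[simp] lemma pow_smul (s : ℝ) (v : Strategy N) (k : Fin N) : pow (s • v) k = s * v.pow k := rfl
@[simp] lemma tau_zero : tau (0 : Strategy N) = 0 := rfl
@[simp] lemma fa_zero : fa (0 : Strategy N) = 0 := rfl
@[simp] lemma pow_zero (k : Fin N) : pow (0 : Strategy N) k = 0 := rfl

/-- The strategy with the given coordinates. -/
def mk (τ : ℝ) (p : Fin N → ℝ) (φ : ℝ) : Strategy N :=
  Sum.elim (fun _ => τ) (Sum.elim p (fun _ => φ))

@[simp] lemma tau_mk (τ : ℝ) (p : Fin N → ℝ) (φ : ℝ) : tau (mk τ p φ) = τ := rfl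
@[simp] lemma fa_mk (τ : ℝ) (p : Fin N → ℝ) (φ : ℝ) : fa (mk τ p φ) = φ := rfl
@[simp] lemma pow_mk (τ : ℝ) (p : Fin N → ℝ) (φ : ℝ) : pow (mk τ p φ) = p := rfl

lemma ext_coords {z v : Strategy N} (h1 : z.tau = v.tau) (h2 : ∀ k, z.pow k = v.pow k)
    (h3 : z.fa = v.fa) : z = v := by
  ext i
  rcases i with ⟨⟩ | k | ⟨⟩
  exacts [h1, h2 k, h3]

lemma continuous_tau : Continuous (tau : Strategy N → ℝ) := continuous_apply _
lemma continuous_fa : Continuous (fa : Strategy N → ℝ) := continuous_apply _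
lemma continuous_pow (k : Fin N) : Continuous fun z : Strategy N => z.pow k := continuous_apply _

end Strategy

namespace CRSystem

variable {Q N : ℕ} (S : CRSystem Q N)

/-- Interference that the user `q` generates at the primary receiver. -/
def interf (q : Fin Q) (z : Strategy N) : ℝ := ∑ k, S.pMiss q k z * S.w q k * z.pow k

lemma localI_eq (q : Fin Q) (z : Strategy N) : S.localI q z = S.interf q z - S.Imax q := rfl

lemma globalI_eq (x : Profile Q N) : S.globalI x = ∑ q, S.interf q (x q) - S.Itot := by
  unfold globalI interf
  rw [Finset.sum_comm]

/-- Noise plus multiuser interference of the user `q` on the carrier `k`. -/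
def noiseInterf (x : Profile Q N) (q : Fin Q) (k : Fin N) : ℝ :=
  S.nNoise q k + ∑ r ∈ Finset.univ.erase q, S.nGain q r k * (x r).pow k

/-- Total received power of the user `q` on the carrier `k`. -/
def recvPow (x : Profile Q N) (q : Fin Q) (k : Fin N) : ℝ := S.noiseInterf x q k + (x q).pow k

/-- Total rate of the user `q`. -/
def sumRate (x : Profile Q N) (q : Fin Q) : ℝ := ∑ k, S.rate (fun r => (x r).pow) q k

/-- The variation of `noiseInterf` in the direction `y`. -/
def noiseDir (y : Profile Q N) (q : Fin Q) (k : Fin N) : ℝ :=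
  ∑ r ∈ Finset.univ.erase q, S.nGain q r k * (y r).pow k

/-- The variation of `sumRate` in the direction `y`. -/
def rateDir (x y : Profile Q N) (q : Fin Q) : ℝ :=
  ∑ k, ((S.noiseDir y q k + (y q).pow k) / S.recvPow x q k -
    S.noiseDir y q k / S.noiseInterf x q k)

/-- Conditions on a profile under which the payoff of the user `q` is smooth. -/
structure Regular (q : Fin Q) (x : Profile Q N) : Prop where
  fa_lt : (x q).fa < 1
  tau_lt : (x q).tau ^ 2 / (S.f q * S.T q) < 1
  noise_pos : ∀ k, 0 < S.noiseInterf x q k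
  recv_pos : ∀ k, 0 < S.recvPow x q k
  rate_pos : 0 < S.sumRate x q

/-- Normalized sensing time relative to the mean of all the users. -/
def equiDev (q : Fin Q) (x : Profile Q N) : ℝ :=
  (x q).tau / √(S.f q) - 1 / (Q : ℝ) * ∑ r, (x r).tau / √(S.f r)

/-- Directional derivative of `θ_q` with respect to the strategy of the user `q`. -/
def dTheta (q : Fin Q) (x : Profile Q N) (v : Strategy N) : ℝ :=
  -(2 / (S.f q * S.T q) * v.tau * (x q).tau / (1 - (x q).tau ^ 2 / (S.f q * S.T q))) -
    v.fa / (1 - (x q).fa) + (∑ k, v.pow k / S.recvPow x q k) / S.sumRate x q -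
    S.c * ((1 - 1 / (Q : ℝ)) * (v.tau / √(S.f q))) * S.equiDev q x

/-- Derivative of `dTheta q x v` with respect to `x` in the direction `y`. -/
def d2Theta (q : Fin Q) (x y : Profile Q N) (v : Strategy N) : ℝ :=
  -(2 / (S.f q * S.T q) * v.tau * (y q).tau * (1 + (x q).tau ^ 2 / (S.f q * S.T q)) /
      (1 - (x q).tau ^ 2 / (S.f q * S.T q)) ^ 2) -
    v.fa * (y q).fa / (1 - (x q).fa) ^ 2 +
    (-(∑ k, v.pow k * (S.noiseDir y q k + (y q).pow k) / S.recvPow x q k ^ 2) / S.sumRate x q -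
      (∑ k, v.pow k / S.recvPow x q k) * S.rateDir x y q / S.sumRate x q ^ 2) -
    S.c * ((1 - 1 / (Q : ℝ)) * (v.tau / √(S.f q))) * S.equiDev q y

/-- Derivative of `detArg`. -/
def detDir (q : Fin Q) (k : Fin N) (z v : Strategy N) : ℝ :=
  (S.sd0 q k * (gaussQinvDeriv z.fa * v.fa) - S.dmu q k * v.tau) / S.sd1 q k

/-- Derivative of `pMiss`. -/
def dMiss (q : Fin Q) (k : Fin N) (z v : Strategy N) : ℝ :=
  gaussPdf (S.detArg q k z) * S.detDir q k z v

/-- Second derivative of `pMiss`. -/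
def d2Miss (q : Fin Q) (k : Fin N) (z y v : Strategy N) : ℝ :=
  -S.detArg q k z * gaussPdf (S.detArg q k z) * S.detDir q k z y * S.detDir q k z v +
    gaussPdf (S.detArg q k z) * (S.sd0 q k * (gaussQinvDeriv2 z.fa * y.fa * v.fa) / S.sd1 q k)

/-- Derivative of `interf`. -/
def dInterf (q : Fin Q) (z v : Strategy N) : ℝ :=
  ∑ k, S.w q k * (S.dMiss q k z v * z.pow k + S.pMiss q k z * v.pow k)

/-- Second derivative of `interf`. -/
def d2Interf (q : Fin Q) (z y v : Strategy N) : ℝ :=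
  ∑ k, S.w q k * (S.d2Miss q k z y v * z.pow k + S.dMiss q k z v * y.pow k +
    S.dMiss q k z y * v.pow k)

/-- Directional derivative of the Lagrangian of the user `q` with respect to the strategy of this
user. -/
def dLag (q : Fin Q) (lam price : ℝ) (x : Profile Q N) (v : Strategy N) : ℝ :=
  -S.dTheta q x v + (lam + price) * S.dInterf q (x q) v

lemma dLag_isLinearMap (q : Fin Q) (lam price : ℝ) (x : Profile Q N) :
    IsLinearMap ℝ (S.dLag q lam price x) := by
  constructor
  · intro v v'
    simp only [dLag, dTheta, dInterf, dMiss, detDir, Strategy.tau_add, Strategy.fa_add,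
      Strategy.pow_add, add_div, Finset.sum_add_distrib, Finset.sum_sub_distrib, mul_add, add_mul,
      sub_div, sub_mul, mul_sub]
    ring
  · intro s v
    have e1 : ∑ k, (s • v).pow k / S.recvPow x q k = s * ∑ k, v.pow k / S.recvPow x q k := by
      rw [Finset.mul_sum]
      exact Finset.sum_congr rfl fun k _ => by rw [Strategy.pow_smul]; ring
    have e2 : S.dInterf q (x q) (s • v) = s * S.dInterf q (x q) v := by
      unfold dInterf dMiss detDir
      rw [Finset.mul_sum]
      exact Finset.sum_congr rfl fun k _ => by
        simp only [Strategy.pow_smul, Strategy.tau_smul, Strategy.fa_smul]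
        ring
    unfold dLag dTheta
    rw [e1, e2]
    simp only [Strategy.tau_smul, Strategy.fa_smul, smul_eq_mul]
    ring

variable {S} in
lemma Regular.sumRate_eq {q : Fin Q} {x : Profile Q N} (hx : S.Regular q x) :
    S.sumRate x q = ∑ k, (Real.log (S.recvPow x q k) - Real.log (S.noiseInterf x q k)) := by
  refine Finset.sum_congr rfl fun k _ => ?_
  rw [← Real.log_div (hx.recv_pos k).ne' (hx.noise_pos k).ne']
  have := (hx.noise_pos k).ne'
  unfold rate
  congr 1
  change 1 + (x q).pow k / S.noiseInterf x q k = _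
  unfold recvPow
  field_simp

lemma throughput_eq (q : Fin Q) (x : Profile Q N) :
    S.throughput q x =
      (1 - (x q).tau ^ 2 / (S.f q * S.T q)) * (1 - (x q).fa) * S.sumRate x q := rfl

variable {S} in
lemma Regular.theta_eq {q : Fin Q} {x : Profile Q N} (hx : S.Regular q x) :
    S.theta q x = Real.log (1 - (x q).tau ^ 2 / (S.f q * S.T q)) + Real.log (1 - (x q).fa) +
      Real.log (S.sumRate x q) - S.c / 2 * S.equiDev q x ^ 2 := by
  have h1 := hx.tau_lt
  have h2 := hx.fa_lt
  unfold theta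
  rw [throughput_eq, Real.log_mul (mul_pos (by linarith) (by linarith)).ne' hx.rate_pos.ne',
    Real.log_mul (by linarith) (by linarith)]
  rfl

/-! ### Derivatives along lines -/

lemma hasDerivAt_line_tau (x y : Profile Q N) (q : Fin Q) (s : ℝ) :
    HasDerivAt (fun s : ℝ => ((x + s • y) q).tau) (y q).tau s := by
  simpa using ((hasDerivAt_id s).mul_const (y q).tau).const_add (x q).tau

lemma hasDerivAt_line_fa (x y : Profile Q N) (q : Fin Q) (s : ℝ) :
    HasDerivAt (fun s : ℝ => ((x + s • y) q).fa) (y q).fa s := by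
  simpa using ((hasDerivAt_id s).mul_const (y q).fa).const_add (x q).fa

lemma hasDerivAt_line_pow (x y : Profile Q N) (q : Fin Q) (k : Fin N) (s : ℝ) :
    HasDerivAt (fun s : ℝ => ((x + s • y) q).pow k) ((y q).pow k) s := by
  simpa using ((hasDerivAt_id s).mul_const ((y q).pow k)).const_add ((x q).pow k)

lemma hasDerivAt_line_noiseInterf (x y : Profile Q N) (q : Fin Q) (k : Fin N) (s : ℝ) :
    HasDerivAt (fun s : ℝ => S.noiseInterf (x + s • y) q k) (S.noiseDir y q k) s :=
  (HasDerivAt.fun_sum fun r _ => (hasDerivAt_line_pow x y r k s).const_mul _).const_add _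

lemma hasDerivAt_line_recvPow (x y : Profile Q N) (q : Fin Q) (k : Fin N) (s : ℝ) :
    HasDerivAt (fun s : ℝ => S.recvPow (x + s • y) q k) (S.noiseDir y q k + (y q).pow k) s :=
  (S.hasDerivAt_line_noiseInterf x y q k s).add (hasDerivAt_line_pow x y q k s)

lemma hasDerivAt_line_equiDev (x y : Profile Q N) (q : Fin Q) (s : ℝ) :
    HasDerivAt (fun s : ℝ => S.equiDev q (x + s • y)) (S.equiDev q y) s :=
  ((hasDerivAt_line_tau x y q s).div_const _).sub
    ((HasDerivAt.fun_sum fun r _ => (hasDerivAt_line_tau x y r s).div_const _).const_mul _)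

lemma hasDerivAt_line_sumRate {q : Fin Q} {x : Profile Q N} (hx : S.Regular q x)
    (y : Profile Q N) :
    HasDerivAt (fun s : ℝ => S.sumRate (x + s • y) q) (S.rateDir x y q) 0 := by
  have e : x + (0 : ℝ) • y = x := by simp
  unfold sumRate
  refine HasDerivAt.fun_sum fun k _ => ?_
  have hM := S.hasDerivAt_line_noiseInterf x y q k 0
  have hp := hasDerivAt_line_pow x y q k 0
  have hM0 := (hx.noise_pos k)
  have hN0 := (hx.recv_pos k)
  have h := ((hp.div hM (by rw [e]; exact hM0.ne')).const_add 1).log (by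
    simp only [Pi.div_apply, e]
    have : 1 + (x q).pow k / S.noiseInterf x q k = S.recvPow x q k / S.noiseInterf x q k := by
      unfold recvPow; field_simp
    change 1 + (x q).pow k / S.noiseInterf x q k ≠ 0
    rw [this]
    positivity)
  refine h.congr_deriv ?_
  simp only [Pi.div_apply, e]
  have hp : (x q).pow k = S.recvPow x q k - S.noiseInterf x q k := by unfold recvPow; ring
  rw [hp]
  have h3 : 1 + (S.recvPow x q k - S.noiseInterf x q k) / S.noiseInterf x q k =
      S.recvPow x q k / S.noiseInterf x q k := by field_simp; ring
  rw [h3]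
  field_simp
  ring

lemma continuousAt_line (x y : Profile Q N) : Filter.Tendsto (fun s : ℝ => x + s • y)
    (nhds 0) (nhds x) := by
  have : Continuous fun s : ℝ => x + s • y := by fun_prop
  simpa using this.tendsto 0

lemma Regular.eventually {q : Fin Q} {x : Profile Q N} (hx : S.Regular q x) :
    ∀ᶠ x' in nhds x, S.Regular q x' := by
  have c1 : ∀ r, Continuous fun x : Profile Q N => (x r).tau := fun r =>
    Strategy.continuous_tau.comp (continuous_apply r)
  have c2 : ∀ r, Continuous fun x : Profile Q N => (x r).fa := fun r =>
    Strategy.continuous_fa.comp (continuous_apply r)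
  have c3 : ∀ r k, Continuous fun x : Profile Q N => (x r).pow k := fun r k =>
    (Strategy.continuous_pow k).comp (continuous_apply r)
  have c4 : ∀ k, Continuous fun x : Profile Q N => S.noiseInterf x q k := fun k =>
    continuous_const.add (continuous_finsetSum _ fun r _ => continuous_const.mul (c3 r k))
  have c5 : ∀ k, Continuous fun x : Profile Q N => S.recvPow x q k := fun k => (c4 k).add (c3 q k)
  have h4 : ∀ᶠ x' in nhds x, ∀ k, 0 < S.noiseInterf x' q k :=
    Filter.eventually_all.2 fun k => (c4 k).continuousAt.eventually (lt_mem_nhds (hx.noise_pos k))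
  have h5 : ∀ᶠ x' in nhds x, ∀ k, 0 < S.recvPow x' q k :=
    Filter.eventually_all.2 fun k => (c5 k).continuousAt.eventually (lt_mem_nhds (hx.recv_pos k))
  have hR : ContinuousAt (fun x : Profile Q N => S.sumRate x q) x := by
    unfold sumRate
    refine tendsto_finsetSum _ fun k _ => ?_
    refine ContinuousAt.log (continuousAt_const.add ((c3 q k).continuousAt.div
      (c4 k).continuousAt (hx.noise_pos k).ne')) ?_
    have h1 := hx.noise_pos k
    have h2 := hx.recv_pos k
    have : 1 + (x q).pow k / S.noiseInterf x q k = S.recvPow x q k / S.noiseInterf x q k := by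
      unfold recvPow; field_simp
    change 1 + (x q).pow k / S.noiseInterf x q k ≠ 0
    rw [this]
    positivity
  filter_upwards [h4, h5, hR.eventually (lt_mem_nhds hx.rate_pos),
    (c2 q).continuousAt.eventually (gt_mem_nhds hx.fa_lt),
    (((c1 q).pow 2).div_const (S.f q * S.T q)).continuousAt.eventually (gt_mem_nhds hx.tau_lt)]
    with x' a1 a2 a3 a4 a5
  exact ⟨a4, a5, a1, a2, a3⟩

lemma hasDerivAt_line_theta {q : Fin Q} {x : Profile Q N} (hx : S.Regular q x)
    (v : Strategy N) :
    HasDerivAt (fun s : ℝ => S.theta q (x + s • (Pi.single q v : Profile Q N))) (S.dTheta q x v) 0 := by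
  set y : Profile Q N := Pi.single q v with hy
  have e : x + (0 : ℝ) • y = x := by simp
  have hyq : y q = v := by simp [hy]
  -- A user's own deviation does not change the interference that this user receives.
  have hM : ∀ k, S.noiseDir y q k = 0 := fun k => Finset.sum_eq_zero fun r hr => by
    have : y r = 0 := by simp [hy, Finset.ne_of_mem_erase hr]
    rw [this]; simp
  have h1 := hx.tau_lt
  have h2 := hx.fa_lt
  have d1 := ((((hasDerivAt_line_tau x y q 0).pow 2).div_const (S.f q * S.T q)).const_sub 1).log
    (by simp only [Pi.pow_apply, e]; linarith)
  have d2 := ((hasDerivAt_line_fa x y q 0).const_sub 1).log (by rw [e]; linarith)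
  have d3 := (S.hasDerivAt_line_sumRate hx y).log (by rw [e]; exact hx.rate_pos.ne')
  have d4 := ((S.hasDerivAt_line_equiDev x y q 0).pow 2).const_mul (S.c / 2)
  have hev : (fun s : ℝ => S.theta q (x + s • y)) =ᶠ[nhds 0] fun s =>
      Real.log (1 - ((x + s • y) q).tau ^ 2 / (S.f q * S.T q)) +
        Real.log (1 - ((x + s • y) q).fa) + Real.log (S.sumRate (x + s • y) q) -
        S.c / 2 * S.equiDev q (x + s • y) ^ 2 := by
    filter_upwards [(continuousAt_line x y).eventually (Regular.eventually S hx)] with s hs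
    exact hs.theta_eq
  refine HasDerivAt.congr_of_eventuallyEq ?_ hev
  refine (((d1.add d2).add d3).sub d4).congr_deriv ?_
  simp only [Pi.pow_apply, e, hyq]
  have hR : S.rateDir x y q = ∑ k, v.pow k / S.recvPow x q k :=
    Finset.sum_congr rfl fun k _ => by rw [hM, hyq]; simp
  have hD : S.equiDev q y = (1 - 1 / (Q : ℝ)) * (v.tau / √(S.f q)) := by
    unfold equiDev
    rw [Finset.sum_eq_single q (fun r _ hr => by simp [hy, hr]) (by simp), hyq]
    ring
  rw [hR, hD]
  unfold dTheta
  push_cast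
  ring

/-- The direction `y` moves all the users, whereas `v` stays a direction of the user `q`: the row
block `q` of `A` differentiates the user's own gradient in all the variables. -/
lemma hasDerivAt_line_dTheta {q : Fin Q} {x : Profile Q N} (hx : S.Regular q x)
    (y : Profile Q N) (v : Strategy N) :
    HasDerivAt (fun s : ℝ => S.dTheta q (x + s • y) v) (S.d2Theta q x y v) 0 := by
  have e : x + (0 : ℝ) • y = x := by simp
  have h1 := hx.tau_lt
  have h2 := hx.fa_lt
  have d0 := hasDerivAt_line_tau x y q 0
  have d1 := ((d0.const_mul (2 / (S.f q * S.T q) * v.tau)).div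
    (((d0.pow 2).div_const (S.f q * S.T q)).const_sub 1)
    (by simp only [Pi.pow_apply, e]; linarith)).neg
  have d2 := (hasDerivAt_const (0 : ℝ) v.fa).div ((hasDerivAt_line_fa x y q 0).const_sub 1)
    (by rw [e]; linarith)
  have d3 := (HasDerivAt.fun_sum (u := Finset.univ) fun k _ =>
    (hasDerivAt_const (0 : ℝ) (v.pow k)).div (S.hasDerivAt_line_recvPow x y q k 0)
      (by rw [e]; exact (hx.recv_pos k).ne')).div (S.hasDerivAt_line_sumRate hx y)
      (by rw [e]; exact hx.rate_pos.ne')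
  have d4 := (S.hasDerivAt_line_equiDev x y q 0).const_mul
    (S.c * ((1 - 1 / (Q : ℝ)) * (v.tau / √(S.f q))))
  refine (((d1.sub d2).add d3).sub d4).congr_deriv ?_
  simp only [Pi.pow_apply, Pi.div_apply, e]
  have hR := hx.rate_pos.ne'
  have hs : ∑ k, (0 * S.recvPow x q k - v.pow k * (S.noiseDir y q k + (y q).pow k)) /
      S.recvPow x q k ^ 2 =
      -∑ k, v.pow k * (S.noiseDir y q k + (y q).pow k) / S.recvPow x q k ^ 2 := by
    rw [← Finset.sum_neg_distrib]
    exact Finset.sum_congr rfl fun k _ => by ring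
  rw [hs]
  unfold d2Theta
  have h3 : (1 - (x q).fa) ≠ 0 := by linarith
  have h4 : (1 - (x q).tau ^ 2 / (S.f q * S.T q)) ≠ 0 := by linarith
  generalize (∑ k, v.pow k * (S.noiseDir y q k + (y q).pow k) / S.recvPow x q k ^ 2) = a1
  generalize (∑ k, v.pow k / S.recvPow x q k) = a2
  push_cast
  congr 1
  congr 1
  · congr 1
    · rw [← neg_div]
      rw [← neg_div]
      ring
    · ring
  · field_simp

lemma hasDerivAt_line_detArg {q : Fin Q} {z : Strategy N} (h0 : 0 < z.fa) (h1 : z.fa < 1)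
    (y : Strategy N) (k : Fin N) :
    HasDerivAt (fun s : ℝ => S.detArg q k (z + s • y)) (S.detDir q k z y) 0 := by
  have hf : HasDerivAt (fun s : ℝ => z.fa + s * y.fa) y.fa 0 := by
    simpa using ((hasDerivAt_id (0 : ℝ)).mul_const y.fa).const_add z.fa
  have ht : HasDerivAt (fun s : ℝ => z.tau + s * y.tau) y.tau 0 := by
    simpa using ((hasDerivAt_id (0 : ℝ)).mul_const y.tau).const_add z.tau
  have hq := HasDerivAt.comp (0 : ℝ) (h₂ := gaussQinv) (by
    simpa using hasDerivAt_gaussQinv h0 h1) hf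
  exact ((hq.const_mul (S.sd0 q k)).sub (ht.const_mul (S.dmu q k))).div_const (S.sd1 q k)

lemma hasDerivAt_line_detDir {q : Fin Q} {z : Strategy N} (h0 : 0 < z.fa) (h1 : z.fa < 1)
    (y v : Strategy N) (k : Fin N) :
    HasDerivAt (fun s : ℝ => S.detDir q k (z + s • y) v)
      (S.sd0 q k * (gaussQinvDeriv2 z.fa * y.fa * v.fa) / S.sd1 q k) 0 := by
  have hf : HasDerivAt (fun s : ℝ => z.fa + s * y.fa) y.fa 0 := by
    simpa using ((hasDerivAt_id (0 : ℝ)).mul_const y.fa).const_add z.fa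
  have hq := HasDerivAt.comp (0 : ℝ) (h₂ := gaussQinvDeriv) (by
    simpa using hasDerivAt_gaussQinvDeriv h0 h1) hf
  exact (((hq.mul_const v.fa).const_mul (S.sd0 q k)).sub_const _).div_const (S.sd1 q k)

lemma hasDerivAt_line_pMiss {q : Fin Q} {z : Strategy N} (h0 : 0 < z.fa) (h1 : z.fa < 1)
    (y : Strategy N) (k : Fin N) :
    HasDerivAt (fun s : ℝ => S.pMiss q k (z + s • y)) (S.dMiss q k z y) 0 := by
  have hq := HasDerivAt.comp (0 : ℝ) (h₂ := gaussQ) (by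
    simpa using hasDerivAt_gaussQ (S.detArg q k z)) (S.hasDerivAt_line_detArg h0 h1 y k)
  refine (hq.const_sub 1).congr_deriv ?_
  unfold dMiss
  ring

lemma hasDerivAt_line_dMiss {q : Fin Q} {z : Strategy N} (h0 : 0 < z.fa) (h1 : z.fa < 1)
    (y v : Strategy N) (k : Fin N) :
    HasDerivAt (fun s : ℝ => S.dMiss q k (z + s • y) v) (S.d2Miss q k z y v) 0 := by
  have hq := HasDerivAt.comp (0 : ℝ) (h₂ := gaussPdf) (by
    simpa using hasDerivAt_gaussPdf (S.detArg q k z)) (S.hasDerivAt_line_detArg h0 h1 y k)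
  refine (hq.mul (S.hasDerivAt_line_detDir h0 h1 y v k)).congr_deriv ?_
  unfold d2Miss
  simp

lemma hasDerivAt_pow (z y : Strategy N) (k : Fin N) :
    HasDerivAt (fun s : ℝ => (z + s • y).pow k) (y.pow k) 0 := by
  simpa using ((hasDerivAt_id (0 : ℝ)).mul_const (y.pow k)).const_add (z.pow k)

lemma hasDerivAt_line_interf {q : Fin Q} {z : Strategy N} (h0 : 0 < z.fa) (h1 : z.fa < 1)
    (y : Strategy N) :
    HasDerivAt (fun s : ℝ => S.interf q (z + s • y)) (S.dInterf q z y) 0 := by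
  refine HasDerivAt.fun_sum fun k _ => ?_
  refine (((S.hasDerivAt_line_pMiss h0 h1 y k).mul_const (S.w q k)).mul
    (hasDerivAt_pow z y k)).congr_deriv ?_
  simp
  ring

lemma hasDerivAt_line_dInterf {q : Fin Q} {z : Strategy N} (h0 : 0 < z.fa) (h1 : z.fa < 1)
    (y v : Strategy N) :
    HasDerivAt (fun s : ℝ => S.dInterf q (z + s • y) v) (S.d2Interf q z y v) 0 := by
  refine HasDerivAt.fun_sum fun k _ => ?_
  refine ((((S.hasDerivAt_line_dMiss h0 h1 y v k).mul (hasDerivAt_pow z y k)).add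
    ((S.hasDerivAt_line_pMiss h0 h1 y k).mul_const (v.pow k))).const_mul (S.w q k)).congr_deriv ?_
  simp

end CRSystem
end

/-! ### Smoothness of the Lagrangians and the quadratic form of `A` -/

noncomputable section
namespace CRSystem

variable {Q N : ℕ} (S : CRSystem Q N)

/-- Conditions on a profile under which all the payoffs and the interference are smooth. -/
def Smooth (x : Profile Q N) : Prop := ∀ q, 0 < (x q).fa ∧ S.Regular q x

lemma Smooth.eventually {x : Profile Q N} (hx : S.Smooth x) :
    ∀ᶠ x' in nhds x, S.Smooth x' :=
  Filter.eventually_all.2 fun q =>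
    have hc : Continuous fun x : Profile Q N => (x q).fa :=
      Strategy.continuous_fa.comp (continuous_apply q)
    (hc.continuousAt.eventually (lt_mem_nhds (hx q).1)).and (Regular.eventually S (hx q).2)

lemma contDiff_coord {n : WithTop ℕ∞} (r : Fin Q) (i : Coord N) :
    ContDiff ℝ n fun x : Profile Q N => x r i := by fun_prop

lemma theta_contDiffAt {q : Fin Q} {x : Profile Q N} (hx : S.Regular q x) :
    ContDiffAt ℝ 2 (S.theta q) x := by
  have ct : ∀ r, ContDiff ℝ 2 fun x : Profile Q N => (x r).tau := fun r => contDiff_coord r _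
  have cf : ∀ r, ContDiff ℝ 2 fun x : Profile Q N => (x r).fa := fun r => contDiff_coord r _
  have cp : ∀ r k, ContDiff ℝ 2 fun x : Profile Q N => (x r).pow k := fun r k =>
    contDiff_coord r _
  have cM : ∀ k, ContDiff ℝ 2 fun x : Profile Q N => S.noiseInterf x q k := fun k =>
    contDiff_const.add (ContDiff.sum fun r _ => contDiff_const.mul (cp r k))
  have cN : ∀ k, ContDiff ℝ 2 fun x : Profile Q N => S.recvPow x q k := fun k =>
    (cM k).add (cp q k)
  have cE : ContDiff ℝ 2 fun x : Profile Q N => S.equiDev q x :=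
    ((ct q).div_const _).sub (contDiff_const.mul (ContDiff.sum fun r _ => (ct r).div_const _))
  have cR : ContDiffAt ℝ 2 (fun x : Profile Q N => S.sumRate x q) x := by
    have h : ContDiffAt ℝ 2 (fun x : Profile Q N =>
        ∑ k, (Real.log (S.recvPow x q k) - Real.log (S.noiseInterf x q k))) x :=
      ContDiffAt.sum fun k _ => ((cN k).contDiffAt.log (hx.recv_pos k).ne').sub
        ((cM k).contDiffAt.log (hx.noise_pos k).ne')
    refine h.congr_of_eventuallyEq ?_
    filter_upwards [Regular.eventually S hx] with x' hx'
    exact hx'.sumRate_eq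
  have h1 := hx.tau_lt
  have h2 := hx.fa_lt
  have h : ContDiffAt ℝ 2 (fun x : Profile Q N =>
      Real.log (1 - (x q).tau ^ 2 / (S.f q * S.T q)) + Real.log (1 - (x q).fa) +
      Real.log (S.sumRate x q) - S.c / 2 * S.equiDev q x ^ 2) x := by
    refine (((ContDiffAt.log ?_ ?_).add (ContDiffAt.log ?_ ?_)).add
      (cR.log hx.rate_pos.ne')).sub (contDiffAt_const.mul (cE.contDiffAt.pow 2))
    · exact contDiffAt_const.sub (((ct q).contDiffAt.pow 2).div_const _)
    · linarith
    · exact contDiffAt_const.sub (cf q).contDiffAt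
    · linarith
  refine h.congr_of_eventuallyEq ?_
  filter_upwards [Regular.eventually S hx] with x' hx'
  exact hx'.theta_eq

lemma interf_contDiffAt (q : Fin Q) {x : Profile Q N} (h0 : 0 < (x q).fa) (h1 : (x q).fa < 1) :
    ContDiffAt ℝ 2 (fun x : Profile Q N => S.interf q (x q)) x := by
  have ct : ContDiff ℝ 2 fun x : Profile Q N => (x q).tau := contDiff_coord q _
  have cf : ContDiff ℝ 2 fun x : Profile Q N => (x q).fa := contDiff_coord q _
  have cp : ∀ k, ContDiff ℝ 2 fun x : Profile Q N => (x q).pow k := fun k => contDiff_coord q _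
  have cq : ContDiffAt ℝ 2 gaussQinv (x q).fa :=
    contDiffOn_two_gaussQinv.contDiffAt (Ioo_mem_nhds h0 h1)
  have cq' : ContDiffAt ℝ 2 (fun x : Profile Q N => gaussQinv (x q).fa) x :=
    ContDiffAt.comp x cq cf.contDiffAt
  have cu : ∀ k, ContDiffAt ℝ 2 (fun x : Profile Q N => S.detArg q k (x q)) x := fun k =>
    ((contDiffAt_const.mul cq').sub (contDiffAt_const.mul ct.contDiffAt)).div_const _
  have cm : ∀ k, ContDiffAt ℝ 2 (fun x : Profile Q N => S.pMiss q k (x q)) x := fun k =>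
    contDiffAt_const.sub (contDiff_two_gaussQ.contDiffAt.comp x (cu k))
  exact ContDiffAt.sum fun k _ => ((cm k).mul contDiffAt_const).mul (cp k).contDiffAt

lemma lagrangian_contDiffAt (q : Fin Q) (lam price : ℝ) {x : Profile Q N} (hx : S.Smooth x) :
    ContDiffAt ℝ 2 (S.lagrangian q lam price) x := by
  have hI : ∀ r, ContDiffAt ℝ 2 (fun x : Profile Q N => S.interf r (x r)) x := fun r =>
    S.interf_contDiffAt r (hx r).1 (hx r).2.fa_lt
  have hG : ContDiffAt ℝ 2 S.globalI x := by
    have : ContDiffAt ℝ 2 (fun x => ∑ r, S.interf r (x r) - S.Itot) x :=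
      (ContDiffAt.sum fun r _ => hI r).sub contDiffAt_const
    exact this.congr_of_eventuallyEq (Filter.Eventually.of_forall S.globalI_eq)
  exact ((S.theta_contDiffAt (hx q).2).neg.add
    (contDiffAt_const.mul ((hI q).sub contDiffAt_const))).add (contDiffAt_const.mul hG)

lemma hasDerivAt_line_lagrangian (q : Fin Q) (lam price : ℝ) {x : Profile Q N}
    (h0 : 0 < (x q).fa) (hx : S.Regular q x) (v : Strategy N) :
    HasDerivAt (fun s : ℝ => S.lagrangian q lam price (x + s • (Pi.single q v : Profile Q N)))
      (S.dLag q lam price x v) 0 := by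
  have hI : ∀ r, HasDerivAt (fun s : ℝ =>
      S.interf r ((x + s • (Pi.single q v : Profile Q N)) r))
      (if r = q then S.dInterf q (x q) v else 0) 0 := by
    intro r
    split_ifs with h
    · subst h
      simpa using S.hasDerivAt_line_interf h0 hx.fa_lt v
    · simpa [h] using hasDerivAt_const (0 : ℝ) (S.interf r (x r))
  have hG : HasDerivAt (fun s : ℝ => S.globalI (x + s • (Pi.single q v : Profile Q N)))
      (S.dInterf q (x q) v) 0 := by
    simp only [globalI_eq]
    refine ((HasDerivAt.fun_sum fun r _ => hI r).sub_const _).congr_deriv ?_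
    simp
  have hq := hI q
  simp only [if_true] at hq
  refine (((S.hasDerivAt_line_theta hx v).neg.add ((hq.sub_const (S.Imax q)).const_mul lam)).add
    (hG.const_mul price)).congr_deriv ?_
  unfold dLag
  ring

/-- The second derivative of the Lagrangian of the user `q`, in `x_q` along `y q` and in `x` along
`y`. -/
def d2Lag (q : Fin Q) (lam price : ℝ) (x y : Profile Q N) : ℝ :=
  -S.d2Theta q x y (y q) + (lam + price) * S.d2Interf q (x q) (y q) (y q)

/-- The multipliers may move along the line. Constant ones give the quadratic form of `A`; affine
ones give the derivative of the extended map, where the additional term cancels against the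
constraints. -/
lemma hasDerivAt_line_dLag (q : Fin Q) {x : Profile Q N} (h0 : 0 < (x q).fa) (hx : S.Regular q x)
    (y : Profile Q N) {lam price : ℝ → ℝ} {lam' price' : ℝ} (hl : HasDerivAt lam lam' 0)
    (hp : HasDerivAt price price' 0) :
    HasDerivAt (fun s : ℝ => S.dLag q (lam s) (price s) (x + s • y) (y q))
      (S.d2Lag q (lam 0) (price 0) x y + (lam' + price') * S.dInterf q (x q) (y q)) 0 := by
  have h1 := S.hasDerivAt_line_dTheta hx y (y q)
  have h2 := S.hasDerivAt_line_dInterf (q := q) h0 hx.fa_lt (y q) (y q)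
  have e : x q + (0 : ℝ) • y q = x q := by simp
  refine (h1.neg.add ((hl.add hp).mul h2)).congr_deriv ?_
  simp only [Pi.add_apply, e]
  unfold d2Lag
  ring

/-- Differentiability is known from smoothness, so the value of the derivative can be read off along
a line. -/
lemma fderiv_lagrangian_single (q : Fin Q) (lam price : ℝ) {x : Profile Q N} (hx : S.Smooth x)
    (v : Strategy N) :
    fderiv ℝ (S.lagrangian q lam price) x (Pi.single q v) = S.dLag q lam price x v := by
  have hd := ((S.lagrangian_contDiffAt q lam price hx).differentiableAt two_ne_zero).hasFDerivAt
  have hline : HasDerivAt (fun s : ℝ => x + s • (Pi.single q v : Profile Q N))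
      (Pi.single q v) 0 := by
    simpa using ((hasDerivAt_id (0 : ℝ)).smul_const (Pi.single q v : Profile Q N)).const_add x
  have := HasFDerivAt.comp_hasDerivAt (0 : ℝ) (f := fun s : ℝ =>
    x + s • (Pi.single q v : Profile Q N)) (by simpa using hd) hline
  exact this.unique (S.hasDerivAt_line_lagrangian q lam price (hx q).1 (hx q).2 v)

lemma strategy_eq_sum_single (v : Strategy N) :
    v = ∑ i, v i • (Pi.single i 1 : Strategy N) := pi_eq_sum_univ' v

lemma profile_eq_sum_single (y : Profile Q N) :
    y = ∑ b : Fin Q × Coord N, y b.1 b.2 • (Pi.single b.1 (Pi.single b.2 1) : Profile Q N) := by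
  rw [Fintype.sum_prod_type]
  ext q i
  rw [Finset.sum_apply, Finset.sum_apply, Finset.sum_eq_single q]
  · rw [Finset.sum_apply, Finset.sum_apply, Finset.sum_eq_single i]
    · simp
    · intro j _ hj; simp [hj.symm]
    · simp
  · intro r _ hr
    rw [Finset.sum_apply, Finset.sum_apply]
    exact Finset.sum_eq_zero fun j _ => by simp [hr.symm]
  · simp

/-- The contribution of row block `q` is the derivative along `y` of the user's own gradient paired
with the fixed vector `y q`. It is computed as the derivative of `dLag` along one line, without
computing any entry of `A`. -/
lemma A_quadForm (lam : Fin Q → ℝ) (price : ℝ) {x : Profile Q N} (hx : S.Smooth x)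
    (y : Fin Q × Coord N → ℝ) :
    y ⬝ᵥ (S.A x lam price).mulVec y =
      ∑ q, S.d2Lag q (lam q) price x (fun r i => y (r, i)) := by
  set Y : Profile Q N := fun r i => y (r, i) with hY
  have hdiff : ∀ q i, DifferentiableAt ℝ
      (fun x' => partialD (S.lagrangian q (lam q) price) q i x') x := by
    intro q i
    have h := (S.lagrangian_contDiffAt q (lam q) price hx).fderiv_right (m := 1)
      (by norm_num [one_add_one_eq_two])
    exact (h.differentiableAt one_ne_zero).clm_apply (differentiableAt_const _)
  have hline : HasDerivAt (fun s : ℝ => x + s • Y) Y 0 := by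
    simpa using ((hasDerivAt_id (0 : ℝ)).smul_const Y).const_add x
  have hrow : ∀ q, ∑ i, y (q, i) * ∑ b, S.A x lam price (q, i) b * y b =
      S.d2Lag q (lam q) price x Y := by
    intro q
    have e1 : ∀ i, ∑ b, S.A x lam price (q, i) b * y b =
        fderiv ℝ (fun x' => partialD (S.lagrangian q (lam q) price) q i x') x Y := by
      intro i
      conv_rhs => rw [profile_eq_sum_single Y, map_sum]
      refine Finset.sum_congr rfl fun b _ => ?_
      rw [map_smul, smul_eq_mul, mul_comm]
      rfl
    simp only [e1]
    have h1 : HasDerivAt (fun s : ℝ => ∑ i, y (q, i) *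
        partialD (S.lagrangian q (lam q) price) q i (x + s • Y))
        (∑ i, y (q, i) *
          fderiv ℝ (fun x' => partialD (S.lagrangian q (lam q) price) q i x') x Y) 0 := by
      refine HasDerivAt.fun_sum fun i _ => HasDerivAt.const_mul _ ?_
      exact HasFDerivAt.comp_hasDerivAt (0 : ℝ) (f := fun s : ℝ => x + s • Y)
        (by simpa using (hdiff q i).hasFDerivAt) hline
    have h2 := S.hasDerivAt_line_dLag q (hx q).1 (hx q).2 Y (hasDerivAt_const (0 : ℝ) (lam q))
      (hasDerivAt_const (0 : ℝ) price)
    simp only [add_zero, zero_mul] at h2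
    -- Smoothness persists near `x`, so the paired partial derivatives equal `dLag` on a
    -- neighbourhood and the two functions of `s` have the same derivative.
    refine (h1.congr_of_eventuallyEq ?_).unique h2
    filter_upwards [(continuousAt_line x Y).eventually (Smooth.eventually S hx)] with s hs
    rw [strategy_eq_sum_single (Y q)]
    have hl := S.dLag_isLinearMap q (lam q) price (x + s • Y)
    change IsLinearMap.mk' _ hl _ = _
    rw [map_sum]
    refine Finset.sum_congr rfl fun i _ => ?_
    rw [map_smul, smul_eq_mul]
    congr 1
    exact (S.fderiv_lagrangian_single q (lam q) price hs _).symm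
  simp only [dotProduct, Matrix.mulVec]
  rw [Fintype.sum_prod_type]
  exact Finset.sum_congr rfl fun q _ => hrow q

end CRSystem
end

/-! ### A priori bounds on strategies, rates and constants -/

noncomputable section

lemma finite_iInf_pos {ι : Type*} [Finite ι] [Nonempty ι] {f : ι → ℝ} (h : ∀ i, 0 < f i) :
    0 < ⨅ i, f i := by
  obtain ⟨i, hi⟩ := exists_eq_ciInf_of_finite (f := f)
  rw [← hi]; exact h i

lemma finite_iInf_le {ι : Type*} [Finite ι] (f : ι → ℝ) (i : ι) : ⨅ i, f i ≤ f i :=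
  ciInf_le (Set.finite_range f).bddBelow i

lemma finite_le_iSup {ι : Type*} [Finite ι] (f : ι → ℝ) (i : ι) : f i ≤ ⨆ i, f i :=
  le_ciSup (Set.finite_range f).bddAbove i

/-- Concavity of the logarithm, in the form of Bernoulli's inequality for real exponents at most
one. -/
lemma mul_log_one_add_le {θ a : ℝ} (h0 : 0 ≤ θ) (h1 : θ ≤ 1) (ha : 0 ≤ a) :
    θ * Real.log (1 + a) ≤ Real.log (1 + θ * a) := by
  rw [← Real.log_rpow (by linarith)]
  exact Real.log_le_log (Real.rpow_pos_of_pos (by linarith) _)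
    (rpow_one_add_le_one_add_mul_self (by linarith) h0 h1)

namespace CRSystem

variable {Q N : ℕ} {S : CRSystem Q N}

namespace Valid

lemma nNoise_pos (hS : S.Valid) (q : Fin Q) (k : Fin N) : 0 < S.nNoise q k :=
  div_pos (hS.noise_pos q k) (pow_pos (norm_pos_iff.2 (hS.direct_ne q k)) 2)

lemma dmu_pos (hS : S.Valid) (q : Fin Q) (k : Fin N) : 0 < S.dmu q k :=
  sub_pos.2 (hS.mu_lt q k)

lemma tauMax_pos (hS : S.Valid) (q : Fin Q) : 0 < S.tauMax q :=
  (hS.tauMin_pos q).trans (hS.tauMin_lt q)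

lemma T_pos (hS : S.Valid) (q : Fin Q) : 0 < S.T q := (hS.tauMax_pos q).trans (hS.tauMax_lt q)

lemma hAlpha_nonpos (hS : S.Valid) (q : Fin Q) (k : Fin N) : S.hAlpha q k ≤ 0 :=
  gaussQinv_nonpos (by linarith [hS.alpha_le q k]) (by linarith [hS.alpha_pos q k])

lemma htauMin_pos (hS : S.Valid) (q : Fin Q) : 0 < S.htauMin q :=
  Real.sqrt_pos.2 (mul_pos (hS.tauMin_pos q) (hS.f_pos q))

lemma sq_htauMin (hS : S.Valid) (q : Fin Q) : S.htauMin q ^ 2 = S.tauMin q * S.f q :=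
  Real.sq_sqrt (mul_pos (hS.tauMin_pos q) (hS.f_pos q)).le

lemma sq_htauMax (hS : S.Valid) (q : Fin Q) : S.htauMax q ^ 2 = S.tauMax q * S.f q :=
  Real.sq_sqrt (mul_pos (hS.tauMax_pos q) (hS.f_pos q)).le

end Valid

lemma w_nonneg (S : CRSystem Q N) (q : Fin Q) (k : Fin N) : 0 ≤ S.w q k := sq_nonneg _

lemma nGain_nonneg (S : CRSystem Q N) (q r : Fin Q) (k : Fin N) : 0 ≤ S.nGain q r k := sq_nonneg _

lemma pMiss_pos (S : CRSystem Q N) (q : Fin Q) (k : Fin N) (z : Strategy N) : 0 < S.pMiss q k z :=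
  sub_pos.2 (gaussQ_lt_one _)

/-! ### Bounds on the convex part of the strategy set -/

section Y

variable {q : Fin Q} {z : Strategy N}

lemma Y_fa_le (hS : S.Valid) (hz : z ∈ S.Y q) : z.fa ≤ 1 / 2 := hz.2.1.trans (hS.beta_le q)

lemma Y_tau_pos (hS : S.Valid) (hz : z ∈ S.Y q) : 0 < z.tau :=
  (hS.htauMin_pos q).trans_le hz.2.2.2.2.1

lemma Y_le_tau (hS : S.Valid) (hz : z ∈ S.Y q) :
    S.tauMin q / S.T q ≤ z.tau ^ 2 / (S.f q * S.T q) := by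
  have hf := hS.f_pos q
  have hT := hS.T_pos q
  have h : S.htauMin q ^ 2 ≤ z.tau ^ 2 :=
    pow_le_pow_left₀ (hS.htauMin_pos q).le hz.2.2.2.2.1 2
  rw [hS.sq_htauMin] at h
  rw [div_le_div_iff₀ hT (by positivity)]
  nlinarith

lemma Y_tau_lt (hS : S.Valid) (hz : z ∈ S.Y q) : z.tau ^ 2 / (S.f q * S.T q) < 1 := by
  have hf := hS.f_pos q
  have hT := hS.T_pos q
  have h : z.tau ^ 2 ≤ S.htauMax q ^ 2 :=
    pow_le_pow_left₀ (Y_tau_pos hS hz).le hz.2.2.2.2.2 2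
  rw [hS.sq_htauMax] at h
  rw [div_lt_one (by positivity)]
  nlinarith [hS.tauMax_lt q]

/-- Since `alpha ≤ 1 / 2`, the thresholds `hAlpha` are nonpositive. Both the bound `1 / 2` on the
missed detection probability and its convexity rest on this sign. -/
lemma Y_detArg_nonpos (hS : S.Valid) (hz : z ∈ S.Y q) (k : Fin N) : S.detArg q k z ≤ 0 :=
  (hz.2.2.1 k).trans (hS.hAlpha_nonpos q k)

lemma Y_pMiss_le (hS : S.Valid) (hz : z ∈ S.Y q) (k : Fin N) : S.pMiss q k z ≤ 1 / 2 := by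
  have := gaussQ_strictAnti.antitone (Y_detArg_nonpos hS hz k)
  rw [gaussQ_zero] at this
  unfold pMiss
  linarith

lemma Y_gaussQinv_nonneg (hS : S.Valid) (hz : z ∈ S.Y q) : 0 ≤ gaussQinv z.fa :=
  gaussQinv_nonneg hz.1 (Y_fa_le hS hz)

/-- Nonpositivity of `detArg` caps the inverse tail by a multiple of the sensing time, which is
itself bounded. This is the origin of the exponential in `omFa` and of `faMin`. -/
lemma Y_gaussQinv_le (hS : S.Valid) (hz : z ∈ S.Y q) (k : Fin N) :
    gaussQinv z.fa ≤ S.dmu q k / S.sd0 q k * √(S.f q * S.tauMax q) := by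
  have h := Y_detArg_nonpos hS hz k
  have h0 := hS.sd0_pos q k
  have hd := hS.dmu_pos q k
  unfold detArg at h
  rw [div_le_iff₀ (hS.sd1_pos q k), zero_mul] at h
  have ht := hz.2.2.2.2.2
  unfold htauMax at ht
  rw [mul_comm] at ht
  rw [div_mul_eq_mul_div, le_div_iff₀ h0]
  nlinarith

lemma Y_faMin_le [NeZero N] (hS : S.Valid) (hz : z ∈ S.Y q) : S.faMin q ≤ z.fa := by
  refine (finite_iInf_le _ (0 : Fin N)).trans ?_
  rw [← gaussQinv_le_iff hz.1 (by linarith [Y_fa_le hS hz])]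
  have := Y_gaussQinv_le hS hz 0
  rwa [div_mul_eq_mul_div] at this

end Y

lemma faMin_lt_one (S : CRSystem Q N) [NeZero N] (q : Fin Q) : S.faMin q < 1 :=
  (finite_iInf_le _ (0 : Fin N)).trans_lt (gaussQ_lt_one _)

/-! ### Rates -/

/-- The powers of all the users lie between zero and the spectral masks. -/
def PowBounds (S : CRSystem Q N) (x : Profile Q N) : Prop :=
  ∀ r k, 0 ≤ (x r).pow k ∧ (x r).pow k ≤ S.pMax r k

lemma powBounds_of_mem_Y {x : Profile Q N} (hx : ∀ r, x r ∈ S.Y r) : S.PowBounds x :=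
  fun r k => (hx r).2.2.2.1.2 k

section Rates

variable {x : Profile Q N}

lemma nNoise_le_noiseInterf (hx : S.PowBounds x) (q : Fin Q) (k : Fin N) :
    S.nNoise q k ≤ S.noiseInterf x q k :=
  le_add_of_nonneg_right (Finset.sum_nonneg fun r _ =>
    mul_nonneg (S.nGain_nonneg q r k) (hx r k).1)

lemma noiseInterf_pos (hS : S.Valid) (hx : S.PowBounds x) (q : Fin Q) (k : Fin N) :
    0 < S.noiseInterf x q k := (hS.nNoise_pos q k).trans_le (nNoise_le_noiseInterf hx q k)

lemma noiseInterf_le_recvPow (hx : S.PowBounds x) (q : Fin Q) (k : Fin N) :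
    S.noiseInterf x q k ≤ S.recvPow x q k := le_add_of_nonneg_right (hx q k).1

lemma nNoise_le_recvPow (hx : S.PowBounds x) (q : Fin Q) (k : Fin N) :
    S.nNoise q k ≤ S.recvPow x q k :=
  (nNoise_le_noiseInterf hx q k).trans (noiseInterf_le_recvPow hx q k)

lemma recvPow_pos (hS : S.Valid) (hx : S.PowBounds x) (q : Fin Q) (k : Fin N) :
    0 < S.recvPow x q k := (hS.nNoise_pos q k).trans_le (nNoise_le_recvPow hx q k)

lemma nGain_self (hS : S.Valid) (q : Fin Q) (k : Fin N) : S.nGain q q k = 1 := by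
  unfold nGain
  rw [div_self (hS.direct_ne q k)]
  simp

lemma recvPow_le (hS : S.Valid) (hx : S.PowBounds x) (q : Fin Q) (k : Fin N) :
    S.recvPow x q k ≤ S.nNoise q k + ∑ r, S.nGain q r k * S.pMax r k := by
  unfold recvPow noiseInterf
  rw [← Finset.add_sum_erase Finset.univ _ (Finset.mem_univ q), nGain_self hS, one_mul]
  have : ∑ r ∈ Finset.univ.erase q, S.nGain q r k * (x r).pow k ≤
      ∑ r ∈ Finset.univ.erase q, S.nGain q r k * S.pMax r k :=
    Finset.sum_le_sum fun r _ => mul_le_mul_of_nonneg_left (hx r k).2 (S.nGain_nonneg q r k)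
  linarith [(hx q k).2]

lemma rate_eq (S : CRSystem Q N) (x : Profile Q N) (q : Fin Q) (k : Fin N) :
    S.rate (fun r => (x r).pow) q k = Real.log (1 + (x q).pow k / S.noiseInterf x q k) := rfl

lemma rate_le (hS : S.Valid) (hx : S.PowBounds x) (q : Fin Q) (k : Fin N) :
    S.rate (fun r => (x r).pow) q k ≤ (x q).pow k / ⨅ k, S.nNoise q k := by
  have : Nonempty (Fin N) := ⟨k⟩
  rw [rate_eq]
  have hM := noiseInterf_pos hS hx q k
  have h1 := div_nonneg (hx q k).1 hM.le
  have h2 := Real.log_le_sub_one_of_pos (x := 1 + (x q).pow k / S.noiseInterf x q k)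
    (by linarith)
  have h3 : (x q).pow k / S.noiseInterf x q k ≤ (x q).pow k / ⨅ k, S.nNoise q k :=
    div_le_div_of_nonneg_left (hx q k).1 (finite_iInf_pos fun k => hS.nNoise_pos q k)
      ((finite_iInf_le _ k).trans (nNoise_le_noiseInterf hx q k))
  linarith

lemma sumRate_le (hS : S.Valid) (hx : S.PowBounds x) (q : Fin Q) :
    S.sumRate x q ≤ (∑ k, (x q).pow k) / ⨅ k, S.nNoise q k := by
  rw [Finset.sum_div]
  exact Finset.sum_le_sum fun k _ => rate_le hS hx q k

lemma sumRate_le_rMax (hS : S.Valid) (hx : S.PowBounds x) (q : Fin Q) :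
    S.sumRate x q ≤ S.rMax q := by
  refine Finset.sum_le_sum fun k _ => ?_
  rw [rate_eq]
  have hM := noiseInterf_pos hS hx q k
  refine Real.log_le_log (by linarith [div_nonneg (hx q k).1 hM.le]) ?_
  gcongr
  · exact hS.pMax_pos q k |>.le
  · exact hS.nNoise_pos q k
  · exact (hx q k).2
  · exact nNoise_le_noiseInterf hx q k

lemma maskNoise_pos (hS : S.Valid) (q : Fin Q) (k : Fin N) :
    0 < S.nNoise q k + ∑ r ∈ Finset.univ.erase q, S.nGain q r k * S.pMax r k :=
  add_pos_of_pos_of_nonneg (hS.nNoise_pos q k) (Finset.sum_nonneg fun r _ =>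
    mul_nonneg (S.nGain_nonneg q r k) (hS.pMax_pos r k).le)

lemma noiseInterf_le_mask (hx : S.PowBounds x) (q : Fin Q) (k : Fin N) :
    S.noiseInterf x q k ≤
      S.nNoise q k + ∑ r ∈ Finset.univ.erase q, S.nGain q r k * S.pMax r k := by
  unfold noiseInterf
  gcongr with r
  · exact S.nGain_nonneg q r k
  · exact (hx r k).2

lemma rMin_pos [NeZero N] (hS : S.Valid) (q : Fin Q) : 0 < S.rMin q :=
  finite_iInf_pos fun k => div_pos (Real.log_pos (by
    linarith [div_pos (hS.pMax_pos q k) (maskNoise_pos hS q k)])) (hS.pMax_pos q k)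

/-- The rate is concave in the user's own power, so it lies above its chord between zero and the
mask; raising the other users to their masks only lowers it. The slope of that chord is at least
`rMin`. -/
lemma rMin_mul_le_rate (hS : S.Valid) (hx : S.PowBounds x) (q : Fin Q) (k : Fin N) :
    S.rMin q * (x q).pow k ≤ S.rate (fun r => (x r).pow) q k := by
  have hP := hS.pMax_pos q k
  have hM := noiseInterf_pos hS hx q k
  have hm := maskNoise_pos hS q k
  have hp := (hx q k).1
  have h1 : S.rMin q * (x q).pow k ≤ S.rate S.pMax q k / S.pMax q k * (x q).pow k :=
    mul_le_mul_of_nonneg_right (finite_iInf_le _ k) hp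
  refine h1.trans ?_
  have h2 := mul_log_one_add_le (θ := (x q).pow k / S.pMax q k) (div_nonneg hp hP.le)
    ((div_le_one hP).2 (hx q k).2) (div_pos hP hm).le
  rw [show S.rate S.pMax q k / S.pMax q k * (x q).pow k =
    (x q).pow k / S.pMax q k * S.rate S.pMax q k by ring]
  refine h2.trans ?_
  rw [rate_eq, div_mul_div_comm, mul_comm (S.pMax q k), mul_div_mul_right _ _ hP.ne']
  refine Real.log_le_log (by linarith [div_nonneg hp hm.le]) ?_
  gcongr
  exact noiseInterf_le_mask hx q k

lemma rMin_mul_le_sumRate (hS : S.Valid) (hx : S.PowBounds x) (q : Fin Q) :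
    S.rMin q * ∑ k, (x q).pow k ≤ S.sumRate x q := by
  rw [Finset.mul_sum]
  exact Finset.sum_le_sum fun k _ => rMin_mul_le_rate hS hx q k

lemma sumRate_pos_iff [NeZero N] (hS : S.Valid) (hx : S.PowBounds x) (q : Fin Q) :
    0 < S.sumRate x q ↔ 0 < ∑ k, (x q).pow k := by
  constructor
  · intro h
    have h1 := h.trans_le (sumRate_le hS hx q)
    have h2 : 0 < ⨅ k, S.nNoise q k := finite_iInf_pos fun k => hS.nNoise_pos q k
    by_contra! hcon
    linarith [div_nonpos_of_nonpos_of_nonneg hcon h2.le]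
  · intro h
    exact (mul_pos (rMin_pos hS q) h).trans_le (rMin_mul_le_sumRate hS hx q)

lemma regular_of_mem_Y [NeZero N] (hS : S.Valid) (hx : ∀ r, x r ∈ S.Y r) {q : Fin Q}
    (hp : 0 < ∑ k, (x q).pow k) : S.Regular q x where
  fa_lt := by linarith [Y_fa_le hS (hx q)]
  tau_lt := Y_tau_lt hS (hx q)
  noise_pos := noiseInterf_pos hS (powBounds_of_mem_Y hx) q
  recv_pos := recvPow_pos hS (powBounds_of_mem_Y hx) q
  rate_pos := (sumRate_pos_iff hS (powBounds_of_mem_Y hx) q).2 hp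

end Rates

/-! ### Positivity of the constants -/

section Positivity

lemma omTau_pos (hS : S.Valid) (q : Fin Q) (k : Fin N) : 0 < S.omTau q k :=
  mul_pos (one_div_pos.2 sqrt_two_pi_pos) (div_pos (hS.dmu_pos q k) (hS.sd1_pos q k))

lemma omFa_pos (hS : S.Valid) (q : Fin Q) (k : Fin N) : 0 < S.omFa q k :=
  mul_pos (div_pos (hS.sd0_pos q k) (hS.sd1_pos q k)) (Real.exp_pos _)

lemma omTauFa_nonneg (hS : S.Valid) (q : Fin Q) (k : Fin N) : 0 ≤ S.omTauFa q k := by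
  have h1 := hS.dmu_pos q k
  have h2 := hS.sd0_pos q k
  have h3 := hS.sd1_pos q k
  have h4 : 0 ≤ max (gaussQinv (S.alpha q k)) (S.dmu q k / S.sd1 q k * √(S.f q * S.tauMax q)) :=
    le_max_of_le_right (by positivity)
  unfold omTauFa
  positivity

lemma tauMin_div_T_lt (hS : S.Valid) (q : Fin Q) : S.tauMin q / S.T q < 1 :=
  (div_lt_one (hS.T_pos q)).2 ((hS.tauMin_lt q).trans (hS.tauMax_lt q))

/-- The smallest interference threshold and spectral mask. -/
def threshold (S : CRSystem Q N) : ℝ := min S.Itot (⨅ r, min (S.Imax r) (⨅ k, S.pMax r k))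

lemma threshold_le_Imax (S : CRSystem Q N) (q : Fin Q) : S.threshold ≤ S.Imax q :=
  (min_le_right _ _).trans ((finite_iInf_le _ q).trans (min_le_left _ _))

lemma sumPow_pos (hS : S.Valid) (q : Fin Q) (k : Fin N) : 0 < S.sumPow q k := by
  unfold sumPow
  linarith [omTau_pos hS q k, omFa_pos hS q k]

lemma dTau_pos (hS : S.Valid) (q : Fin Q) : 0 < S.dTau q := by
  have h1 := hS.T_pos q
  have h2 := hS.f_pos q
  have h3 := hS.tauMin_pos q
  have h4 := sub_pos.2 (tauMin_div_T_lt hS q)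
  unfold dTau
  positivity

variable [NeZero N]

lemma rMax_pos (hS : S.Valid) (q : Fin Q) : 0 < S.rMax q :=
  Finset.sum_pos (fun k _ => Real.log_pos (by
    linarith [div_pos (hS.pMax_pos q k) (hS.nNoise_pos q k)])) Finset.univ_nonempty

lemma sumTau_pos (hS : S.Valid) (q : Fin Q) : 0 < S.sumTau q := by
  have h1 : 0 < ∑ k, S.omTau q k :=
    Finset.sum_pos (fun k _ => omTau_pos hS q k) Finset.univ_nonempty
  have h2 : 0 ≤ ∑ k, S.omTauFa q k * S.pMax q k :=
    Finset.sum_nonneg fun k _ => mul_nonneg (omTauFa_nonneg hS q k) (hS.pMax_pos q k).le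
  unfold sumTau
  linarith

lemma sumFa_pos (hS : S.Valid) (q : Fin Q) : 0 < S.sumFa q := by
  have h1 : 0 < ∑ k, S.omFa q k :=
    Finset.sum_pos (fun k _ => omFa_pos hS q k) Finset.univ_nonempty
  have h2 : 0 ≤ ∑ k, S.omTauFa q k * S.pMax q k :=
    Finset.sum_nonneg fun k _ => mul_nonneg (omTauFa_nonneg hS q k) (hS.pMax_pos q k).le
  unfold sumFa
  linarith

lemma dPow_pos (hS : S.Valid) (q : Fin Q) (k : Fin N) : 0 < S.dPow q k := by
  have h1 := rMax_pos hS q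
  have h2 := hS.nNoise_pos q k
  have h3 : 0 ≤ ∑ r, S.nGain q r k * S.pMax r k :=
    Finset.sum_nonneg fun r _ => mul_nonneg (S.nGain_nonneg q r k) (hS.pMax_pos r k).le
  unfold dPow
  positivity

lemma dFa_pos (S : CRSystem Q N) (q : Fin Q) : 0 < S.dFa q := by
  have := S.faMin_lt_one q
  have : 0 < 1 - S.faMin q := by linarith
  unfold dFa
  positivity

lemma threshold_pos [NeZero Q] (hS : S.Valid) : 0 < S.threshold :=
  lt_min hS.Itot_pos (finite_iInf_pos fun r =>
    lt_min (hS.Imax_pos r) (finite_iInf_pos fun k => hS.pMax_pos r k))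

/-- Bound of the marginal price of interference for the user `q`. -/
def priceBound (S : CRSystem Q N) (q : Fin Q) : ℝ := 1 / (S.rMin q * ⨅ k, S.nNoise q k)

lemma priceBound_pos (hS : S.Valid) (q : Fin Q) : 0 < S.priceBound q :=
  one_div_pos.2 (mul_pos (rMin_pos hS q) (finite_iInf_pos fun k => hS.nNoise_pos q k))

/-- In this form `lambdaMax` serves two purposes, as `threshold` lies below every `Imax q` and below
`Itot`: it controls the multipliers of the local constraints and the price. -/
lemma threshold_mul_lambdaMax [NeZero Q] (hS : S.Valid) :
    S.threshold * S.lambdaMax = ∑ q, S.priceBound q := by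
  have h := (threshold_pos hS).ne'
  unfold lambdaMax
  rw [Finset.mul_sum]
  refine Finset.sum_congr rfl fun q _ => ?_
  change S.threshold * (1 / S.threshold / _) = 1 / _
  rw [one_div, div_eq_mul_inv, ← mul_assoc, mul_inv_cancel₀ h, one_div, one_mul]

lemma lambdaMax_pos [NeZero Q] (hS : S.Valid) : 0 < S.lambdaMax := by
  have h : 0 < S.threshold * S.lambdaMax := by
    rw [threshold_mul_lambdaMax hS]
    exact Finset.sum_pos (fun q _ => priceBound_pos hS q) Finset.univ_nonempty
  exact pos_of_mul_pos_right h (threshold_pos hS).le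

lemma priceBound_le_Imax_mul [NeZero Q] (hS : S.Valid) (q : Fin Q) :
    S.priceBound q ≤ S.Imax q * S.lambdaMax := by
  have h1 : S.priceBound q ≤ ∑ q, S.priceBound q :=
    Finset.single_le_sum (fun r _ => (priceBound_pos hS r).le) (Finset.mem_univ q)
  rw [← threshold_mul_lambdaMax hS] at h1
  exact h1.trans (mul_le_mul_of_nonneg_right (S.threshold_le_Imax q) (lambdaMax_pos hS).le)

lemma sum_priceBound_le [NeZero Q] (hS : S.Valid) :
    ∑ q, S.priceBound q ≤ S.Itot * S.lambdaMax := by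
  rw [← threshold_mul_lambdaMax hS]
  exact mul_le_mul_of_nonneg_right (min_le_left _ _) (lambdaMax_pos hS).le

/-- The smallest ratio of a curvature bound and a row sum. -/
def curvRatio (S : CRSystem Q N) (q : Fin Q) : ℝ :=
  min (S.dTau q / S.sumTau q) (min (⨅ k, S.dPow q k / S.sumPow q k) (S.dFa q / S.sumFa q))

/-- The smallest row sum. -/
def rowMin (S : CRSystem Q N) (q : Fin Q) : ℝ :=
  min (S.sumTau q) (min (⨅ k, S.sumPow q k) (S.sumFa q))

lemma curvRatio_pos (hS : S.Valid) (q : Fin Q) : 0 < S.curvRatio q :=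
  lt_min (div_pos (dTau_pos hS q) (sumTau_pos hS q))
    (lt_min (finite_iInf_pos fun k => div_pos (dPow_pos hS q k) (sumPow_pos hS q k))
      (div_pos (S.dFa_pos q) (sumFa_pos hS q)))

lemma rowMin_pos (hS : S.Valid) (q : Fin Q) : 0 < S.rowMin q :=
  lt_min (sumTau_pos hS q) (lt_min (finite_iInf_pos fun k => sumPow_pos hS q k) (sumFa_pos hS q))

variable {pRef : Fin Q → Fin N → ℝ} {t : ℝ}

lemma powLow_pos (hS : S.Valid) (q : Fin Q) : 0 < S.powLow pRef t q :=
  mul_pos (finite_iInf_pos fun k => hS.nNoise_pos q k) (Real.exp_pos _)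

lemma rLow_pos (hS : S.Valid) (q : Fin Q) : 0 < S.rLow pRef t q :=
  mul_pos (powLow_pos hS q) (rMin_pos hS q)

lemma zeta_term_pos (hS : S.Valid) (q : Fin Q) :
    0 < (⨆ k, 1 / S.nNoise q k) *
    (1 / S.rLow pRef t q +
      1 / S.rLow pRef t q * (1 / S.rMin q) * ∑ k, 1 / S.nNoise q k) := by
  have h1 := rLow_pos (pRef := pRef) (t := t) hS q
  have h2 := rMin_pos hS q
  have h3 : 0 ≤ ∑ k, 1 / S.nNoise q k :=
    Finset.sum_nonneg fun k _ => (one_div_pos.2 (hS.nNoise_pos q k)).le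
  have h4 : 0 < ⨆ k, 1 / S.nNoise q k :=
    (one_div_pos.2 (hS.nNoise_pos q 0)).trans_le
      (finite_le_iSup (fun k => 1 / S.nNoise q k) (0 : Fin N))
  positivity

lemma zeta_pos [NeZero Q] (hS : S.Valid) : 0 < S.zeta pRef t :=
  (zeta_term_pos hS 0).trans_le (finite_le_iSup (fun q => (⨆ k, 1 / S.nNoise q k) *
    (1 / S.rLow pRef t q +
      1 / S.rLow pRef t q * (1 / S.rMin q) * ∑ k, 1 / S.nNoise q k)) (0 : Fin Q))

lemma gamma1_pos (hS : S.Valid) (ht : 0 < t) (q : Fin Q) : 0 < S.gamma1 t q :=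
  div_pos (mul_pos hS.Itot_pos (mul_pos two_pos (lt_max_of_lt_left ht))) (curvRatio_pos hS q)

lemma gamma2_pos [NeZero Q] (hS : S.Valid) (ht : 0 < t) (q : Fin Q) : 0 < S.gamma2 pRef t q := by
  have h1 : 0 < 1 / S.rowMin q := one_div_pos.2 (rowMin_pos hS q)
  have h2 : 0 < S.zeta pRef t / (2 * t * S.Itot) :=
    div_pos (zeta_pos hS) (mul_pos (mul_pos two_pos ht) hS.Itot_pos)
  exact mul_pos (mul_pos h2 h1) (gamma1_pos hS ht q)

end Positivity

end CRSystem
end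

/-! ### Curvature estimates and positive definiteness of `A` -/

noncomputable section

/-- Abstract form of the coupling between the powers of two users. The diagonal part is handled by
Young's inequality, the rank-one part by Cauchy–Schwarz with the weights `i`, which will be the
inverse noise levels. -/
lemma abs_bilin_sum_le {ι : Type*} [Fintype ι] (v y a b c i : ι → ℝ) {A C σ : ℝ} (hC : 0 ≤ C)
    (hi : ∀ k, 0 ≤ i k) (hσ : ∀ k, i k ≤ σ) (ha : ∀ k, |a k| ≤ A)
    (hb : ∀ k, |b k| ≤ i k) (hc : ∀ k, |c k| ≤ C * i k) :
    |∑ k, v k * a k * y k - (∑ k, v k * b k) * ∑ k, c k * y k| ≤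
      (A + C * σ * ∑ k, i k) * ((∑ k, v k ^ 2 + ∑ k, y k ^ 2) / 2) := by
  have hsum : 0 ≤ ∑ k, i k := Finset.sum_nonneg fun k _ => hi k
  have h1 : |∑ k, v k * a k * y k| ≤ A * ((∑ k, v k ^ 2 + ∑ k, y k ^ 2) / 2) := by
    refine (Finset.abs_sum_le_sum_abs _ _).trans ?_
    rw [← Finset.sum_add_distrib, Finset.sum_div, Finset.mul_sum]
    refine Finset.sum_le_sum fun k _ => ?_
    rw [abs_mul, abs_mul]
    have hA : 0 ≤ A := (abs_nonneg _).trans (ha k)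
    have e : |v k| * |y k| ≤ (v k ^ 2 + y k ^ 2) / 2 := by
      nlinarith [sq_nonneg (|v k| - |y k|), sq_abs (v k), sq_abs (y k)]
    calc |v k| * |a k| * |y k| = |a k| * (|v k| * |y k|) := by ring
      _ ≤ A * ((v k ^ 2 + y k ^ 2) / 2) := mul_le_mul (ha k) e (by positivity) hA
  -- Cauchy–Schwarz with one factor `√i` on each side; the bound `i ≤ σ` is spent on only one of the
  -- two sums.
  have sq : ∀ u : ι → ℝ, (∑ k, |u k| * i k) ^ 2 ≤ (∑ k, i k) * (σ * ∑ k, u k ^ 2) := by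
    intro u
    refine (Finset.sum_sq_le_sum_mul_sum_of_sq_le_mul Finset.univ (fun k _ => hi k)
      (fun k _ => mul_nonneg (hi k) (sq_nonneg (u k))) (fun k _ => ?_)).trans ?_
    · rw [mul_pow, sq_abs]
      exact (by ring : u k ^ 2 * i k ^ 2 = i k * (i k * u k ^ 2)).le
    · refine mul_le_mul_of_nonneg_left ?_ hsum
      rw [Finset.mul_sum]
      exact Finset.sum_le_sum fun k _ => mul_le_mul_of_nonneg_right (hσ k) (sq_nonneg _)
  have h2 : |∑ k, v k * b k| ≤ ∑ k, |v k| * i k := by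
    refine (Finset.abs_sum_le_sum_abs _ _).trans (Finset.sum_le_sum fun k _ => ?_)
    rw [abs_mul]
    exact mul_le_mul_of_nonneg_left (hb k) (abs_nonneg _)
  have h3 : |∑ k, c k * y k| ≤ C * ∑ k, |y k| * i k := by
    rw [Finset.mul_sum]
    refine (Finset.abs_sum_le_sum_abs _ _).trans (Finset.sum_le_sum fun k _ => ?_)
    rw [abs_mul]
    calc |c k| * |y k| ≤ C * i k * |y k| := mul_le_mul_of_nonneg_right (hc k) (abs_nonneg _)
      _ = C * (|y k| * i k) := by ring
  have h4 : |(∑ k, v k * b k) * ∑ k, c k * y k| ≤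
      C * σ * (∑ k, i k) * ((∑ k, v k ^ 2 + ∑ k, y k ^ 2) / 2) := by
    rw [abs_mul]
    refine (mul_le_mul h2 h3 (abs_nonneg _)
      (Finset.sum_nonneg fun k _ => mul_nonneg (abs_nonneg _) (hi k))).trans ?_
    have e1 := sq v
    have e2 := sq y
    generalize ∑ k, |v k| * i k = p at *
    generalize ∑ k, |y k| * i k = q at *
    calc p * (C * q) = C * (p * q) := by ring
      _ ≤ C * ((p ^ 2 + q ^ 2) / 2) := by
        refine mul_le_mul_of_nonneg_left ?_ hC
        nlinarith [sq_nonneg (p - q)]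
      _ ≤ C * (((∑ k, i k) * (σ * ∑ k, v k ^ 2) + (∑ k, i k) * (σ * ∑ k, y k ^ 2)) / 2) := by
        refine mul_le_mul_of_nonneg_left ?_ hC
        linarith
      _ = _ := by ring
  refine (abs_sub _ _).trans ?_
  linarith

namespace CRSystem

variable {Q N : ℕ} {S : CRSystem Q N}

/-! ### Curvature of the interference -/

/-- The largest weight of the interference constraints of the user `q`. -/
def wMax (S : CRSystem Q N) (q : Fin Q) : ℝ := S.Itot * ⨆ k, ‖S.G q k‖ ^ 2 / S.Itot

lemma w_le_wMax (hS : S.Valid) (q : Fin Q) (k : Fin N) : S.w q k ≤ S.wMax q := by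
  have h := finite_le_iSup (fun k => ‖S.G q k‖ ^ 2 / S.Itot) k
  have h0 := hS.Itot_pos
  rwa [div_le_iff₀' h0] at h

lemma wMax_nonneg [NeZero N] (hS : S.Valid) (q : Fin Q) : 0 ≤ S.wMax q :=
  (S.w_nonneg q 0).trans (w_le_wMax hS q 0)

/-- The maximal density `1 / √(2π)` cancels the factor `√(2π)` in the derivative of the inverse
tail; the exponential that remains is controlled by `Y_gaussQinv_le`. -/
lemma abs_dMiss_le (hS : S.Valid) {q : Fin Q} {z : Strategy N} (hz : z ∈ S.Y q) (k : Fin N)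
    (v : Strategy N) : |S.dMiss q k z v| ≤ S.omTau q k * |v.tau| + S.omFa q k * |v.fa| := by
  have h0 := hS.sd0_pos q k
  have h1 := hS.sd1_pos q k
  have hd := hS.dmu_pos q k
  have hg := gaussPdf_pos (S.detArg q k z)
  have hg' := gaussPdf_le (S.detArg q k z)
  have hq : gaussPdf (S.detArg q k z) * -gaussQinvDeriv z.fa ≤
      Real.exp ((S.dmu q k / S.sd0 q k * √(S.f q * S.tauMax q)) ^ 2 / 2) := by
    have e1 : Real.exp (gaussQinv z.fa ^ 2 / 2) ≤
        Real.exp ((S.dmu q k / S.sd0 q k * √(S.f q * S.tauMax q)) ^ 2 / 2) := by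
      apply Real.exp_le_exp.2
      have := pow_le_pow_left₀ (Y_gaussQinv_nonneg hS hz) (Y_gaussQinv_le hS hz k) 2
      linarith
    refine le_trans ?_ e1
    unfold gaussQinvDeriv
    rw [neg_neg]
    have h2 := sqrt_two_pi_pos
    calc gaussPdf (S.detArg q k z) * (√(2 * Real.pi) * Real.exp (gaussQinv z.fa ^ 2 / 2))
        ≤ (√(2 * Real.pi))⁻¹ * (√(2 * Real.pi) * Real.exp (gaussQinv z.fa ^ 2 / 2)) :=
          mul_le_mul_of_nonneg_right hg' (by positivity)
      _ = _ := by field_simp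
  have e : S.dMiss q k z v = -(gaussPdf (S.detArg q k z) * (S.dmu q k / S.sd1 q k) * v.tau +
      S.sd0 q k / S.sd1 q k * (gaussPdf (S.detArg q k z) * -gaussQinvDeriv z.fa) * v.fa) := by
    unfold dMiss detDir
    ring
  rw [e, abs_neg]
  refine (abs_add_le _ _).trans (add_le_add ?_ ?_)
  · rw [abs_mul, abs_of_pos (mul_pos hg (div_pos hd h1))]
    refine mul_le_mul_of_nonneg_right ?_ (abs_nonneg _)
    unfold omTau
    rw [one_div]
    exact mul_le_mul_of_nonneg_right hg' (div_pos hd h1).le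
  · have hpos : 0 < gaussPdf (S.detArg q k z) * -gaussQinvDeriv z.fa :=
      mul_pos hg (neg_pos.2 (gaussQinvDeriv_neg _))
    rw [abs_mul, abs_of_pos (mul_pos (div_pos h0 h1) hpos)]
    exact mul_le_mul_of_nonneg_right (mul_le_mul_of_nonneg_left hq (div_pos h0 h1).le)
      (abs_nonneg _)

/-- Convexity of the missed detection probability: one term carries the sign of `-detArg`, the other
that of the second derivative of the inverse tail. -/
lemma d2Miss_nonneg (hS : S.Valid) {q : Fin Q} {z : Strategy N} (hz : z ∈ S.Y q) (k : Fin N)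
    (v : Strategy N) : 0 ≤ S.d2Miss q k z v v := by
  have h1 := gaussPdf_pos (S.detArg q k z)
  have h2 := neg_nonneg.2 (Y_detArg_nonpos hS hz k)
  have h3 := gaussQinvDeriv2_nonneg hz.1 (Y_fa_le hS hz)
  have h4 := hS.sd0_pos q k
  have h5 := hS.sd1_pos q k
  unfold d2Miss
  rw [mul_assoc (_ * _) (S.detDir q k z v), mul_assoc (gaussQinvDeriv2 _)]
  have h6 := mul_self_nonneg (S.detDir q k z v)
  have h7 := mul_self_nonneg v.fa
  positivity

/-- By convexity of the missed detection probability and nonnegativity of the powers, only the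
products of a power direction with `dMiss` can be negative. Young's inequality distributes each
product over the two coordinates involved, which produces the row sums. -/
lemma d2Interf_ge (hS : S.Valid) {q : Fin Q} {z : Strategy N} (hz : z ∈ S.Y q)
    (v : Strategy N) :
    -(S.wMax q * (S.sumTau q * v.tau ^ 2 + ∑ k, S.sumPow q k * v.pow k ^ 2 +
      S.sumFa q * v.fa ^ 2) / 2) ≤ S.d2Interf q z v v := by
  have key : ∀ k, -(S.wMax q * (S.omTau q k * (v.tau ^ 2 + v.pow k ^ 2) +
      S.omFa q k * (v.fa ^ 2 + v.pow k ^ 2))) ≤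
      S.w q k * (S.d2Miss q k z v v * z.pow k + S.dMiss q k z v * v.pow k +
        S.dMiss q k z v * v.pow k) := by
    intro k
    have h1 := mul_nonneg (d2Miss_nonneg hS hz k v) (hz.2.2.2.1.2 k).1
    have h2 := abs_dMiss_le hS hz k v
    have hT := omTau_pos hS q k
    have hF := omFa_pos hS q k
    have h3 : |S.dMiss q k z v * v.pow k| ≤ (S.omTau q k * (v.tau ^ 2 + v.pow k ^ 2) +
        S.omFa q k * (v.fa ^ 2 + v.pow k ^ 2)) / 2 := by
      rw [abs_mul]
      refine (mul_le_mul_of_nonneg_right h2 (abs_nonneg _)).trans ?_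
      have e1 : |v.tau| * |v.pow k| ≤ (v.tau ^ 2 + v.pow k ^ 2) / 2 := by
        nlinarith [sq_nonneg (|v.tau| - |v.pow k|), sq_abs v.tau, sq_abs (v.pow k)]
      have e2 : |v.fa| * |v.pow k| ≤ (v.fa ^ 2 + v.pow k ^ 2) / 2 := by
        nlinarith [sq_nonneg (|v.fa| - |v.pow k|), sq_abs v.fa, sq_abs (v.pow k)]
      have := mul_le_mul_of_nonneg_left e1 hT.le
      have := mul_le_mul_of_nonneg_left e2 hF.le
      linarith
    have h4 := neg_le_of_abs_le h3
    have h5 : 0 ≤ S.omTau q k * (v.tau ^ 2 + v.pow k ^ 2) +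
        S.omFa q k * (v.fa ^ 2 + v.pow k ^ 2) := by positivity
    have h6 := mul_le_mul_of_nonneg_right (w_le_wMax hS q k) h5
    have h7 := mul_le_mul_of_nonneg_left (show -(S.omTau q k * (v.tau ^ 2 + v.pow k ^ 2) +
        S.omFa q k * (v.fa ^ 2 + v.pow k ^ 2)) ≤ S.d2Miss q k z v v * z.pow k +
        S.dMiss q k z v * v.pow k + S.dMiss q k z v * v.pow k by linarith) (S.w_nonneg q k)
    linarith
  refine le_trans ?_ (Finset.sum_le_sum fun k _ => key k)
  rw [Finset.sum_neg_distrib, ← Finset.mul_sum, mul_div_assoc]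
  by_cases hN : N = 0
  · subst hN
    simp [sumTau, sumFa]
  have : NeZero N := ⟨hN⟩
  refine neg_le_neg (mul_le_mul_of_nonneg_left ?_ (wMax_nonneg hS q))
  have h2 : 0 ≤ ∑ k, S.omTauFa q k * S.pMax q k :=
    Finset.sum_nonneg fun k _ => mul_nonneg (omTauFa_nonneg hS q k) (hS.pMax_pos q k).le
  have e : ∑ k, (S.omTau q k * (v.tau ^ 2 + v.pow k ^ 2) +
      S.omFa q k * (v.fa ^ 2 + v.pow k ^ 2)) =
      (∑ k, S.omTau q k) * v.tau ^ 2 + (∑ k, S.sumPow q k * v.pow k ^ 2) / 2 +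
        (∑ k, S.omFa q k) * v.fa ^ 2 := by
    rw [Finset.sum_mul, Finset.sum_mul, Finset.sum_div, ← Finset.sum_add_distrib,
      ← Finset.sum_add_distrib]
    refine Finset.sum_congr rfl fun k _ => ?_
    unfold sumPow
    ring
  rw [e]
  -- The `omTauFa` parts of the row sums are slack: convexity has already disposed of the mixed
  -- derivatives in sensing time and false alarm probability.
  unfold sumTau sumFa
  have := mul_nonneg h2 (sq_nonneg v.tau)
  have := mul_nonneg h2 (sq_nonneg v.fa)
  linarith

/-! ### Curvature of the payoff -/

/-- The interaction of the user `q` with the others in the second derivative of the rate. -/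
def crossTerm (S : CRSystem Q N) (q : Fin Q) (x y : Profile Q N) : ℝ :=
  (∑ k, (y q).pow k * S.noiseDir y q k / S.recvPow x q k ^ 2) / S.sumRate x q -
    (∑ k, (y q).pow k / S.recvPow x q k) *
      (∑ k, S.noiseDir y q k * (x q).pow k / (S.recvPow x q k * S.noiseInterf x q k)) /
      S.sumRate x q ^ 2

/-- The second derivative of the equi-sensing penalty. -/
def penalty (S : CRSystem Q N) (q : Fin Q) (y : Profile Q N) : ℝ :=
  S.c * ((1 - 1 / (Q : ℝ)) * ((y q).tau / √(S.f q))) * S.equiDev q y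

lemma curvature_tau_ge (hS : S.Valid) {q : Fin Q} {z : Strategy N} (hz : z ∈ S.Y q) :
    S.dTau q ≤ 2 / (S.f q * S.T q) * (1 + z.tau ^ 2 / (S.f q * S.T q)) /
      (1 - z.tau ^ 2 / (S.f q * S.T q)) ^ 2 := by
  have h1 := Y_le_tau hS hz
  have h2 := Y_tau_lt hS hz
  have h3 := hS.f_pos q
  have h4 := hS.T_pos q
  have h5 := hS.tauMin_pos q
  unfold dTau
  gcongr

lemma curvature_fa_ge [NeZero N] (hS : S.Valid) {q : Fin Q} {z : Strategy N} (hz : z ∈ S.Y q) :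
    S.dFa q ≤ 1 / (1 - z.fa) ^ 2 := by
  have h1 := Y_faMin_le hS hz
  have h2 := Y_fa_le hS hz
  unfold dFa
  gcongr
  · exact pow_pos (by linarith) 2
  · linarith

/-- Differentiating the logarithm of the rate twice gives the user's own curvature, a perfect
square, and terms that involve the other users. The square is dropped, and the curvature is bounded
below through `rMax` and the received power at full masks. -/
lemma neg_d2Theta_ge [NeZero N] (hS : S.Valid) {x : Profile Q N} (hx : ∀ r, x r ∈ S.Y r)
    {q : Fin Q} (hp : 0 < ∑ k, (x q).pow k) (y : Profile Q N) :
    S.dTau q * (y q).tau ^ 2 + ∑ k, S.dPow q k * (y q).pow k ^ 2 + S.dFa q * (y q).fa ^ 2 +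
      S.crossTerm q x y + S.penalty q y ≤ -S.d2Theta q x y (y q) := by
  have hb := powBounds_of_mem_Y hx
  have hreg := regular_of_mem_Y hS hx hp
  have hR := hreg.rate_pos
  have eR : S.rateDir x y q = ∑ k, (y q).pow k / S.recvPow x q k -
      ∑ k, S.noiseDir y q k * (x q).pow k / (S.recvPow x q k * S.noiseInterf x q k) := by
    rw [← Finset.sum_sub_distrib]
    refine Finset.sum_congr rfl fun k _ => ?_
    have h1 := (hreg.noise_pos k).ne'
    have h2 := (hreg.recv_pos k).ne'
    have h3 : S.noiseInterf x q k = S.recvPow x q k - (x q).pow k := by unfold recvPow; ring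
    field_simp
    rw [h3]
    ring
  have eS : ∑ k, (y q).pow k * (S.noiseDir y q k + (y q).pow k) / S.recvPow x q k ^ 2 =
      ∑ k, (y q).pow k * S.noiseDir y q k / S.recvPow x q k ^ 2 +
        ∑ k, (y q).pow k ^ 2 / S.recvPow x q k ^ 2 := by
    rw [← Finset.sum_add_distrib]
    exact Finset.sum_congr rfl fun k _ => by ring
  have hP : ∑ k, S.dPow q k * (y q).pow k ^ 2 ≤
      (∑ k, (y q).pow k ^ 2 / S.recvPow x q k ^ 2) / S.sumRate x q := by
    rw [Finset.sum_div]
    refine Finset.sum_le_sum fun k _ => ?_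
    have h1 := recvPow_le hS hb q k
    have h2 := hreg.recv_pos k
    have h3 := sumRate_le_rMax hS hb q
    have h4 : S.dPow q k ≤ 1 / S.sumRate x q / S.recvPow x q k ^ 2 := by
      unfold dPow
      gcongr
    calc S.dPow q k * (y q).pow k ^ 2
        ≤ 1 / S.sumRate x q / S.recvPow x q k ^ 2 * (y q).pow k ^ 2 :=
          mul_le_mul_of_nonneg_right h4 (sq_nonneg _)
      _ = _ := by ring
  have hT := mul_le_mul_of_nonneg_right (curvature_tau_ge hS (hx q)) (sq_nonneg (y q).tau)
  have hF := mul_le_mul_of_nonneg_right (curvature_fa_ge hS (hx q)) (sq_nonneg (y q).fa)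
  have hsq : 0 ≤ (∑ k, (y q).pow k / S.recvPow x q k) ^ 2 / S.sumRate x q ^ 2 := by positivity
  unfold d2Theta crossTerm penalty
  rw [eR, eS]
  -- Here `B` is the user's own curvature, `a ^ 2` the discarded square, and `A` with `a * b` makes
  -- up `crossTerm`.
  have e1 : ∀ a b A B R : ℝ, -(A + B) / R - a * (a - b) / R ^ 2 =
      -(B / R) - a ^ 2 / R ^ 2 - (A / R - a * b / R ^ 2) := fun a b A B R => by ring
  rw [e1]
  have e2 : 2 / (S.f q * S.T q) * (y q).tau * (y q).tau *
      (1 + (x q).tau ^ 2 / (S.f q * S.T q)) / (1 - (x q).tau ^ 2 / (S.f q * S.T q)) ^ 2 =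
      2 / (S.f q * S.T q) * (1 + (x q).tau ^ 2 / (S.f q * S.T q)) /
      (1 - (x q).tau ^ 2 / (S.f q * S.T q)) ^ 2 * (y q).tau ^ 2 := by ring
  have e3 : (y q).fa * (y q).fa / (1 - (x q).fa) ^ 2 =
      1 / (1 - (x q).fa) ^ 2 * (y q).fa ^ 2 := by ring
  rw [e2, e3]
  linarith

/-- Quadratic form with the curvature that the interference constraints leave. -/
def marginForm (S : CRSystem Q N) (t : ℝ) (q : Fin Q) (v : Strategy N) : ℝ :=
  (S.dTau q - t * S.wMax q * S.sumTau q) * v.tau ^ 2 +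
    ∑ k, (S.dPow q k - t * S.wMax q * S.sumPow q k) * v.pow k ^ 2 +
    (S.dFa q - t * S.wMax q * S.sumFa q) * v.fa ^ 2

/-- The multipliers satisfy `lam + price ≤ 2 * t`, and the factor one half in `d2Interf_ge` leaves
`t * wMax` times the row sums to be subtracted. -/
lemma d2Lag_ge [NeZero N] (hS : S.Valid) {t : ℝ} (ht : S.lambdaMax < t) {x : Profile Q N}
    (hx : ∀ r, x r ∈ S.Y r) {q : Fin Q} (hp : 0 < ∑ k, (x q).pow k) (y : Profile Q N)
    {lam price : ℝ} (hl : lam ∈ Set.Icc 0 S.lambdaMax) (hpr : price ∈ Set.Icc 0 t) :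
    S.marginForm t q (y q) + S.crossTerm q x y + S.penalty q y ≤ S.d2Lag q lam price x y := by
  have h1 := neg_d2Theta_ge hS hx hp y
  have h2 := d2Interf_ge hS (hx q) (y q)
  have h3 : 0 ≤ S.sumTau q * (y q).tau ^ 2 + ∑ k, S.sumPow q k * (y q).pow k ^ 2 +
      S.sumFa q * (y q).fa ^ 2 := by
    have h4 := sumTau_pos hS q
    have h5 := sumFa_pos hS q
    have : 0 ≤ ∑ k, S.sumPow q k * (y q).pow k ^ 2 :=
      Finset.sum_nonneg fun k _ => mul_nonneg (sumPow_pos hS q k).le (sq_nonneg _)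
    positivity
  have h0 : 0 ≤ lam + price := add_nonneg hl.1 hpr.1
  have h4 := mul_le_mul_of_nonneg_left h2 h0
  have h5 : (lam + price) * (S.wMax q * (S.sumTau q * (y q).tau ^ 2 +
      ∑ k, S.sumPow q k * (y q).pow k ^ 2 + S.sumFa q * (y q).fa ^ 2) / 2) ≤
      2 * t * (S.wMax q * (S.sumTau q * (y q).tau ^ 2 +
      ∑ k, S.sumPow q k * (y q).pow k ^ 2 + S.sumFa q * (y q).fa ^ 2) / 2) :=
    mul_le_mul_of_nonneg_right (by linarith [hl.2, hpr.2])
      (div_nonneg (mul_nonneg (wMax_nonneg hS q) h3) two_pos.le)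
  have e : S.marginForm t q (y q) = S.dTau q * (y q).tau ^ 2 +
      ∑ k, S.dPow q k * (y q).pow k ^ 2 + S.dFa q * (y q).fa ^ 2 -
      2 * t * (S.wMax q * (S.sumTau q * (y q).tau ^ 2 +
      ∑ k, S.sumPow q k * (y q).pow k ^ 2 + S.sumFa q * (y q).fa ^ 2) / 2) := by
    have : ∑ k, (S.dPow q k - t * S.wMax q * S.sumPow q k) * (y q).pow k ^ 2 =
        ∑ k, S.dPow q k * (y q).pow k ^ 2 -
          t * S.wMax q * ∑ k, S.sumPow q k * (y q).pow k ^ 2 := by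
      rw [Finset.mul_sum, ← Finset.sum_sub_distrib]
      exact Finset.sum_congr rfl fun k _ => by ring
    unfold marginForm
    rw [this]
    ring
  unfold d2Lag
  rw [e]
  linarith

/-! ### Interaction between users -/

/-- Normalized gain of the link from `r` to `q`. -/
def linkGain (S : CRSystem Q N) (q r : Fin Q) : ℝ := ⨆ k, ‖S.H q r k‖ ^ 2 / S.noise q k

lemma linkGain_nonneg (hS : S.Valid) (q r : Fin Q) : 0 ≤ S.linkGain q r :=
  Real.iSup_nonneg fun k => div_nonneg (sq_nonneg _) (hS.noise_pos q k).le

lemma nGain_div_nNoise_le (hS : S.Valid) (q r : Fin Q) (k : Fin N) :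
    S.nGain q r k / S.nNoise q k ≤ S.linkGain q r := by
  refine le_trans (le_of_eq ?_) (finite_le_iSup _ k)
  have h1 := (hS.noise_pos q k).ne'
  have h2 := norm_ne_zero_iff.2 (hS.direct_ne q k)
  unfold nGain nNoise
  rw [norm_div]
  field_simp

/-- The total of the squared powers of a direction. -/
def powSq (v : Strategy N) : ℝ := ∑ k, v.pow k ^ 2

/-- The coupling splits into one bilinear form for each interfering user, to which
`abs_bilin_sum_le` applies with the inverse noise levels as weights. On `Yhat` the rate `R` is at
least `rLow`; the second factor `1 / R` comes with a power and is bounded by `1 / rMin`, as the rate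
dominates `rMin` times the total power. -/
lemma crossTerm_ge [NeZero Q] [NeZero N] (hS : S.Valid) {pRef : Fin Q → Fin N → ℝ} {t : ℝ}
    {x : Profile Q N} (hx : x ∈ S.Yhat pRef t) (q : Fin Q) (y : Profile Q N) :
    -∑ r ∈ Finset.univ.erase q,
      S.zeta pRef t * S.linkGain q r * ((powSq (y q) + powSq (y r)) / 2) ≤ S.crossTerm q x y := by
  have hb := powBounds_of_mem_Y fun r => (hx r).1
  have hlow := powLow_pos (pRef := pRef) (t := t) hS q
  have hrl := rLow_pos (pRef := pRef) (t := t) hS q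
  have hrm := rMin_pos hS q
  have hreg := regular_of_mem_Y hS (fun r => (hx r).1) (hlow.trans_le (hx q).2)
  have hR := hreg.rate_pos
  have hRl : S.rLow pRef t q ≤ S.sumRate x q := by
    refine le_trans ?_ (rMin_mul_le_sumRate hS hb q)
    unfold rLow
    rw [mul_comm]
    exact mul_le_mul_of_nonneg_left (hx q).2 hrm.le
  have hpR : ∀ k, (x q).pow k / S.sumRate x q ≤ 1 / S.rMin q := by
    intro k
    rw [div_le_div_iff₀ hR hrm, one_mul, mul_comm]
    refine le_trans ?_ (rMin_mul_le_sumRate hS hb q)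
    exact mul_le_mul_of_nonneg_left (Finset.single_le_sum (fun j _ => (hb q j).1)
      (Finset.mem_univ k)) hrm.le
  set R := S.sumRate x q with hRdef
  have e : S.crossTerm q x y = ∑ r ∈ Finset.univ.erase q,
      (∑ k, (y q).pow k * (S.nGain q r k / S.recvPow x q k ^ 2 / R) * (y r).pow k -
      (∑ k, (y q).pow k * (1 / S.recvPow x q k)) *
        ∑ k, (S.nGain q r k * (x q).pow k / (S.recvPow x q k * S.noiseInterf x q k) / R ^ 2) *
          (y r).pow k) := by
    unfold crossTerm noiseDir
    rw [Finset.sum_sub_distrib, ← Finset.mul_sum, Finset.sum_comm,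
      Finset.sum_comm (s := Finset.univ.erase q), ← hRdef]
    congr 1
    · rw [Finset.sum_div]
      refine Finset.sum_congr rfl fun k _ => ?_
      rw [Finset.mul_sum, Finset.sum_div, Finset.sum_div]
      exact Finset.sum_congr rfl fun r _ => by ring
    · rw [mul_div_assoc]
      congr 1
      · exact Finset.sum_congr rfl fun k _ => by ring
      · rw [Finset.sum_div]
        refine Finset.sum_congr rfl fun k _ => ?_
        rw [Finset.sum_mul, Finset.sum_div, Finset.sum_div]
        exact Finset.sum_congr rfl fun r _ => by ring
  rw [e, ← Finset.sum_neg_distrib]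
  refine Finset.sum_le_sum fun r _ => neg_le_of_abs_le ?_
  have hg := linkGain_nonneg hS q r
  set σ := ⨆ k, 1 / S.nNoise q k with hσ
  have hσk : ∀ k, 1 / S.nNoise q k ≤ σ := fun k =>
    finite_le_iSup (fun k => 1 / S.nNoise q k) k
  have hinv : ∀ k, 1 / S.recvPow x q k ≤ 1 / S.nNoise q k := fun k =>
    one_div_le_one_div_of_le (hS.nNoise_pos q k) (nNoise_le_recvPow hb q k)
  have hgr : ∀ k, ∀ M, S.nNoise q k ≤ M → S.nGain q r k / M ≤ S.linkGain q r := fun k M hM =>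
    (div_le_div_of_nonneg_left (S.nGain_nonneg q r k) (hS.nNoise_pos q k) hM).trans
      (nGain_div_nNoise_le hS q r k)
  have hσ0 : 0 ≤ σ := (one_div_pos.2 (hS.nNoise_pos q 0)).le.trans (hσk 0)
  -- With these choices `A + C * σ * ∑ i` is the link gain times the expression for the user `q` in
  -- the supremum `zeta`.
  refine (abs_bilin_sum_le (fun k => (y q).pow k) (fun k => (y r).pow k) _ _ _
    (fun k => 1 / S.nNoise q k)
    (A := S.linkGain q r * σ * (1 / S.rLow pRef t q))
    (C := S.linkGain q r * (1 / S.rLow pRef t q * (1 / S.rMin q))) (σ := σ) (by positivity)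
    (fun k => (one_div_pos.2 (hS.nNoise_pos q k)).le) hσk (fun k => ?_) (fun k => ?_)
    (fun k => ?_)).trans ?_
  · have hN := hreg.recv_pos k
    have := S.nGain_nonneg q r k
    rw [abs_of_nonneg (by positivity)]
    calc S.nGain q r k / S.recvPow x q k ^ 2 / R
        = S.nGain q r k / S.recvPow x q k * (1 / S.recvPow x q k) * (1 / R) := by
          field_simp
      _ ≤ _ := mul_le_mul (mul_le_mul (hgr k _ (nNoise_le_recvPow hb q k))
          ((hinv k).trans (hσk k)) (by positivity) hg)
          (one_div_le_one_div_of_le hrl hRl) (by positivity) (by positivity)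
  · rw [abs_of_pos (one_div_pos.2 (hreg.recv_pos k))]
    exact hinv k
  · have hN := hreg.recv_pos k
    have hM := hreg.noise_pos k
    have hpk := (hb q k).1
    have := S.nGain_nonneg q r k
    have := hS.nNoise_pos q k
    rw [abs_of_nonneg (by positivity)]
    calc S.nGain q r k * (x q).pow k / (S.recvPow x q k * S.noiseInterf x q k) / R ^ 2
        = S.nGain q r k / S.noiseInterf x q k * (1 / R * ((x q).pow k / R)) *
            (1 / S.recvPow x q k) := by field_simp
      _ ≤ _ := mul_le_mul (mul_le_mul (hgr k _ (nNoise_le_noiseInterf hb q k))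
          (mul_le_mul (one_div_le_one_div_of_le hrl hRl) (hpR k) (by positivity)
            (by positivity)) (by positivity) hg) (hinv k) (by positivity) (by positivity)
  · have hz := finite_le_iSup (fun q => (⨆ k, 1 / S.nNoise q k) *
      (1 / S.rLow pRef t q +
        1 / S.rLow pRef t q * (1 / S.rMin q) * ∑ k, 1 / S.nNoise q k)) q
    have h0 : 0 ≤ (powSq (y q) + powSq (y r)) / 2 := by unfold powSq; positivity
    refine mul_le_mul_of_nonneg_right ?_ h0
    calc _ = S.linkGain q r * (σ * (1 / S.rLow pRef t q +
        1 / S.rLow pRef t q * (1 / S.rMin q) * ∑ k, 1 / S.nNoise q k)) := by ring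
      _ ≤ S.linkGain q r * S.zeta pRef t := mul_le_mul_of_nonneg_left hz hg
      _ = _ := by ring

/-- A single penalty term has no sign, but the sum is a nonnegative multiple of `∑ a² - (∑ a)² / Q`,
nonnegative by Cauchy–Schwarz. -/
lemma sum_penalty_nonneg [NeZero Q] (hS : S.Valid) (y : Profile Q N) :
    0 ≤ ∑ q, S.penalty q y := by
  have hQ : (1 : ℝ) ≤ Q := by exact_mod_cast NeZero.one_le
  set a : Fin Q → ℝ := fun q => (y q).tau / √(S.f q) with ha
  have e : ∑ q, S.penalty q y =
      S.c * (1 - 1 / (Q : ℝ)) * (∑ q, a q ^ 2 - 1 / (Q : ℝ) * (∑ q, a q) ^ 2) := by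
    have : ∀ q, S.penalty q y =
        S.c * (1 - 1 / (Q : ℝ)) * (a q ^ 2 - 1 / (Q : ℝ) * (∑ r, a r) * a q) := by
      intro q
      simp only [penalty, equiDev, ha]
      ring
    simp only [this]
    rw [← Finset.mul_sum, Finset.sum_sub_distrib, ← Finset.mul_sum]
    ring
  rw [e]
  have h1 : 0 ≤ 1 - 1 / (Q : ℝ) := by
    rw [sub_nonneg, div_le_one (by linarith)]; exact hQ
  have h2 : (∑ q, a q) ^ 2 ≤ Q * ∑ q, a q ^ 2 := by
    simpa using sq_sum_le_card_mul_sum_sq (s := Finset.univ) (f := a)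
  refine mul_nonneg (mul_nonneg hS.c_nonneg h1) ?_
  rw [sub_nonneg, one_div, inv_mul_le_iff₀ (by linarith)]
  exact h2

/-! ### Positivity of the quadratic form -/

/-- The condition of weak coupling. -/
def WeakCoupling (S : CRSystem Q N) (pRef : Fin Q → Fin N → ℝ) (t : ℝ) : Prop :=
  ∀ q, S.gamma1 t q * (⨆ k, ‖S.G q k‖ ^ 2 / S.Itot) +
        S.gamma2 pRef t q * ∑ r ∈ Finset.univ.erase q,
          ((⨆ k, ‖S.H q r k‖ ^ 2 / S.noise q k) + (⨆ k, ‖S.H r q k‖ ^ 2 / S.noise r k)) < 1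

/-- The total gain of the links between the user `q` and the others. -/
def linkSum (S : CRSystem Q N) (q : Fin Q) : ℝ :=
  ∑ r ∈ Finset.univ.erase q, (S.linkGain q r + S.linkGain r q)

lemma linkSum_nonneg (hS : S.Valid) (q : Fin Q) : 0 ≤ S.linkSum q :=
  Finset.sum_nonneg fun r _ => add_nonneg (linkGain_nonneg hS q r) (linkGain_nonneg hS r q)

/-- After cancellation the hypothesis reads `2 * t * wMax + zeta * linkSum / rowMin < curvRatio`.
Multiplying by a row sum `s ≥ rowMin` gives the margin for the corresponding diagonal entry; one
statement covers the three kinds of coordinates. -/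
lemma WeakCoupling.margin [NeZero Q] [NeZero N] (hS : S.Valid) {pRef : Fin Q → Fin N → ℝ} {t : ℝ}
    (ht : S.lambdaMax < t) (hW : S.WeakCoupling pRef t) (q : Fin Q) {d s : ℝ} (hs : 0 < s)
    (hd : S.curvRatio q ≤ d / s) (hr : S.rowMin q ≤ s) :
    S.zeta pRef t * S.linkSum q < d - t * S.wMax q * s := by
  have ht0 : 0 < t := (lambdaMax_pos hS).trans ht
  have hI := hS.Itot_pos
  have hm := curvRatio_pos hS q
  have hr0 := rowMin_pos hS q
  have hz := zeta_pos (pRef := pRef) (t := t) hS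
  have hL := linkSum_nonneg hS q
  have h := hW q
  change S.Itot * (2 * max t S.lambdaMax) / S.curvRatio q * _ +
    S.zeta pRef t / (2 * t * S.Itot) * (1 / S.rowMin q) *
      (S.Itot * (2 * max t S.lambdaMax) / S.curvRatio q) * S.linkSum q < 1 at h
  rw [max_eq_left ht.le] at h
  have e : S.Itot * (2 * t) / S.curvRatio q * (⨆ k, ‖S.G q k‖ ^ 2 / S.Itot) +
      S.zeta pRef t / (2 * t * S.Itot) * (1 / S.rowMin q) *
      (S.Itot * (2 * t) / S.curvRatio q) * S.linkSum q =
      (2 * t * S.wMax q + S.zeta pRef t * S.linkSum q / S.rowMin q) / S.curvRatio q := by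
    unfold wMax
    field_simp
  rw [e, div_lt_one hm] at h
  have h1 := mul_lt_mul_of_pos_right h hs
  rw [le_div_iff₀ hs] at hd
  have h2 : S.zeta pRef t * S.linkSum q ≤ S.zeta pRef t * S.linkSum q / S.rowMin q * s := by
    rw [div_mul_eq_mul_div, le_div_iff₀ hr0]
    exact mul_le_mul_of_nonneg_left hr (mul_nonneg hz.le hL)
  have h3 : 0 ≤ t * S.wMax q * s :=
    mul_nonneg (mul_nonneg ht0.le (wMax_nonneg hS q)) hs.le
  linarith

lemma WeakCoupling.marginForm_pos [NeZero Q] [NeZero N] (hS : S.Valid)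
    {pRef : Fin Q → Fin N → ℝ} {t : ℝ} (ht : S.lambdaMax < t) (hW : S.WeakCoupling pRef t)
    (q : Fin Q) :
    (∀ v, S.zeta pRef t * S.linkSum q * powSq v ≤ S.marginForm t q v) ∧
    ∀ v ≠ 0, S.zeta pRef t * S.linkSum q * powSq v < S.marginForm t q v := by
  have hz := mul_nonneg (zeta_pos (pRef := pRef) (t := t) hS).le (linkSum_nonneg hS q)
  have hT := hW.margin hS ht q (sumTau_pos hS q) (min_le_left _ _) (min_le_left _ _)
  have hF := hW.margin hS ht q (sumFa_pos hS q) ((min_le_right _ _).trans (min_le_right _ _))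
    ((min_le_right _ _).trans (min_le_right _ _))
  have hP : ∀ k, _ := fun k => hW.margin hS ht q (sumPow_pos hS q k)
    ((min_le_right _ _).trans ((min_le_left _ _).trans
      (finite_iInf_le (fun k => S.dPow q k / S.sumPow q k) k)))
    ((min_le_right _ _).trans ((min_le_left _ _).trans (finite_iInf_le (S.sumPow q) k)))
  have hsum : ∀ v : Strategy N, S.zeta pRef t * S.linkSum q * powSq v ≤
      ∑ k, (S.dPow q k - t * S.wMax q * S.sumPow q k) * v.pow k ^ 2 := by
    intro v
    unfold powSq
    rw [Finset.mul_sum]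
    exact Finset.sum_le_sum fun k _ => mul_le_mul_of_nonneg_right (hP k).le (sq_nonneg _)
  have hle : ∀ v, S.zeta pRef t * S.linkSum q * powSq v ≤ S.marginForm t q v := by
    intro v
    have h1 := mul_nonneg (hz.trans hT.le) (sq_nonneg v.tau)
    have h2 := mul_nonneg (hz.trans hF.le) (sq_nonneg v.fa)
    unfold marginForm
    linarith [hsum v]
  refine ⟨hle, fun v hv => lt_of_le_of_ne (hle v) fun heq => hv ?_⟩
  have h1 := mul_nonneg (hz.trans hT.le) (sq_nonneg v.tau)
  have h2 := mul_nonneg (hz.trans hF.le) (sq_nonneg v.fa)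
  have h3 := hsum v
  unfold marginForm at heq
  refine Strategy.ext_coords ?_ (fun k => ?_) ?_
  · by_contra hne
    have := mul_pos (hz.trans_lt hT) (pow_pos (abs_pos.2 hne) 2)
    rw [sq_abs] at this
    linarith
  · by_contra hne
    have : S.zeta pRef t * S.linkSum q * powSq v <
        ∑ k, (S.dPow q k - t * S.wMax q * S.sumPow q k) * v.pow k ^ 2 := by
      unfold powSq
      rw [Finset.mul_sum]
      refine Finset.sum_lt_sum (fun j _ => mul_le_mul_of_nonneg_right (hP j).le (sq_nonneg _))
        ⟨k, Finset.mem_univ k, mul_lt_mul_of_pos_right (hP k) ?_⟩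
      rw [← sq_abs]
      exact pow_pos (abs_pos.2 hne) 2
    linarith
  · by_contra hne
    have := mul_pos (hz.trans_lt hF) (pow_pos (abs_pos.2 hne) 2)
    rw [sq_abs] at this
    linarith

lemma powSq_nonneg (v : Strategy N) : 0 ≤ powSq v := Finset.sum_nonneg fun _ _ => sq_nonneg _

/-- The Lagrangian of the user `q` is strictly convex in the strategy of this user. -/
lemma d2Lag_single_pos [NeZero Q] [NeZero N] (hS : S.Valid) {pRef : Fin Q → Fin N → ℝ} {t : ℝ}
    (ht : S.lambdaMax < t) (hW : S.WeakCoupling pRef t) {x : Profile Q N}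
    (hx : ∀ r, x r ∈ S.Y r) {q : Fin Q} (hp : 0 < ∑ k, (x q).pow k) {v : Strategy N} (hv : v ≠ 0)
    {lam price : ℝ} (hl : lam ∈ Set.Icc 0 S.lambdaMax) (hpr : price ∈ Set.Icc 0 t) :
    0 < S.d2Lag q lam price x (Pi.single q v) := by
  have h1 := d2Lag_ge hS ht hx hp (Pi.single q v) hl hpr
  have h0 : ∀ r ∈ Finset.univ.erase q, (Pi.single q v : Profile Q N) r = 0 := fun r hr =>
    Pi.single_eq_of_ne (Finset.ne_of_mem_erase hr) _
  have hM : ∀ k, S.noiseDir (Pi.single q v) q k = 0 := fun k =>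
    Finset.sum_eq_zero fun r hr => by rw [h0 r hr]; simp
  -- Without movement of the other users there is no coupling, so positive power suffices and the
  -- lower bound of `Yhat` is not needed.
  have h2 : S.crossTerm q x (Pi.single q v) = 0 := by simp [crossTerm, hM]
  -- The penalty terms of the users at rest vanish, so the total penalty is that of the user `q`.
  have h3 : 0 ≤ S.penalty q (Pi.single q v) := by
    have := sum_penalty_nonneg hS (Pi.single q v : Profile Q N)
    rwa [Finset.sum_eq_single q (fun r _ hr => by
      unfold penalty; rw [Pi.single_eq_of_ne hr]; simp) (by simp)] at this
  have h4 := (hW.marginForm_pos hS ht q).2 v hv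
  have h5 := mul_nonneg (mul_nonneg (zeta_pos (pRef := pRef) (t := t) hS).le
    (linkSum_nonneg hS q)) (powSq_nonneg v)
  rw [Pi.single_eq_same] at h1
  linarith

/-- Each link gain is charged in equal parts to its two ends. After symmetrization the user `q` pays
half of `zeta * linkSum * powSq`, which the margin exceeds. -/
lemma sum_d2Lag_pos [NeZero Q] [NeZero N] (hS : S.Valid) {pRef : Fin Q → Fin N → ℝ} {t : ℝ}
    (ht : S.lambdaMax < t) (hW : S.WeakCoupling pRef t) {x : Profile Q N}
    (hx : x ∈ S.Yhat pRef t) {y : Profile Q N} (hy : y ≠ 0) {lam : Fin Q → ℝ} {price : ℝ}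
    (hl : ∀ q, lam q ∈ Set.Icc 0 S.lambdaMax) (hpr : price ∈ Set.Icc 0 t) :
    0 < ∑ q, S.d2Lag q (lam q) price x y := by
  have h1 : ∑ q, (S.marginForm t q (y q) + S.crossTerm q x y + S.penalty q y) ≤
      ∑ q, S.d2Lag q (lam q) price x y := Finset.sum_le_sum fun q _ =>
    d2Lag_ge hS ht (fun r => (hx r).1) ((powLow_pos hS q).trans_le (hx q).2) y (hl q) hpr
  rw [Finset.sum_add_distrib, Finset.sum_add_distrib] at h1
  have h2 := sum_penalty_nonneg hS y
  have h3 : -∑ q, ∑ r ∈ Finset.univ.erase q,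
      S.zeta pRef t * S.linkGain q r * ((powSq (y q) + powSq (y r)) / 2) ≤
      ∑ q, S.crossTerm q x y := by
    rw [← Finset.sum_neg_distrib]
    exact Finset.sum_le_sum fun q _ => crossTerm_ge hS hx q y
  have swap : ∀ F : Fin Q → Fin Q → ℝ, ∑ q, ∑ r ∈ Finset.univ.erase q, F q r =
      ∑ q, ∑ r ∈ Finset.univ.erase q, F r q := fun F =>
    Finset.sum_comm' fun q r => by simp [eq_comm]
  have h4 : ∑ q, ∑ r ∈ Finset.univ.erase q,
      S.zeta pRef t * S.linkGain q r * ((powSq (y q) + powSq (y r)) / 2) =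
      ∑ q, S.zeta pRef t * S.linkSum q * powSq (y q) / 2 := by
    simp only [add_div, mul_add, Finset.sum_add_distrib]
    rw [swap fun q r => S.zeta pRef t * S.linkGain q r * (powSq (y r) / 2),
      ← Finset.sum_add_distrib]
    refine Finset.sum_congr rfl fun q _ => ?_
    unfold linkSum
    rw [← Finset.sum_add_distrib, Finset.mul_sum, Finset.sum_mul, Finset.sum_div]
    exact Finset.sum_congr rfl fun r _ => by ring
  have h5 : ∑ q, S.zeta pRef t * S.linkSum q * powSq (y q) < ∑ q, S.marginForm t q (y q) := by
    obtain ⟨q, hq⟩ := Function.ne_iff.1 hy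
    exact Finset.sum_lt_sum (fun r _ => (hW.marginForm_pos hS ht r).1 _)
      ⟨q, Finset.mem_univ q, (hW.marginForm_pos hS ht q).2 _ hq⟩
  have h6 : 0 ≤ ∑ q, S.zeta pRef t * S.linkSum q * powSq (y q) / 2 :=
    Finset.sum_nonneg fun q _ => div_nonneg (mul_nonneg (mul_nonneg (zeta_pos hS).le
      (linkSum_nonneg hS q)) (powSq_nonneg _)) two_pos.le
  have h7 : ∑ q, S.zeta pRef t * S.linkSum q * powSq (y q) =
      2 * ∑ q, S.zeta pRef t * S.linkSum q * powSq (y q) / 2 := by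
    rw [Finset.mul_sum]
    exact Finset.sum_congr rfl fun q _ => by ring
  linarith

lemma smooth_of_mem_Yhat [NeZero N] (hS : S.Valid) {pRef : Fin Q → Fin N → ℝ} {t : ℝ}
    {x : Profile Q N} (hx : x ∈ S.Yhat pRef t) : S.Smooth x := fun q =>
  ⟨(hx q).1.1, regular_of_mem_Y hS (fun r => (hx r).1) ((powLow_pos hS q).trans_le (hx q).2)⟩

lemma A_posDef [NeZero Q] [NeZero N] (hS : S.Valid) {pRef : Fin Q → Fin N → ℝ} {t : ℝ}
    (ht : S.lambdaMax < t) (hW : S.WeakCoupling pRef t) {x : Profile Q N}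
    (hx : x ∈ S.Yhat pRef t) {lam : Fin Q → ℝ} {price : ℝ}
    (hl : ∀ q, lam q ∈ Set.Icc 0 S.lambdaMax) (hpr : price ∈ Set.Icc 0 t)
    {y : Fin Q × Coord N → ℝ} (hy : y ≠ 0) : 0 < y ⬝ᵥ (S.A x lam price).mulVec y := by
  rw [A_quadForm S lam price (smooth_of_mem_Yhat hS hx)]
  refine sum_d2Lag_pos hS ht hW hx (fun h => hy ?_) hl hpr
  ext ⟨q, i⟩
  exact congrFun (congrFun h q) i

end CRSystem
end

/-! ### Compact convex strategy sets and a strictly monotone variational inequality -/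

noncomputable section

/-- Derivatives along lines have been computed at parameter zero; moving the base point transfers
them to every point of a segment. -/
lemma HasDerivAt.of_shift {E : Type*} [AddCommGroup E] [Module ℝ E] {g : E → ℝ} {z d : E}
    {s₀ D : ℝ} (h : HasDerivAt (fun s : ℝ => g (z + s₀ • d + s • d)) D 0) :
    HasDerivAt (fun s : ℝ => g (z + s • d)) D s₀ := by
  have h1 : HasDerivAt (fun s : ℝ => s - s₀) 1 s₀ := (hasDerivAt_id s₀).sub_const s₀
  have h2 := HasDerivAt.comp (h₂ := fun s : ℝ => g (z + s₀ • d + s • d)) (h := fun s : ℝ => s - s₀)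
    s₀ (by simpa using h) h1
  rw [mul_one] at h2
  refine h2.congr_of_eventuallyEq (Filter.Eventually.of_forall fun s => ?_)
  simp only [Function.comp]
  rw [add_assoc, ← add_smul]
  simp

namespace CRSystem

variable {Q N : ℕ} {S : CRSystem Q N}

/-! ### Geometry of the strategy sets -/

/-- Solving the detection constraint for the false alarm probability leaves the globally continuous
`gaussQ` of an affine function of the sensing time. The strict constraint `0 < fa` becomes
automatic, so the set is closed. -/
lemma mem_Y_iff [NeZero N] (hS : S.Valid) {q : Fin Q} {z : Strategy N} :
    z ∈ S.Y q ↔ z.fa ≤ S.beta q ∧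
      (∀ k, gaussQ ((S.sd1 q k * S.hAlpha q k + S.dmu q k * z.tau) / S.sd0 q k) ≤ z.fa) ∧
      z.pow ∈ S.powerSet q ∧ S.htauMin q ≤ z.tau ∧ z.tau ≤ S.htauMax q := by
  have key : 0 < z.fa → z.fa < 1 → ∀ k, (S.detArg q k z ≤ S.hAlpha q k ↔
      gaussQ ((S.sd1 q k * S.hAlpha q k + S.dmu q k * z.tau) / S.sd0 q k) ≤ z.fa) := by
    intro h0 h1 k
    rw [← gaussQinv_le_iff h0 h1, le_div_iff₀ (hS.sd0_pos q k), detArg,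
      div_le_iff₀ (hS.sd1_pos q k)]
    constructor <;> intro h <;> linarith
  constructor
  · rintro ⟨h1, h2, h3, h4⟩
    have : z.fa < 1 := by linarith [hS.beta_le q]
    exact ⟨h2, fun k => (key h1 this k).1 (h3 k), h4⟩
  · rintro ⟨h2, h3, h4⟩
    have h1 : 0 < z.fa := (gaussQ_pos _).trans_le (h3 0)
    have : z.fa < 1 := by linarith [hS.beta_le q]
    exact ⟨h1, h2, fun k => (key h1 this k).2 (h3 k), h4⟩

lemma convex_Y [NeZero N] (hS : S.Valid) (q : Fin Q) : Convex ℝ (S.Y q) := by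
  intro z hz z' hz' a b ha hb hab
  have h1 := (mem_Y_iff hS).1 hz
  have h2 := (mem_Y_iff hS).1 hz'
  refine (mem_Y_iff hS).2 ⟨?_, fun k => ?_, ⟨?_, fun k => ⟨?_, ?_⟩⟩, ?_, ?_⟩
  · have e : S.beta q = a * S.beta q + b * S.beta q := by rw [← add_mul, hab, one_mul]
    rw [e]
    exact add_le_add (mul_le_mul_of_nonneg_left h1.1 ha) (mul_le_mul_of_nonneg_left h2.1 hb)
  · have hc := gaussQ_convexOn.2 (Y_gaussQinv_nonneg hS hz) (Y_gaussQinv_nonneg hS hz') ha hb hab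
    have hf : ∀ {u : Strategy N}, u ∈ S.Y q → u.fa < 1 := fun hu => by linarith [Y_fa_le hS hu]
    rw [gaussQ_gaussQinv hz.1 (hf hz), gaussQ_gaussQinv hz'.1 (hf hz')] at hc
    refine le_trans (gaussQ_strictAnti.antitone ?_) hc
    have g1 := (gaussQinv_le_iff hz.1 (hf hz)).2 (h1.2.1 k)
    have g2 := (gaussQinv_le_iff hz'.1 (hf hz')).2 (h2.2.1 k)
    have e : (S.sd1 q k * S.hAlpha q k + S.dmu q k * (a • z + b • z').tau) / S.sd0 q k =
        a * ((S.sd1 q k * S.hAlpha q k + S.dmu q k * z.tau) / S.sd0 q k) +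
        b * ((S.sd1 q k * S.hAlpha q k + S.dmu q k * z'.tau) / S.sd0 q k) := by
      have : S.sd1 q k * S.hAlpha q k = (a + b) * (S.sd1 q k * S.hAlpha q k) := by
        rw [hab, one_mul]
      rw [this, Strategy.tau_add, Strategy.tau_smul, Strategy.tau_smul]
      rw [hab]
      have hb' : b = 1 - a := by linarith
      rw [hb']
      ring
    rw [e]
    exact add_le_add (mul_le_mul_of_nonneg_left g1 ha) (mul_le_mul_of_nonneg_left g2 hb)
  · have e : S.budget q = a * S.budget q + b * S.budget q := by rw [← add_mul, hab, one_mul]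
    simp only [Strategy.pow_add, Strategy.pow_smul, Finset.sum_add_distrib, ← Finset.mul_sum]
    rw [e]
    exact add_le_add (mul_le_mul_of_nonneg_left hz.2.2.2.1.1 ha)
      (mul_le_mul_of_nonneg_left hz'.2.2.2.1.1 hb)
  · exact add_nonneg (mul_nonneg ha (hz.2.2.2.1.2 k).1) (mul_nonneg hb (hz'.2.2.2.1.2 k).1)
  · have e : S.pMax q k = a * S.pMax q k + b * S.pMax q k := by rw [← add_mul, hab, one_mul]
    rw [e]
    exact add_le_add (mul_le_mul_of_nonneg_left (hz.2.2.2.1.2 k).2 ha)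
      (mul_le_mul_of_nonneg_left (hz'.2.2.2.1.2 k).2 hb)
  · have e : S.htauMin q = a * S.htauMin q + b * S.htauMin q := by rw [← add_mul, hab, one_mul]
    rw [e]
    exact add_le_add (mul_le_mul_of_nonneg_left hz.2.2.2.2.1 ha)
      (mul_le_mul_of_nonneg_left hz'.2.2.2.2.1 hb)
  · have e : S.htauMax q = a * S.htauMax q + b * S.htauMax q := by rw [← add_mul, hab, one_mul]
    rw [e]
    exact add_le_add (mul_le_mul_of_nonneg_left hz.2.2.2.2.2 ha)
      (mul_le_mul_of_nonneg_left hz'.2.2.2.2.2 hb)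

lemma isCompact_Y [NeZero N] (hS : S.Valid) (q : Fin Q) : IsCompact (S.Y q) := by
  have hbox : IsCompact (Set.Icc (Strategy.mk (S.htauMin q) 0 0 : Strategy N)
      (Strategy.mk (S.htauMax q) (S.pMax q) (S.beta q))) := isCompact_Icc
  refine hbox.of_isClosed_subset ?_ fun z hz => ⟨?_, ?_⟩
  · have e : S.Y q = {z | z.fa ≤ S.beta q ∧
      (∀ k, gaussQ ((S.sd1 q k * S.hAlpha q k + S.dmu q k * z.tau) / S.sd0 q k) ≤ z.fa) ∧
      (∑ k, z.pow k ≤ S.budget q ∧ ∀ k, 0 ≤ z.pow k ∧ z.pow k ≤ S.pMax q k) ∧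
      S.htauMin q ≤ z.tau ∧ z.tau ≤ S.htauMax q} := by
      ext z
      exact mem_Y_iff hS
    have c1 := Strategy.continuous_tau (N := N)
    have c2 := Strategy.continuous_fa (N := N)
    have c3 := Strategy.continuous_pow (N := N)
    have c4 := continuous_gaussQ
    rw [e]
    simp only [Set.ofPred_and, Set.ofPred_forall]
    refine (isClosed_le c2 continuous_const).inter
      ((isClosed_iInter fun k => isClosed_le (by fun_prop) c2).inter
      (((isClosed_le (continuous_finsetSum _ fun k _ => c3 k) continuous_const).inter
      (isClosed_iInter fun k => (isClosed_le continuous_const (c3 k)).inter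
        (isClosed_le (c3 k) continuous_const))).inter
      ((isClosed_le continuous_const c1).inter (isClosed_le c1 continuous_const))))
  · rintro (⟨⟩ | k | ⟨⟩)
    exacts [hz.2.2.2.2.1, (hz.2.2.2.1.2 k).1, hz.1.le]
  · rintro (⟨⟩ | k | ⟨⟩)
    exacts [hz.2.2.2.2.2, (hz.2.2.2.1.2 k).2, hz.2.1]

lemma convex_Yhat [NeZero N] (hS : S.Valid) (pRef : Fin Q → Fin N → ℝ) (t : ℝ) :
    Convex ℝ (S.Yhat pRef t) := by
  intro x hx x' hx' a b ha hb hab q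
  refine ⟨convex_Y hS q (hx q).1 (hx' q).1 ha hb hab, ?_⟩
  have e : S.powLow pRef t q = a * S.powLow pRef t q + b * S.powLow pRef t q := by
    rw [← add_mul, hab, one_mul]
  simp only [Pi.add_apply, Pi.smul_apply, Strategy.pow_add, Strategy.pow_smul,
    Finset.sum_add_distrib, ← Finset.mul_sum]
  rw [e]
  exact add_le_add (mul_le_mul_of_nonneg_left (hx q).2 ha)
    (mul_le_mul_of_nonneg_left (hx' q).2 hb)

lemma isCompact_Yhat [NeZero N] (hS : S.Valid) (pRef : Fin Q → Fin N → ℝ) (t : ℝ) :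
    IsCompact (S.Yhat pRef t) := by
  refine (isCompact_univ_pi fun q => isCompact_Y hS q).of_isClosed_subset ?_
    fun x hx q _ => (hx q).1
  have e : S.Yhat pRef t =
      ⋂ q, ({x | x q ∈ S.Y q} ∩ {x | S.powLow pRef t q ≤ ∑ k, (x q).pow k}) := by
    ext x
    simp [Yhat]
  rw [e]
  exact isClosed_iInter fun q =>
    ((isCompact_Y hS q).isClosed.preimage (continuous_apply q)).inter
    (isClosed_le continuous_const (continuous_finsetSum _ fun k _ =>
      (Strategy.continuous_pow k).comp (continuous_apply q)))

/-! ### The variational inequality -/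

/-- Profiles together with the multipliers of the local constraints and the price. -/
abbrev Extended (Q N : ℕ) : Type := Profile Q N × (Fin Q → ℝ) × ℝ

/-- The set on which the variational inequality is posed. -/
def extSet (S : CRSystem Q N) (pRef : Fin Q → Fin N → ℝ) (t : ℝ) : Set (Extended Q N) :=
  S.Yhat pRef t ×ˢ (Set.univ.pi fun _ => Set.Icc 0 S.lambdaMax) ×ˢ Set.Icc 0 t

/-- The map of the variational inequality. -/
def extMap (S : CRSystem Q N) (z d : Extended Q N) : ℝ :=
  ∑ q, S.dLag q (z.2.1 q) z.2.2 z.1 (d.1 q) - ∑ q, d.2.1 q * S.localI q (z.1 q) -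
    d.2.2 * S.globalI z.1

lemma isCompact_extSet [NeZero N] (hS : S.Valid) (pRef : Fin Q → Fin N → ℝ) (t : ℝ) :
    IsCompact (S.extSet pRef t) :=
  (isCompact_Yhat hS pRef t).prod ((isCompact_univ_pi fun _ => isCompact_Icc).prod isCompact_Icc)

lemma convex_extSet [NeZero N] (hS : S.Valid) (pRef : Fin Q → Fin N → ℝ) (t : ℝ) :
    Convex ℝ (S.extSet pRef t) :=
  (convex_Yhat hS pRef t).prod ((convex_pi fun _ _ => convex_Icc _ _).prod (convex_Icc _ _))

lemma extMap_isLinearMap (S : CRSystem Q N) (z : Extended Q N) : IsLinearMap ℝ (S.extMap z) := by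
  have hl := fun q => S.dLag_isLinearMap q (z.2.1 q) z.2.2 z.1
  constructor
  · intro d d'
    simp only [extMap, Prod.fst_add, Prod.snd_add, Pi.add_apply, (hl _).map_add,
      Finset.sum_add_distrib, add_mul]
    ring
  · intro s d
    simp only [extMap, Prod.smul_fst, Prod.smul_snd, Pi.smul_apply, (hl _).map_smul, smul_eq_mul,
      mul_assoc, ← Finset.mul_sum]
    ring

/-- The variation of the multipliers enters through the gradients and, with the opposite sign,
through the constraints. These contributions cancel, and only the quadratic form of `A` remains. -/
lemma hasDerivAt_extMap_zero {z : Extended Q N} (hz : S.Smooth z.1) (d : Extended Q N) :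
    HasDerivAt (fun s : ℝ => S.extMap (z + s • d) d)
      (∑ q, S.d2Lag q (z.2.1 q) z.2.2 z.1 d.1) 0 := by
  have hl : ∀ q, HasDerivAt (fun s : ℝ => z.2.1 q + s * d.2.1 q) (d.2.1 q) 0 := fun q => by
    simpa using ((hasDerivAt_id (0 : ℝ)).mul_const (d.2.1 q)).const_add (z.2.1 q)
  have hp : HasDerivAt (fun s : ℝ => z.2.2 + s * d.2.2) d.2.2 0 := by
    simpa using ((hasDerivAt_id (0 : ℝ)).mul_const d.2.2).const_add z.2.2
  have hI : ∀ q, HasDerivAt (fun s : ℝ => S.interf q ((z.1 + s • d.1) q))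
      (S.dInterf q (z.1 q) (d.1 q)) 0 := fun q =>
    S.hasDerivAt_line_interf (hz q).1 (hz q).2.fa_lt (d.1 q)
  have h1 := HasDerivAt.fun_sum (u := Finset.univ) fun q _ =>
    S.hasDerivAt_line_dLag q (hz q).1 (hz q).2 d.1 (hl q) hp
  have h2 := HasDerivAt.fun_sum (u := Finset.univ) fun q _ =>
    ((hI q).sub_const (S.Imax q)).const_mul (d.2.1 q)
  have h3 := ((HasDerivAt.fun_sum (u := Finset.univ) fun q _ => hI q).sub_const
    S.Itot).const_mul d.2.2
  have h := (h1.sub h2).sub h3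
  have e : (fun s : ℝ => S.extMap (z + s • d) d) = fun s =>
      ∑ q, S.dLag q (z.2.1 q + s * d.2.1 q) (z.2.2 + s * d.2.2) (z.1 + s • d.1) (d.1 q) -
      ∑ q, d.2.1 q * (S.interf q ((z.1 + s • d.1) q) - S.Imax q) -
      d.2.2 * (∑ q, S.interf q ((z.1 + s • d.1) q) - S.Itot) := by
    ext s
    unfold extMap
    rw [globalI_eq]
    rfl
  rw [e]
  refine h.congr_deriv ?_
  simp only [zero_mul, add_zero, Finset.sum_add_distrib, add_mul, Finset.mul_sum]
  ring

lemma d2Lag_zero (q : Fin Q) (lam price : ℝ) (x : Profile Q N) : S.d2Lag q lam price x 0 = 0 := by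
  simp [d2Lag, d2Theta, d2Interf, d2Miss, dMiss, detDir, equiDev, rateDir, noiseDir]

variable [NeZero N] {pRef : Fin Q → Fin N → ℝ} {t : ℝ}

lemma hasDerivAt_extMap (hS : S.Valid) {z z' : Extended Q N} (hz : z ∈ S.extSet pRef t)
    (hz' : z' ∈ S.extSet pRef t) {s : ℝ} (hs : s ∈ Set.Icc (0 : ℝ) 1) :
    HasDerivAt (fun s : ℝ => S.extMap (z + s • (z' - z)) (z' - z))
      (∑ q, S.d2Lag q ((z + s • (z' - z)).2.1 q) (z + s • (z' - z)).2.2 (z + s • (z' - z)).1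
        (z' - z).1) s := by
  have hmem := (convex_extSet hS pRef t).add_smul_sub_mem hz hz' hs
  exact HasDerivAt.of_shift (g := fun u => S.extMap u (z' - z))
    (hasDerivAt_extMap_zero (smooth_of_mem_Yhat hS hmem.1) (z' - z))

lemma continuousOn_extMap (hS : S.Valid) {z z' : Extended Q N} (hz : z ∈ S.extSet pRef t)
    (hz' : z' ∈ S.extSet pRef t) :
    ContinuousOn (fun s : ℝ => S.extMap (z + s • (z' - z)) (z' - z)) (Set.Icc 0 1) :=
  fun _ hs => (hasDerivAt_extMap hS hz hz' hs).continuousAt.continuousWithinAt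

variable [NeZero Q]

/-- Along the segment the derivative is the form of `A` at the difference of the profiles. There is
no strictness in the multipliers, so uniqueness concerns only the strategies. -/
lemma extMap_lt (hS : S.Valid) (ht : S.lambdaMax < t) (hW : S.WeakCoupling pRef t)
    {z z' : Extended Q N} (hz : z ∈ S.extSet pRef t) (hz' : z' ∈ S.extSet pRef t)
    (hne : z.1 ≠ z'.1) : S.extMap z (z' - z) < S.extMap z' (z' - z) := by
  have hmono : StrictMonoOn (fun s : ℝ => S.extMap (z + s • (z' - z)) (z' - z))
      (Set.Icc 0 1) := by
    refine strictMonoOn_of_deriv_pos (convex_Icc 0 1) (continuousOn_extMap hS hz hz')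
      fun s hs => ?_
    have hs' := interior_subset hs
    have hmem := (convex_extSet hS pRef t).add_smul_sub_mem hz hz' hs'
    rw [(hasDerivAt_extMap hS hz hz' hs').deriv]
    exact sum_d2Lag_pos hS ht hW hmem.1 (sub_ne_zero.2 hne.symm)
      (fun q => hmem.2.1 q (Set.mem_univ q)) hmem.2.2
  simpa using hmono (Set.left_mem_Icc.2 zero_le_one) (Set.right_mem_Icc.2 zero_le_one) zero_lt_one

lemma extMap_le (hS : S.Valid) (ht : S.lambdaMax < t) (hW : S.WeakCoupling pRef t)
    {z z' : Extended Q N} (hz : z ∈ S.extSet pRef t) (hz' : z' ∈ S.extSet pRef t) :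
    S.extMap z (z' - z) ≤ S.extMap z' (z' - z) := by
  by_cases hne : z.1 = z'.1
  · have hmono : MonotoneOn (fun s : ℝ => S.extMap (z + s • (z' - z)) (z' - z))
        (Set.Icc 0 1) := by
      refine monotoneOn_of_deriv_nonneg (convex_Icc 0 1) (continuousOn_extMap hS hz hz')
        (fun s hs => (hasDerivAt_extMap hS hz hz'
          (interior_subset hs)).differentiableAt.differentiableWithinAt) fun s hs => ?_
      rw [(hasDerivAt_extMap hS hz hz' (interior_subset hs)).deriv]
      have : (z' - z).1 = 0 := sub_eq_zero.2 hne.symm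
      simp [this, d2Lag_zero]
    simpa using hmono (Set.left_mem_Icc.2 zero_le_one) (Set.right_mem_Icc.2 zero_le_one) zero_le_one
  · exact (extMap_lt hS ht hW hz hz' hne).le

/-- A general `K` is allowed because the whole of `extSet` yields existence of equilibria, and
slices of it yield multipliers at a given equilibrium. -/
lemma exists_extMap_nonneg (hS : S.Valid) (ht : S.lambdaMax < t) (hW : S.WeakCoupling pRef t)
    {K : Set (Extended Q N)} (hK : IsCompact K) (hconv : Convex ℝ K) (hne : K.Nonempty)
    (hsub : K ⊆ S.extSet pRef t) : ∃ z ∈ K, ∀ z' ∈ K, 0 ≤ S.extMap z (z' - z) := by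
  refine exists_variationalInequality hK hconv hne S.extMap S.extMap_isLinearMap ?_ ?_
  · intro z hz z' hz'
    have h := extMap_le hS ht hW (hsub hz) (hsub hz')
    rw [← neg_sub z' z, (S.extMap_isLinearMap z).map_neg]
    linarith
  · intro z hz z' hz'
    exact (hasDerivAt_extMap hS (hsub hz) (hsub hz')
      (Set.left_mem_Icc.2 zero_le_one)).continuousAt.continuousWithinAt

end CRSystem
end

/-! ### Equilibria as solutions of the variational inequality -/

noncomputable section
namespace CRSystem

variable {Q N : ℕ} {S : CRSystem Q N} {pRef : Fin Q → Fin N → ℝ} {t : ℝ}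

lemma add_single_eq_update (x : Profile Q N) (q : Fin Q) (s : ℝ) (v : Strategy N) :
    x + s • (Pi.single q v : Profile Q N) = Function.update x q (x q + s • v) := by
  ext r i
  by_cases h : r = q
  · subst h; simp
  · simp [h]

lemma update_mem_Y {x : Profile Q N} (hx : ∀ r, x r ∈ S.Y r) {q : Fin Q} {z : Strategy N}
    (hz : z ∈ S.Y q) (r : Fin Q) : Function.update x q z r ∈ S.Y r := by
  by_cases h : r = q
  · subst h; simpa using hz
  · simpa [h] using hx r

lemma globalI_update (S : CRSystem Q N) (x : Profile Q N) (q : Fin Q) (z : Strategy N) :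
    S.globalI (Function.update x q z) = S.globalI x - S.interf q (x q) + S.interf q z := by
  rw [globalI_eq, globalI_eq, ← Finset.add_sum_erase Finset.univ _ (Finset.mem_univ q),
    ← Finset.add_sum_erase Finset.univ (fun r => S.interf r (x r)) (Finset.mem_univ q),
    Finset.sum_congr rfl fun r hr => by
      rw [Function.update_of_ne (Finset.ne_of_mem_erase hr)]]
  simp only [Function.update_self]
  ring

lemma noiseInterf_update (S : CRSystem Q N) (x : Profile Q N) (q : Fin Q) (z : Strategy N)
    (k : Fin N) : S.noiseInterf (Function.update x q z) q k = S.noiseInterf x q k := by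
  unfold noiseInterf
  congr 1
  exact Finset.sum_congr rfl fun r hr => by
    rw [Function.update_of_ne (Finset.ne_of_mem_erase hr)]

lemma interf_nonneg (S : CRSystem Q N) {q : Fin Q} {z : Strategy N} (hz : ∀ k, 0 ≤ z.pow k) :
    0 ≤ S.interf q z :=
  Finset.sum_nonneg fun k _ => mul_nonneg (mul_nonneg (S.pMiss_pos q k z).le (S.w_nonneg q k))
    (hz k)

lemma interf_mk (S : CRSystem Q N) (q : Fin Q) (z : Strategy N) (p : Fin N → ℝ) :
    S.interf q (Strategy.mk z.tau p z.fa) = ∑ k, S.pMiss q k z * S.w q k * p k := rfl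

lemma mk_mem_Y {q : Fin Q} {z : Strategy N} (hz : z ∈ S.Y q) {p : Fin N → ℝ}
    (hp : p ∈ S.powerSet q) : Strategy.mk z.tau p z.fa ∈ S.Y q :=
  ⟨hz.1, hz.2.1, hz.2.2.1, hp, hz.2.2.2.2⟩

/-! ### Comparison with the reference power allocation -/

section Reference

/-- Total rate of the user `q` at the reference allocation and maximal interference. -/
def refRate (S : CRSystem Q N) (pRef : Fin Q → Fin N → ℝ) (q : Fin Q) : ℝ :=
  ∑ k, S.rate (Function.update S.pMax q (pRef q)) q k

lemma ref_rate_eq (S : CRSystem Q N) (q : Fin Q) (p : Fin N → ℝ) (k : Fin N) :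
    S.rate (Function.update S.pMax q p) q k = Real.log (1 + p k /
      (S.nNoise q k + ∑ r ∈ Finset.univ.erase q, S.nGain q r k * S.pMax r k)) := by
  unfold rate
  rw [Function.update_self, Finset.sum_congr rfl fun r hr => by
    rw [Function.update_of_ne (Finset.ne_of_mem_erase hr)]]

lemma refRate_pos (hS : S.Valid) {q : Fin Q} (hRef : S.IsRefPower q (pRef q)) :
    0 < S.refRate pRef q := by
  obtain ⟨k, hk⟩ := Function.ne_iff.1 hRef.2.1
  have h0 : ∀ j, 0 ≤ pRef q j / (S.nNoise q j + ∑ r ∈ Finset.univ.erase q,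
      S.nGain q r j * S.pMax r j) := fun j => div_nonneg (hRef.1.2 j).1 (maskNoise_pos hS q j).le
  refine Finset.sum_pos' (fun j _ => ?_) ⟨k, Finset.mem_univ k, ?_⟩
  · rw [ref_rate_eq]
    exact Real.log_nonneg (by linarith [h0 j])
  · rw [ref_rate_eq]
    have : 0 < pRef q k := lt_of_le_of_ne (hRef.1.2 k).1 (Ne.symm hk)
    exact Real.log_pos (by linarith [div_pos this (maskNoise_pos hS q k)])

lemma refRate_le_sumRate (hS : S.Valid) {q : Fin Q} (hRef : S.IsRefPower q (pRef q))
    {x : Profile Q N} (hx : S.PowBounds x) (τ φ : ℝ) :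
    S.refRate pRef q ≤ S.sumRate (Function.update x q (Strategy.mk τ (pRef q) φ)) q := by
  refine Finset.sum_le_sum fun k _ => ?_
  rw [ref_rate_eq, rate_eq, noiseInterf_update, Function.update_self, Strategy.pow_mk]
  have h1 := (hRef.1.2 k).1
  have h2 := noiseInterf_pos hS hx q k
  refine Real.log_le_log (by linarith [div_nonneg h1 (maskNoise_pos hS q k).le]) ?_
  gcongr
  exact noiseInterf_le_mask hx q k

lemma faRef_mem [NeZero N] (S : CRSystem Q N) (q : Fin Q) : S.faRef q ∈ Set.Ioo (0 : ℝ) 1 := by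
  obtain ⟨k, hk⟩ := exists_eq_ciSup_of_finite (f := fun k =>
    gaussQ ((S.sd1 q k * S.hAlpha q k + S.dmu q k * √(S.f q * S.tauMin q)) / S.sd0 q k))
  unfold faRef
  rw [← hk]
  exact ⟨gaussQ_pos _, gaussQ_lt_one _⟩

/-- The two sensing terms of `etaRef` only lower it, the first one strictly. The comparison below
keeps the sensing variables of the user, so it needs only the rate and the price terms. -/
lemma etaRef_lt [NeZero N] (hS : S.Valid) (q : Fin Q) :
    S.etaRef pRef t q < Real.log (S.refRate pRef q) - t / 2 * ∑ k, S.w q k * pRef q k := by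
  have h1 : Real.log (1 - S.tauMin q / S.T q) < 0 :=
    Real.log_neg (by linarith [tauMin_div_T_lt hS q])
      (by linarith [div_pos (hS.tauMin_pos q) (hS.T_pos q)])
  have hf := S.faRef_mem q
  have h2 : Real.log (1 - S.faRef q) ≤ 0 :=
    Real.log_nonpos (by linarith [hf.2]) (by linarith [hf.1])
  unfold etaRef
  change _ + _ + Real.log (S.refRate pRef q) - _ < _
  linarith

lemma powLow_lt_of_lt_log [NeZero N] (hS : S.Valid) {x : Profile Q N} (hx : S.PowBounds x)
    {q : Fin Q} (hR : 0 < S.sumRate x q) (h : S.etaRef pRef t q < Real.log (S.sumRate x q)) :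
    S.powLow pRef t q < ∑ k, (x q).pow k := by
  have hσ : 0 < ⨅ k, S.nNoise q k := finite_iInf_pos fun k => hS.nNoise_pos q k
  have h1 : Real.exp (S.etaRef pRef t q) < S.sumRate x q := by
    rw [← Real.exp_log hR]
    exact Real.exp_lt_exp.2 h
  have h2 := h1.trans_le (sumRate_le hS hx q)
  rwa [lt_div_iff₀ hσ, mul_comm] at h2

lemma powBounds_update {x : Profile Q N} (hx : S.PowBounds x) {q : Fin Q} {p : Fin N → ℝ}
    (hp : p ∈ S.powerSet q) (τ φ : ℝ) :
    S.PowBounds (Function.update x q (Strategy.mk τ p φ)) := by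
  intro r k
  by_cases h : r = q
  · subst h; simpa using hp.2 k
  · simpa [h] using hx r k

lemma sum_refPower_pos {q : Fin Q} (hRef : S.IsRefPower q (pRef q)) :
    0 < ∑ k, pRef q k := by
  obtain ⟨k, hk⟩ := Function.ne_iff.1 hRef.2.1
  exact Finset.sum_pos' (fun j _ => (hRef.1.2 j).1)
    ⟨k, Finset.mem_univ k, lt_of_le_of_ne (hRef.1.2 k).1 (Ne.symm hk)⟩

lemma powLow_le_sum_refPower [NeZero N] (hS : S.Valid) (ht : 0 ≤ t) {q : Fin Q}
    (hRef : S.IsRefPower q (pRef q)) {x : Profile Q N} (hx : S.PowBounds x) :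
    S.powLow pRef t q ≤ ∑ k, pRef q k := by
  have hb := powBounds_update hx hRef.1 0 0
  have h1 := refRate_le_sumRate hS hRef hx 0 0
  have h0 := refRate_pos hS hRef
  have h2 := etaRef_lt (pRef := pRef) (t := t) hS q
  have h3 : 0 ≤ ∑ k, S.w q k * pRef q k :=
    Finset.sum_nonneg fun k _ => mul_nonneg (S.w_nonneg q k) (hRef.1.2 k).1
  have h4 := Real.log_le_log h0 h1
  have h5 := powLow_lt_of_lt_log (pRef := pRef) (t := t) hS hb (h0.trans_le h1)
    (by nlinarith [mul_nonneg ht h3])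
  simpa using h5.le

lemma interf_ref_le (hS : S.Valid) {q : Fin Q} (hRef : S.IsRefPower q (pRef q)) {z : Strategy N}
    (hz : z ∈ S.Y q) :
    S.interf q (Strategy.mk z.tau (pRef q) z.fa) ≤ 1 / 2 * ∑ k, S.w q k * pRef q k := by
  rw [interf_mk, Finset.mul_sum]
  refine Finset.sum_le_sum fun k _ => ?_
  rw [mul_assoc]
  exact mul_le_mul_of_nonneg_right (Y_pMiss_le hS hz k)
    (mul_nonneg (S.w_nonneg q k) (hRef.1.2 k).1)

/-- Missed detection has probability at most one half on `Y`, which explains the factor two in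
`IsRefPower`. -/
lemma ref_mem_X (hS : S.Valid) {q : Fin Q} (hRef : S.IsRefPower q (pRef q)) {z : Strategy N}
    (hz : z ∈ S.Y q) : Strategy.mk z.tau (pRef q) z.fa ∈ S.X q := by
  refine ⟨mk_mem_Y hz hRef.1, ?_⟩
  have := interf_ref_le hS hRef hz
  have := hRef.2.2
  rw [localI_eq]
  linarith

/-- Replacing only the power by `pRef` leaves the sensing terms and the penalty unchanged, so the
hypothesis bounds the logarithm of the rate from below. The strictness makes the power constraint of
`Yhat` inactive. -/
lemma powLow_lt_of_theta_le [NeZero N] (hS : S.Valid) {q : Fin Q}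
    (hRef : S.IsRefPower q (pRef q)) {x : Profile Q N} (hx : ∀ r, x r ∈ S.Y r)
    (hp : 0 < ∑ k, (x q).pow k) {price : ℝ} (hpr : price ∈ Set.Icc 0 t)
    (h : S.theta q (Function.update x q (Strategy.mk (x q).tau (pRef q) (x q).fa)) -
      price * S.globalI (Function.update x q (Strategy.mk (x q).tau (pRef q) (x q).fa)) ≤
      S.theta q x - price * S.globalI x) :
    S.powLow pRef t q < ∑ k, (x q).pow k := by
  have hb := powBounds_of_mem_Y hx
  set z := Strategy.mk (x q).tau (pRef q) (x q).fa with hz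
  have hzX := ref_mem_X hS hRef (hx q)
  have hreg := regular_of_mem_Y hS hx hp
  have hreg' := regular_of_mem_Y (q := q) hS (update_mem_Y hx hzX.1) (by
    simpa [hz] using sum_refPower_pos hRef)
  have hE : S.equiDev q (Function.update x q z) = S.equiDev q x := by
    have : ∀ r, (Function.update x q z r).tau = (x r).tau := by
      intro r
      by_cases hr : r = q
      · subst hr; simp [hz]
      · simp [hr]
    unfold equiDev
    simp only [this]
  rw [hreg.theta_eq, hreg'.theta_eq, globalI_update, hE, Function.update_self] at h
  have h1 := refRate_le_sumRate hS hRef hb (x q).tau (x q).fa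
  rw [← hz] at h1
  have h2 := Real.log_le_log (refRate_pos hS hRef) h1
  have h3 := etaRef_lt (pRef := pRef) (t := t) hS q
  have h4 := interf_ref_le hS hRef (hx q)
  have h5 := S.interf_nonneg (q := q) (z := x q) fun k => (hb q k).1
  have h6 : price * S.interf q z ≤ t * (1 / 2 * ∑ k, S.w q k * pRef q k) :=
    mul_le_mul hpr.2 h4 (S.interf_nonneg fun k => (hRef.1.2 k).1) (hpr.1.trans hpr.2)
  have h7 := mul_nonneg hpr.1 h5
  refine powLow_lt_of_lt_log hS hb hreg.rate_pos ?_
  simp only [hz, Strategy.tau_mk, Strategy.fa_mk] at h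
  rw [← hz] at h
  linarith

end Reference

/-! ### Best responses of one user -/

lemma dLag_neg_pow (S : CRSystem Q N) (q : Fin Q) (lam price : ℝ) (x : Profile Q N) :
    S.dLag q lam price x (Strategy.mk 0 (-(x q).pow) 0) =
      (∑ k, (x q).pow k / S.recvPow x q k) / S.sumRate x q -
        (lam + price) * S.interf q (x q) := by
  have e : S.dInterf q (x q) (Strategy.mk 0 (-(x q).pow) 0) = -S.interf q (x q) := by
    unfold dInterf interf dMiss detDir
    rw [← Finset.sum_neg_distrib]
    refine Finset.sum_congr rfl fun k _ => ?_
    simp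
    ring
  unfold dLag dTheta
  rw [e]
  simp [neg_div]
  ring

/-- Moving towards zero power costs rate and saves interference. The relative loss of rate is at
most a ratio in which the total power cancels, which leaves a bound independent of the profile. -/
lemma mul_interf_le_priceBound [NeZero N] (hS : S.Valid) {q : Fin Q} {x : Profile Q N}
    (hx : ∀ r, x r ∈ S.Y r) (hp : 0 < ∑ k, (x q).pow k) {lam price : ℝ}
    (h : 0 ≤ S.dLag q lam price x (Strategy.mk 0 (-(x q).pow) 0)) :
    (lam + price) * S.interf q (x q) ≤ S.priceBound q := by
  rw [dLag_neg_pow] at h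
  have hb := powBounds_of_mem_Y hx
  have hreg := regular_of_mem_Y hS hx hp
  have hσ : 0 < ⨅ k, S.nNoise q k := finite_iInf_pos fun k => hS.nNoise_pos q k
  have hrm := rMin_pos hS q
  have h1 : ∑ k, (x q).pow k / S.recvPow x q k ≤ (∑ k, (x q).pow k) / ⨅ k, S.nNoise q k := by
    rw [Finset.sum_div]
    exact Finset.sum_le_sum fun k _ => div_le_div_of_nonneg_left (hb q k).1 hσ
      ((finite_iInf_le _ k).trans (nNoise_le_recvPow hb q k))
  have h2 : (∑ k, (x q).pow k / S.recvPow x q k) / S.sumRate x q ≤ S.priceBound q := by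
    calc _ ≤ ((∑ k, (x q).pow k) / ⨅ k, S.nNoise q k) / (S.rMin q * ∑ k, (x q).pow k) :=
          div_le_div₀ (by positivity) h1 (by positivity) (rMin_mul_le_sumRate hS hb q)
      _ = S.priceBound q := by
        unfold priceBound
        field_simp
  linarith

lemma lagrangian_line_deriv_zero (hS : S.Valid) [NeZero N] {x : Profile Q N}
    (hx : ∀ r, x r ∈ S.Y r) {q : Fin Q} (hp : 0 < ∑ k, (x q).pow k) (lam price : ℝ)
    (v : Strategy N) :
    HasDerivAt (fun s : ℝ => S.lagrangian q lam price (x + s • (Pi.single q v : Profile Q N)))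
      (S.dLag q lam price x v) 0 :=
  S.hasDerivAt_line_lagrangian q lam price (hx q).1 (regular_of_mem_Y hS hx hp) v

/-- First-order optimality implies strict global optimality for the Lagrangian of one user. -/
lemma lagrangian_lt_update [NeZero Q] [NeZero N] (hS : S.Valid) (ht : S.lambdaMax < t)
    (hW : S.WeakCoupling pRef t) {x : Profile Q N} (hx : ∀ r, x r ∈ S.Y r) {q : Fin Q}
    (hp : 0 < ∑ k, (x q).pow k) {z : Strategy N} (hz : z ∈ S.Y q) (hzp : 0 < ∑ k, z.pow k)
    (hne : z ≠ x q) {lam price : ℝ} (hl : lam ∈ Set.Icc 0 S.lambdaMax)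
    (hpr : price ∈ Set.Icc 0 t) (h : 0 ≤ S.dLag q lam price x (z - x q)) :
    S.lagrangian q lam price x < S.lagrangian q lam price (Function.update x q z) := by
  set v := z - x q with hv
  have hv0 : v ≠ 0 := sub_ne_zero.2 hne
  set d : Profile Q N := Pi.single q v with hd
  have hmem : ∀ s ∈ Set.Icc (0 : ℝ) 1, ∀ r, (x + s • d) r ∈ S.Y r := by
    intro s hs
    rw [hd, add_single_eq_update]
    exact update_mem_Y hx ((convex_Y hS q).add_smul_sub_mem (hx q) hz hs)
  have hpos : ∀ s ∈ Set.Icc (0 : ℝ) 1, 0 < ∑ k, ((x + s • d) q).pow k := by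
    intro s hs
    have e : ∑ k, ((x + s • d) q).pow k =
        (1 - s) * ∑ k, (x q).pow k + s * ∑ k, z.pow k := by
      rw [Finset.mul_sum, Finset.mul_sum, ← Finset.sum_add_distrib]
      refine Finset.sum_congr rfl fun k _ => ?_
      simp [hd, hv]
      ring
    rw [e]
    rcases eq_or_lt_of_le hs.1 with h0 | h0
    · simp [← h0, hp]
    · exact add_pos_of_nonneg_of_pos (mul_nonneg (sub_nonneg.2 hs.2) hp.le) (mul_pos h0 hzp)
  have hd1 : ∀ s ∈ Set.Icc (0 : ℝ) 1,
      HasDerivAt (fun s : ℝ => S.lagrangian q lam price (x + s • d))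
        (S.dLag q lam price (x + s • d) v) s := fun s hs =>
    HasDerivAt.of_shift (lagrangian_line_deriv_zero hS (hmem s hs) (hpos s hs) lam price v)
  have hdq : d q = v := by simp [hd]
  have hd2 : ∀ s ∈ Set.Icc (0 : ℝ) 1,
      HasDerivAt (fun s : ℝ => S.dLag q lam price (x + s • d) v)
        (S.d2Lag q lam price (x + s • d) d) s := fun s hs => by
    refine HasDerivAt.of_shift (g := fun x' => S.dLag q lam price x' v) ?_
    have := S.hasDerivAt_line_dLag q (hmem s hs q).1
      (regular_of_mem_Y hS (hmem s hs) (hpos s hs)) d (hasDerivAt_const (0 : ℝ) lam)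
      (hasDerivAt_const (0 : ℝ) price)
    simpa only [hdq, add_zero, zero_mul] using this
  -- The slope of the Lagrangian along the segment is strictly increasing and starts nonnegative, so
  -- the Lagrangian itself strictly increases.
  have hm1 : StrictMonoOn (fun s : ℝ => S.dLag q lam price (x + s • d) v) (Set.Icc 0 1) := by
    refine strictMonoOn_of_deriv_pos (convex_Icc 0 1)
      (fun s hs => (hd2 s hs).continuousAt.continuousWithinAt) fun s hs => ?_
    have hs' := interior_subset hs
    rw [(hd2 s hs').deriv]
    exact d2Lag_single_pos hS ht hW (hmem s hs') (hpos s hs') hv0 hl hpr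
  have hm2 : StrictMonoOn (fun s : ℝ => S.lagrangian q lam price (x + s • d))
      (Set.Icc 0 1) := by
    refine strictMonoOn_of_deriv_pos (convex_Icc 0 1)
      (fun s hs => (hd1 s hs).continuousAt.continuousWithinAt) fun s hs => ?_
    have hs' := interior_subset hs
    rw [(hd1 s hs').deriv]
    rw [interior_Icc] at hs
    have := hm1 (Set.left_mem_Icc.2 zero_le_one) hs' hs.1
    simp only [zero_smul, add_zero] at this
    exact h.trans_lt this
  have h1 := hm2 (Set.left_mem_Icc.2 zero_le_one) (Set.right_mem_Icc.2 zero_le_one) zero_lt_one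
  have e : x + (1 : ℝ) • d = Function.update x q z := by
    rw [hd, add_single_eq_update, hv, one_smul, add_sub_cancel]
  simpa only [zero_smul, add_zero, e] using h1

/-- The part of the variational inequality that concerns the user `q`. -/
structure UserVI (S : CRSystem Q N) (pRef : Fin Q → Fin N → ℝ) (t : ℝ) (q : Fin Q)
    (lam price : ℝ) (x : Profile Q N) : Prop where
  first_order : ∀ z ∈ S.Y q, S.powLow pRef t q ≤ ∑ k, z.pow k →
    0 ≤ S.dLag q lam price x (z - x q)
  lam_mem : lam ∈ Set.Icc 0 S.lambdaMax
  compl : ∀ l ∈ Set.Icc 0 S.lambdaMax, (l - lam) * S.localI q (x q) ≤ 0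

namespace UserVI

variable [NeZero Q] [NeZero N] {q : Fin Q} {lam price : ℝ} {x : Profile Q N}

/-- Convexity compares the Lagrangian at `x` with its value at the reference power. Complementarity
gives `lam * localI ≥ 0` at `x`, and the reference strategy is feasible; so the multiplier terms can
be dropped and the payoffs compared. -/
lemma powLow_lt (h : S.UserVI pRef t q lam price x) (hS : S.Valid) (ht : S.lambdaMax < t)
    (hW : S.WeakCoupling pRef t) (hRef : S.IsRefPower q (pRef q)) (hx : x ∈ S.Yhat pRef t)
    (hpr : price ∈ Set.Icc 0 t) : S.powLow pRef t q < ∑ k, (x q).pow k := by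
  have hxY := fun r => (hx r).1
  have hp := (powLow_pos hS q).trans_le (hx q).2
  have ht0 : 0 ≤ t := (lambdaMax_pos hS).le.trans ht.le
  refine powLow_lt_of_theta_le hS hRef hxY hp hpr ?_
  set z := Strategy.mk (x q).tau (pRef q) (x q).fa with hz
  have hzX := ref_mem_X hS hRef (hx q).1
  have hzp : S.powLow pRef t q ≤ ∑ k, z.pow k :=
    powLow_le_sum_refPower hS ht0 hRef (powBounds_of_mem_Y hxY)
  have hle : S.lagrangian q lam price x ≤ S.lagrangian q lam price (Function.update x q z) := by
    by_cases hne : z = x q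
    · rw [hne, Function.update_eq_self]
    · exact (lagrangian_lt_update hS ht hW hxY hp hzX.1 ((powLow_pos hS q).trans_le hzp) hne
        h.lam_mem hpr (h.first_order z hzX.1 hzp)).le
  unfold lagrangian at hle
  rw [Function.update_self] at hle
  have h1 := h.compl 0 ⟨le_rfl, (lambdaMax_pos hS).le⟩
  have h2 := mul_nonneg h.lam_mem.1 (neg_nonneg.2 hzX.2)
  linarith

lemma first_order' (h : S.UserVI pRef t q lam price x) (hS : S.Valid) (ht : S.lambdaMax < t)
    (hW : S.WeakCoupling pRef t) (hRef : S.IsRefPower q (pRef q)) (hx : x ∈ S.Yhat pRef t)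
    (hpr : price ∈ Set.Icc 0 t) {z : Strategy N} (hz : z ∈ S.Y q) :
    0 ≤ S.dLag q lam price x (z - x q) := by
  have h1 := h.powLow_lt hS ht hW hRef hx hpr
  have h0 := powLow_pos (pRef := pRef) (t := t) hS q
  have hX : 0 < ∑ k, (x q).pow k := h0.trans h1
  -- The step for which `(1 - ε)` times the current power equals `powLow`; the other endpoint adds
  -- nonnegative power.
  set ε := 1 - S.powLow pRef t q / ∑ k, (x q).pow k with hε
  have hε0 : 0 < ε := sub_pos.2 ((div_lt_one hX).2 h1)
  have hε1 : ε ≤ 1 := by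
    have := div_pos h0 hX
    linarith
  have hmem := (convex_Y hS q).add_smul_sub_mem (hx q).1 hz ⟨hε0.le, hε1⟩
  have hsum : S.powLow pRef t q ≤ ∑ k, (x q + ε • (z - x q)).pow k := by
    have e : ∑ k, (x q + ε • (z - x q)).pow k =
        (1 - ε) * ∑ k, (x q).pow k + ε * ∑ k, z.pow k := by
      rw [Finset.mul_sum, Finset.mul_sum, ← Finset.sum_add_distrib]
      refine Finset.sum_congr rfl fun k _ => ?_
      simp
      ring
    have e2 : (1 - ε) * ∑ k, (x q).pow k = S.powLow pRef t q := by
      rw [hε, sub_sub_cancel, div_mul_cancel₀ _ hX.ne']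
    rw [e, e2]
    exact le_add_of_nonneg_right (mul_nonneg hε0.le (Finset.sum_nonneg fun k _ =>
      (hz.2.2.2.1.2 k).1))
  have h2 := h.first_order _ hmem hsum
  rw [add_sub_cancel_left, (S.dLag_isLinearMap q lam price x).map_smul, smul_eq_mul] at h2
  exact nonneg_of_mul_nonneg_right h2 hε0

/-- A violated constraint would push the multiplier to `lambdaMax`. The test towards zero power then
gives `lambdaMax * interf ≤ priceBound ≤ lambdaMax * Imax`, so the constraint holds after all. -/
lemma localI_nonpos (h : S.UserVI pRef t q lam price x) (hS : S.Valid) (ht : S.lambdaMax < t)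
    (hW : S.WeakCoupling pRef t) (hRef : S.IsRefPower q (pRef q)) (hx : x ∈ S.Yhat pRef t)
    (hpr : price ∈ Set.Icc 0 t) : S.localI q (x q) ≤ 0 := by
  have hxq := (hx q).1
  have hzero : (0 : Fin N → ℝ) ∈ S.powerSet q :=
    ⟨by simpa using (hS.budget_pos q).le, fun k => ⟨le_rfl, (hS.pMax_pos q k).le⟩⟩
  have h1 := h.first_order' hS ht hW hRef hx hpr (mk_mem_Y hxq hzero)
  have e : Strategy.mk (x q).tau 0 (x q).fa - x q = Strategy.mk 0 (-(x q).pow) 0 :=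
    Strategy.ext_coords (by simp) (fun k => by simp) (by simp)
  rw [e] at h1
  have h2 := mul_interf_le_priceBound hS (fun r => (hx r).1)
    ((powLow_pos hS q).trans_le (hx q).2) h1
  have h3 := priceBound_le_Imax_mul hS q
  have hΛ := lambdaMax_pos hS
  by_contra! hpos
  have h4 : lam = S.lambdaMax := by
    refine le_antisymm h.lam_mem.2 ?_
    have := h.compl S.lambdaMax ⟨hΛ.le, le_rfl⟩
    by_contra! hlt
    linarith [mul_pos (sub_pos.2 hlt) hpos]
  rw [localI_eq] at hpos
  have hI := hS.Imax_pos q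
  have h5 : S.lambdaMax * S.interf q (x q) ≤ (lam + price) * S.interf q (x q) := by
    refine mul_le_mul_of_nonneg_right ?_ (by linarith)
    linarith [hpr.1]
  have h6 := mul_pos hΛ hpos
  linarith

lemma compl_eq (h : S.UserVI pRef t q lam price x) (hS : S.Valid) (ht : S.lambdaMax < t)
    (hW : S.WeakCoupling pRef t) (hRef : S.IsRefPower q (pRef q)) (hx : x ∈ S.Yhat pRef t)
    (hpr : price ∈ Set.Icc 0 t) : lam * S.localI q (x q) = 0 := by
  have h1 := h.localI_nonpos hS ht hW hRef hx hpr
  have h2 := h.compl 0 ⟨le_rfl, (lambdaMax_pos hS).le⟩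
  have h3 := mul_nonneg h.lam_mem.1 (neg_nonneg.2 h1)
  linarith

lemma lagrangian_lt (h : S.UserVI pRef t q lam price x) (hS : S.Valid) (ht : S.lambdaMax < t)
    (hW : S.WeakCoupling pRef t) (hRef : S.IsRefPower q (pRef q)) (hx : x ∈ S.Yhat pRef t)
    (hpr : price ∈ Set.Icc 0 t) {z : Strategy N} (hz : z ∈ S.Y q) (hzp : 0 < ∑ k, z.pow k)
    (hne : z ≠ x q) :
    S.lagrangian q lam price x < S.lagrangian q lam price (Function.update x q z) :=
  lagrangian_lt_update hS ht hW (fun r => (hx r).1) ((powLow_pos hS q).trans_le (hx q).2) hz hzp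
    hne h.lam_mem hpr (h.first_order' hS ht hW hRef hx hpr hz)

end UserVI

lemma throughput_pos_iff [NeZero N] (hS : S.Valid) {x : Profile Q N} (hx : ∀ r, x r ∈ S.Y r)
    (q : Fin Q) : 0 < S.throughput q x ↔ 0 < ∑ k, (x q).pow k := by
  have h1 := Y_tau_lt hS (hx q)
  have h2 := Y_fa_le hS (hx q)
  rw [throughput_eq, mul_pos_iff_of_pos_left (mul_pos (by linarith) (by linarith)),
    sumRate_pos_iff hS (powBounds_of_mem_Y hx)]

/-- The multiplier term vanishes at `x` and is nonpositive at feasible strategies, so minimality of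
the Lagrangian becomes maximality of the payoff. Deviations with zero throughput have payoff `⊥`. -/
lemma UserVI.bestResponse [NeZero Q] [NeZero N] {q : Fin Q} {lam price : ℝ} {x : Profile Q N}
    (h : S.UserVI pRef t q lam price x) (hS : S.Valid) (ht : S.lambdaMax < t)
    (hW : S.WeakCoupling pRef t) (hRef : S.IsRefPower q (pRef q)) (hx : x ∈ S.Yhat pRef t)
    (hpr : price ∈ Set.Icc 0 t) :
    x q ∈ S.X q ∧
      ∀ z ∈ S.X q, S.payoff q (Function.update x q z) price ≤ S.payoff q x price := by
  refine ⟨⟨(hx q).1, h.localI_nonpos hS ht hW hRef hx hpr⟩, fun z hz => ?_⟩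
  have hxY := fun r => (hx r).1
  have hup := update_mem_Y hxY hz.1
  unfold payoff
  rw [if_pos ((throughput_pos_iff hS hxY q).2 ((powLow_pos hS q).trans_le (hx q).2))]
  split_ifs with hth
  · rw [throughput_pos_iff hS hup, Function.update_self] at hth
    rw [EReal.coe_le_coe_iff]
    by_cases hne : z = x q
    · rw [hne, Function.update_eq_self]
    · have h1 := h.lagrangian_lt hS ht hW hRef hx hpr hz.1 hth hne
      unfold lagrangian at h1
      rw [Function.update_self, h.compl_eq hS ht hW hRef hx hpr] at h1
      have h2 := mul_nonneg h.lam_mem.1 (neg_nonneg.2 hz.2)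
      linarith
  · exact bot_le

/-! ### Properties of best responses -/

namespace BestResponses

variable {x : Profile Q N} {price : ℝ}

lemma mem_Y (h : S.BestResponses x price) (r : Fin Q) : x r ∈ S.Y r := (h r).1.1

/-- Zero power would give payoff `⊥`, while the feasible reference power gives a real number. -/
lemma sum_pow_pos [NeZero N] (h : S.BestResponses x price) (hS : S.Valid) {q : Fin Q}
    (hRef : S.IsRefPower q (pRef q)) : 0 < ∑ k, (x q).pow k := by
  rw [← throughput_pos_iff hS h.mem_Y]
  have hz := ref_mem_X hS hRef (h.mem_Y q)
  have h1 := (h q).2 _ hz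
  by_contra hcon
  have h2 : 0 < S.throughput q
      (Function.update x q (Strategy.mk (x q).tau (pRef q) (x q).fa)) := by
    rw [throughput_pos_iff hS (update_mem_Y h.mem_Y hz.1), Function.update_self]
    exact sum_refPower_pos hRef
  unfold payoff at h1
  rw [if_pos h2, if_neg hcon, le_bot_iff] at h1
  exact EReal.coe_ne_bot _ h1

lemma theta_le [NeZero N] (h : S.BestResponses x price) (hS : S.Valid) {q : Fin Q}
    (hRef : S.IsRefPower q (pRef q)) {z : Strategy N} (hz : z ∈ S.X q)
    (hzp : 0 < ∑ k, z.pow k) :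
    S.theta q (Function.update x q z) - price * S.globalI (Function.update x q z) ≤
      S.theta q x - price * S.globalI x := by
  have h1 := (h q).2 z hz
  unfold payoff at h1
  rw [if_pos ((throughput_pos_iff hS h.mem_Y q).2 (h.sum_pow_pos hS hRef)),
    if_pos ((throughput_pos_iff hS (update_mem_Y h.mem_Y hz.1) q).2 (by simpa using hzp)),
    EReal.coe_le_coe_iff] at h1
  exact h1

lemma powLow_lt [NeZero N] (h : S.BestResponses x price) (hS : S.Valid) {q : Fin Q}
    (hRef : S.IsRefPower q (pRef q)) (hpr : price ∈ Set.Icc 0 t) :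
    S.powLow pRef t q < ∑ k, (x q).pow k :=
  powLow_lt_of_theta_le hS hRef h.mem_Y (h.sum_pow_pos hS hRef) hpr
    (h.theta_le hS hRef (ref_mem_X hS hRef (h.mem_Y q)) (by
      simpa using sum_refPower_pos hRef))

/-- Scaling all powers by `1 - s` preserves feasibility, so a best response has nonnegative
one-sided derivative in this direction. Neither convexity nor a multiplier is involved, hence `lam =
0`. -/
lemma price_mul_interf_le [NeZero N] (h : S.BestResponses x price) (hS : S.Valid) {q : Fin Q}
    (hRef : S.IsRefPower q (pRef q)) :
    price * S.interf q (x q) ≤ S.priceBound q := by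
  have hp := h.sum_pow_pos hS hRef
  have hb := powBounds_of_mem_Y h.mem_Y
  set v : Strategy N := Strategy.mk 0 (-(x q).pow) 0 with hv
  have hd := lagrangian_line_deriv_zero hS h.mem_Y hp 0 price v
  have hscale : ∀ s : ℝ, x q + s • v = Strategy.mk (x q).tau (fun k => (1 - s) * (x q).pow k)
      (x q).fa := fun s =>
    Strategy.ext_coords (by simp [hv]) (fun k => by simp [hv]; ring) (by simp [hv])
  have hmin : ∀ s ∈ Set.Ioo (0 : ℝ) 1, S.lagrangian q 0 price x ≤
      S.lagrangian q 0 price (x + s • (Pi.single q v : Profile Q N)) := by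
    intro s hs
    have hs1 : 0 < 1 - s := sub_pos.2 hs.2
    rw [add_single_eq_update, hscale]
    have hle : ∀ k, (1 - s) * (x q).pow k ≤ (x q).pow k := fun k =>
      mul_le_of_le_one_left (hb q k).1 (by linarith [hs.1])
    have hps : (fun k => (1 - s) * (x q).pow k) ∈ S.powerSet q :=
      ⟨(Finset.sum_le_sum fun k _ => hle k).trans (h.mem_Y q).2.2.2.1.1, fun k =>
        ⟨mul_nonneg hs1.le (hb q k).1, (hle k).trans (hb q k).2⟩⟩
    have hzX : Strategy.mk (x q).tau (fun k => (1 - s) * (x q).pow k) (x q).fa ∈ S.X q := by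
      refine ⟨mk_mem_Y (h.mem_Y q) hps, le_trans ?_ (h q).1.2⟩
      rw [localI_eq, localI_eq, interf_mk]
      refine sub_le_sub_right (Finset.sum_le_sum fun k _ => ?_) _
      exact mul_le_mul_of_nonneg_left (hle k)
        (mul_nonneg (S.pMiss_pos q k _).le (S.w_nonneg q k))
    have := h.theta_le hS hRef hzX (by
      rw [Strategy.pow_mk, ← Finset.mul_sum]
      exact mul_pos hs1 hp)
    unfold lagrangian
    linarith
  have hnonneg : 0 ≤ S.dLag q 0 price x v := by
    have hslope := hd.tendsto_slope_zero_right
    refine ge_of_tendsto hslope ?_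
    filter_upwards [Ioo_mem_nhdsGT (zero_lt_one' ℝ)] with s hs
    have h1 := hmin s hs
    simp only [zero_add, zero_smul, add_zero, smul_eq_mul]
    exact mul_nonneg (inv_nonneg.2 hs.1.le) (sub_nonneg.2 h1)
  have := mul_interf_le_priceBound hS h.mem_Y hp hnonneg
  rwa [zero_add] at this

/-- Summed over the users, the individual bounds give `price * Itot ≤ price * ∑ interf ≤ Itot *
lambdaMax`. -/
lemma price_le [NeZero Q] [NeZero N] (h : S.BestResponses x price) (hS : S.Valid)
    (hRef : ∀ q, S.IsRefPower q (pRef q)) (hpr : 0 ≤ price) (hI : 0 ≤ S.globalI x) :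
    price ≤ S.lambdaMax := by
  have h1 : price * ∑ q, S.interf q (x q) ≤ ∑ q, S.priceBound q := by
    rw [Finset.mul_sum]
    exact Finset.sum_le_sum fun q _ => h.price_mul_interf_le hS (hRef q)
  rw [globalI_eq] at hI
  have h2 := mul_nonneg hpr hI
  have h3 := sum_priceBound_le hS
  have h4 : S.Itot * price ≤ S.Itot * S.lambdaMax := by linarith
  exact le_of_mul_le_mul_left h4 hS.Itot_pos

end BestResponses

/-! ### Equilibria -/

section Equilibria

variable {x : Profile Q N} {price : ℝ}

lemma extMap_update (S : CRSystem Q N) (z : Extended Q N) (q : Fin Q) (u : Strategy N) :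
    S.extMap z ((Function.update z.1 q u, z.2.1, z.2.2) - z) =
      S.dLag q (z.2.1 q) z.2.2 z.1 (u - z.1 q) := by
  unfold extMap
  simp only [Prod.fst_sub, Prod.snd_sub, sub_self, Prod.fst_zero, Prod.snd_zero,
    Pi.zero_apply, zero_mul, Finset.sum_const_zero, sub_zero, Pi.sub_apply]
  rw [Finset.sum_eq_single q]
  · rw [Function.update_self]
  · intro r _ hr
    rw [Function.update_of_ne hr, sub_self, (S.dLag_isLinearMap _ _ _ _).map_zero]
  · simp

lemma extMap_update_lam (S : CRSystem Q N) (z : Extended Q N) (q : Fin Q) (l : ℝ) :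
    S.extMap z ((z.1, Function.update z.2.1 q l, z.2.2) - z) =
      -((l - z.2.1 q) * S.localI q (z.1 q)) := by
  unfold extMap
  simp only [Prod.fst_sub, Prod.snd_sub, sub_self, zero_mul, Pi.sub_apply, sub_zero,
    (S.dLag_isLinearMap _ _ _ _).map_zero, Finset.sum_const_zero, zero_sub]
  rw [Finset.sum_eq_single q]
  · rw [Function.update_self]
  · intro r _ hr
    rw [Function.update_of_ne hr, sub_self, zero_mul]
  · simp

lemma extMap_price (S : CRSystem Q N) (z : Extended Q N) (m : ℝ) :
    S.extMap z ((z.1, z.2.1, m) - z) = -((m - z.2.2) * S.globalI z.1) := by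
  unfold extMap
  simp [(S.dLag_isLinearMap _ _ _ _).map_zero]

lemma update_mem_Yhat {y : Profile Q N} (hy : y ∈ S.Yhat pRef t) {q : Fin Q} {u : Strategy N}
    (hu : u ∈ S.Y q) (hup : S.powLow pRef t q ≤ ∑ k, u.pow k) :
    Function.update y q u ∈ S.Yhat pRef t := by
  intro r
  by_cases h : r = q
  · subst h; simpa using ⟨hu, hup⟩
  · simpa [h] using hy r

lemma userVI_of_extMap {K : Set (Extended Q N)} (hsub : K ⊆ S.extSet pRef t) {z : Extended Q N}
    (hz : z ∈ K) (hvi : ∀ z' ∈ K, 0 ≤ S.extMap z (z' - z)) (q : Fin Q)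
    (hu : ∀ u ∈ S.Y q, S.powLow pRef t q ≤ ∑ k, u.pow k →
      (Function.update z.1 q u, z.2.1, z.2.2) ∈ K)
    (hl : ∀ l ∈ Set.Icc 0 S.lambdaMax, (z.1, Function.update z.2.1 q l, z.2.2) ∈ K) :
    S.UserVI pRef t q (z.2.1 q) z.2.2 z.1 where
  first_order u hY hp := by
    rw [← extMap_update]
    exact hvi _ (hu u hY hp)
  lam_mem := (hsub hz).2.1 q (Set.mem_univ q)
  compl l hmem := by
    have := hvi _ (hl l hmem)
    rw [extMap_update_lam] at this
    linarith

lemma update_lam_mem {lam : Fin Q → ℝ} (h : lam ∈ Set.univ.pi fun _ => Set.Icc 0 S.lambdaMax)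
    {q : Fin Q} {l : ℝ} (hl : l ∈ Set.Icc 0 S.lambdaMax) :
    Function.update lam q l ∈ Set.univ.pi fun _ => Set.Icc 0 S.lambdaMax := by
  intro r _
  by_cases hr : r = q
  · subst hr; simpa using hl
  · simpa [hr] using h r (Set.mem_univ r)

/-- The conditions of the separate users and the complementarity of the price add up to the joint
variational inequality. -/
lemma extMap_nonneg_of_userVI {lam : Fin Q → ℝ} (hlam : ∀ q, S.UserVI pRef t q (lam q) price x)
    (hne : S.IsNE x price) {z : Extended Q N} (hz : z ∈ S.extSet pRef t) :
    0 ≤ S.extMap (x, lam, price) (z - (x, lam, price)) := by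
  unfold extMap
  have h1 : 0 ≤ ∑ q, S.dLag q (lam q) price x (z.1 q - x q) :=
    Finset.sum_nonneg fun q _ => (hlam q).first_order _ (hz.1 q).1 (hz.1 q).2
  have h2 : ∑ q, (z.2.1 q - lam q) * S.localI q (x q) ≤ 0 :=
    Finset.sum_nonpos fun q _ => (hlam q).compl _ (hz.2.1 q (Set.mem_univ q))
  have h3 : (z.2.2 - price) * S.globalI x ≤ 0 := by
    have := mul_nonneg hz.2.2.1 (neg_nonneg.2 hne.2.2.1)
    rw [sub_mul, hne.2.2.2]
    linarith
  change 0 ≤ ∑ q, S.dLag q (lam q) price x (z.1 q - x q) -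
    ∑ q, (z.2.1 q - lam q) * S.localI q (x q) - (z.2.2 - price) * S.globalI x
  linarith

variable [NeZero Q] [NeZero N]

/-- If the global constraint were violated, the price would be `t`; but best responses then force it
below `lambdaMax < t`. -/
lemma IsTruncNE.isNE (h : S.IsTruncNE t x price) (hS : S.Valid)
    (hRef : ∀ q, S.IsRefPower q (pRef q)) (ht : S.lambdaMax < t) : S.IsNE x price := by
  obtain ⟨hbr, hpr, hmax⟩ := h
  have ht0 : 0 < t := (lambdaMax_pos hS).trans ht
  have hI : S.globalI x ≤ 0 := by
    by_contra! hpos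
    have h1 := hbr.price_le hS hRef hpr.1 hpos.le
    have h2 := le_of_mul_le_mul_right (hmax t ⟨ht0.le, le_rfl⟩) hpos
    linarith
  refine ⟨hbr, hpr.1, hI, ?_⟩
  have h1 := hmax 0 ⟨le_rfl, ht0.le⟩
  have h2 := mul_nonneg hpr.1 (neg_nonneg.2 hI)
  linarith

lemma IsNE.price_mem (h : S.IsNE x price) (hS : S.Valid) (hRef : ∀ q, S.IsRefPower q (pRef q))
    (ht : S.lambdaMax < t) : price ∈ Set.Icc 0 t := by
  obtain ⟨hbr, hpr, hI, hc⟩ := h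
  refine ⟨hpr, ?_⟩
  rcases mul_eq_zero.1 hc with h0 | h0
  · rw [h0]; exact (lambdaMax_pos hS).le.trans ht.le
  · exact (hbr.price_le hS hRef hpr h0.ge).trans ht.le

lemma IsNE.mem_Yhat (h : S.IsNE x price) (hS : S.Valid) (hRef : ∀ q, S.IsRefPower q (pRef q))
    (ht : S.lambdaMax < t) : x ∈ S.Yhat pRef t := fun q =>
  ⟨h.1.mem_Y q, (h.1.powLow_lt hS (hRef q) (h.price_mem hS hRef ht)).le⟩

lemma exists_isTruncNE (hS : S.Valid) (hne : ∀ q, (S.X q).Nonempty)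
    (hRef : ∀ q, S.IsRefPower q (pRef q)) (ht : S.lambdaMax < t)
    (hW : S.WeakCoupling pRef t) : ∃ x price, S.IsTruncNE t x price := by
  have ht0 : 0 ≤ t := (lambdaMax_pos hS).le.trans ht.le
  choose x₀ hx₀ using hne
  have hb := powBounds_of_mem_Y fun r => (hx₀ r).1
  have hnonempty : (S.extSet pRef t).Nonempty :=
    ⟨(fun q => Strategy.mk (x₀ q).tau (pRef q) (x₀ q).fa, 0, 0),
      fun q => ⟨mk_mem_Y (hx₀ q).1 (hRef q).1, powLow_le_sum_refPower hS ht0 (hRef q) hb⟩,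
      fun q _ => ⟨le_rfl, (lambdaMax_pos hS).le⟩, le_rfl, ht0⟩
  obtain ⟨z, hz, hvi⟩ := exists_extMap_nonneg hS ht hW (isCompact_extSet hS pRef t)
    (convex_extSet hS pRef t) hnonempty le_rfl
  refine ⟨z.1, z.2.2, fun q => ?_, hz.2.2, fun m hm => ?_⟩
  · refine UserVI.bestResponse (userVI_of_extMap le_rfl hz hvi q
      (fun u hY hp => ⟨update_mem_Yhat hz.1 hY hp, hz.2⟩)
      (fun l hl => ⟨hz.1, update_lam_mem hz.2.1 hl, hz.2.2⟩)) hS ht hW (hRef q) hz.1 hz.2.2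
  · have := hvi (z.1, z.2.1, m) ⟨hz.1, hz.2.1, hm⟩
    rw [extMap_price] at this
    linarith

/-- At an equilibrium every user has a multiplier of the local interference constraint. -/
lemma IsNE.exists_userVI (h : S.IsNE x price) (hS : S.Valid)
    (hRef : ∀ q, S.IsRefPower q (pRef q)) (ht : S.lambdaMax < t) (hW : S.WeakCoupling pRef t)
    (q : Fin Q) : ∃ lam, S.UserVI pRef t q lam price x := by
  have hpr := h.price_mem hS hRef ht
  have hx := h.mem_Yhat hS hRef ht
  -- Convexity of `localI` is not available for a standard multiplier theorem. Instead, the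
  -- variational inequality is solved on the slice where the other users and the price are frozen,
  -- and its solution is then identified with the equilibrium.
  set C : Set (Extended Q N) := {z | (∀ r ≠ q, z.1 r = x r) ∧ z.2.2 = price} with hC
  have hCclosed : IsClosed C := by
    have e : C = (⋂ r, ⋂ (_ : r ≠ q), {z : Extended Q N | z.1 r = x r}) ∩
        {z | z.2.2 = price} := by
      ext z
      simp [hC]
    rw [e]
    exact (isClosed_iInter fun r => isClosed_iInter fun _ =>
      isClosed_eq ((continuous_apply r).comp continuous_fst) continuous_const).inter
      (isClosed_eq (continuous_snd.comp continuous_snd) continuous_const)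
  have hCconv : Convex ℝ C := by
    intro z hz z' hz' a b ha hb hab
    refine ⟨fun r hr => ?_, ?_⟩
    · change a • z.1 r + b • z'.1 r = x r
      rw [hz.1 r hr, hz'.1 r hr, ← add_smul, hab, one_smul]
    · change a • z.2.2 + b • z'.2.2 = price
      rw [hz.2, hz'.2, ← add_smul, hab, one_smul]
  have hxK : (x, 0, price) ∈ S.extSet pRef t ∩ C :=
    ⟨⟨hx, fun r _ => ⟨le_rfl, (lambdaMax_pos hS).le⟩, hpr⟩, fun r _ => rfl, rfl⟩
  obtain ⟨z, hz, hvi⟩ := exists_extMap_nonneg hS ht hW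
    ((isCompact_extSet hS pRef t).inter_right hCclosed)
    ((convex_extSet hS pRef t).inter hCconv) ⟨_, hxK⟩ Set.inter_subset_left
  have hVI := userVI_of_extMap Set.inter_subset_left hz hvi q
    (fun u hY hp => ⟨⟨update_mem_Yhat hz.1.1 hY hp, hz.1.2⟩, fun r hr => by
      simpa [hr] using hz.2.1 r hr, hz.2.2⟩)
    (fun l hl => ⟨⟨hz.1.1, update_lam_mem hz.1.2.1 hl, hz.1.2.2⟩, hz.2.1, hz.2.2⟩)
  obtain ⟨⟨x', lam, price'⟩, hzz⟩ : ∃ z', z' = z := ⟨z, rfl⟩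
  subst hzz
  obtain ⟨⟨hx', -, -⟩, hxr, hp'⟩ := hz
  simp only at hx' hxr hp' hVI
  subst hp'
  have hup : Function.update x q (x' q) = x' := by
    ext r : 1
    by_cases hr : r = q
    · subst hr; simp
    · rw [Function.update_of_ne hr, hxr r hr]
  have hup' : Function.update x' q (x q) = x := by
    rw [← hup, Function.update_idem, Function.update_eq_self]
  have hbr := hVI.bestResponse hS ht hW (hRef q) hx' hpr
  have hle := h.1.theta_le hS (hRef q) hbr.1 ((powLow_pos hS q).trans_le (hx' q).2)
  rw [hup] at hle
  -- The slice solution is the strict minimizer of its Lagrangian, and the equilibrium strategy has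
  -- at least its payoff; distinct strategies would contradict each other.
  have heq : x q = x' q := by
    by_contra hne
    have hlt := hVI.lagrangian_lt hS ht hW (hRef q) hx' hpr (hx q).1
      ((powLow_pos hS q).trans_le (hx q).2) hne
    rw [hup'] at hlt
    unfold lagrangian at hlt
    rw [hVI.compl_eq hS ht hW (hRef q) hx' hpr] at hlt
    have := mul_nonneg hVI.lam_mem.1 (neg_nonneg.2 (h.1 q).1.2)
    linarith
  have hxx : x' = x := by rw [← hup, ← heq, Function.update_eq_self]
  rw [hxx] at hVI
  exact ⟨_, hVI⟩

/-- With their multipliers both equilibria solve the variational inequality. Testing each against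
the other contradicts strict monotonicity unless the profiles coincide. -/
lemma IsNE.unique (h : S.IsNE x price) {x' : Profile Q N} {price' : ℝ} (h' : S.IsNE x' price')
    (hS : S.Valid) (hRef : ∀ q, S.IsRefPower q (pRef q)) (ht : S.lambdaMax < t)
    (hW : S.WeakCoupling pRef t) : x = x' := by
  choose lam hlam using h.exists_userVI hS hRef ht hW
  choose lam' hlam' using h'.exists_userVI hS hRef ht hW
  have hz : (x, lam, price) ∈ S.extSet pRef t :=
    ⟨h.mem_Yhat hS hRef ht, fun q _ => (hlam q).lam_mem, h.price_mem hS hRef ht⟩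
  have hz' : (x', lam', price') ∈ S.extSet pRef t :=
    ⟨h'.mem_Yhat hS hRef ht, fun q _ => (hlam' q).lam_mem, h'.price_mem hS hRef ht⟩
  by_contra hne
  have h1 := extMap_lt hS ht hW hz hz' hne
  have h2 := extMap_nonneg_of_userVI hlam h hz'
  have h3 := extMap_nonneg_of_userVI hlam' h' hz
  rw [← neg_sub, (S.extMap_isLinearMap _).map_neg] at h3
  linarith

end Equilibria

end CRSystem
end

/-! ### The corollary -/

theorem corollary2 {Q N : ℕ} [NeZero Q] [NeZero N] (S : CRSystem Q N) (hS : S.Valid)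
    (hne : ∀ q, (S.X q).Nonempty)
    (pRef : Fin Q → Fin N → ℝ) (hRef : ∀ q, S.IsRefPower q (pRef q))
    (t : ℝ) (ht : S.lambdaMax < t) :
    (∀ q, 0 < S.gamma1 t q ∧ 0 < S.gamma2 pRef t q) ∧
    ((∀ q, S.gamma1 t q * (⨆ k, ‖S.G q k‖ ^ 2 / S.Itot) +
        S.gamma2 pRef t q * ∑ r ∈ Finset.univ.erase q,
          ((⨆ k, ‖S.H q r k‖ ^ 2 / S.noise q k) + (⨆ k, ‖S.H r q k‖ ^ 2 / S.noise r k)) < 1) →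
      -- `A` is positive definite
      (∀ x ∈ S.Yhat pRef t, ∀ lam : Fin Q → ℝ, (∀ q, lam q ∈ Set.Icc 0 S.lambdaMax) →
        ∀ price ∈ Set.Icc 0 t, ∀ y : Fin Q × Coord N → ℝ, y ≠ 0 →
          0 < y ⬝ᵥ (S.A x lam price).mulVec y) ∧
      -- every equilibrium of the truncated game is one of the game, and one of these exists
      (∀ x price, S.IsTruncNE t x price → S.IsNE x price) ∧
      (∃ x price, S.IsNE x price) ∧
      -- equilibria lie in the region where `A` is positive definite
      (∀ x price, S.IsNE x price → x ∈ S.Yhat pRef t ∧ price ≤ t) ∧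
      -- uniqueness of the strategy component
      (∀ x price x' price', S.IsNE x price → S.IsNE x' price' → x = x')) := by
  have ht0 : 0 < t := (CRSystem.lambdaMax_pos hS).trans ht
  refine ⟨fun q => ⟨CRSystem.gamma1_pos hS ht0 q, CRSystem.gamma2_pos hS ht0 q⟩, fun hW => ?_⟩
  obtain ⟨x₀, price₀, h₀⟩ := CRSystem.exists_isTruncNE hS hne hRef ht hW
  exact ⟨fun x hx lam hl price hpr y hy => CRSystem.A_posDef hS ht hW hx hl hpr hy,
    fun x price h => h.isNE hS hRef ht,
    ⟨x₀, price₀, h₀.isNE hS hRef ht⟩,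
    fun x price h => ⟨h.mem_Yhat hS hRef ht, (h.price_mem hS hRef ht).2⟩,
    fun x price x' price' h h' => h.unique h' hS hRef ht hW⟩
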